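/- **Setting.** Let $n=m+1\ge 1$ and let $M_{\rm ask}\subset\mathbb C^n$ be a $\mathbb C^*$-invariant domain (open, connected, non-empty) on which $Z^n\neq 0$, with a holomorphic function $F$ on $M_{\rm ask}$, homogeneous of degree 2 under $\mathbb C^*$. Put $F_{AB}=\partial_A\partial_BF$, $F_{ABC}=\partial_A\partial_B\partial_CF$, $N_{AB}=\operatorname{Im}F_{AB}$, $(N^{AB})=(N_{AB})^{-1}$, and assume that the Hermitian form $\sum N_{AB}(Z)X^A\bar X^B$ is positive at $X=Z$ and negative definite on the orthogonal complement of $Z$, for all $Z\in M_{\rm ask}$ (so it has signature $(1,n-1)$). Let $M_{\rm sk}=\{z\in\mathbb C^{n-1} : (z,1)\in M_{\rm ask}\}$ with Kähler potential $K(z)=-\ln(2\sum Z^AN_{AB}(Z)\bar Z^B)|_{Z=(z,1)}$, and let $e^b=\sum_a e_a^{\,b}(z)\,dz^a$, $b=1,\dots,n-1$, be a smooth unitary coframe: $\sum_b e_a^{\,b}\,\overline{e_c^{\,b}}=\partial^2K/\partial z^a\partial\bar z^c$. Put $\Pi_A^{\,b}=(e_a^{\,b},-z^ae_a^{\,b})$.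 Let $G$ be the Lie group $\mathbb R^{2n+2}\ni(\phi,\tilde\phi,a^A,b_A)$ with multiplication $$(\phi,\tilde\phi,a,b)(\phi',\tilde\phi',a',b')=(\phi+\phi',\ \tilde\phi+e^{-2\phi}\tilde\phi'+e^{-\phi}(a^Ab'_A-a'^Ab_A),\ a+e^{-\phi}a',\ b+e^{-\phi}b').$$ On $M=M_{\rm sk}\times G$ consider, with $Z=(z,1)$, the one-forms $e^b$ and $$u=ie^{K/2+\phi}Z^A(db_A-F_{AB}da^B),\qquad v=\tfrac12e^{2\phi}\big[de^{-2\phi}+i(d\tilde\phi+b_Ada^A-a^Adb_A)\big],$$ $$E^b=-\tfrac i2e^{\phi-K/2}\Pi_A^{\,b}N^{AB}(db_B-\bar F_{BC}da^C).$$ Let $J_3$ be the almost complex structure on $M$ for which $$\mathcal U=\tfrac1{\sqrt2}\begin{pmatrix}\bar u&\bar e&-v&-E\\ \bar v&\bar E&u&e\end{pmatrix}$$ satisfies $\mathcal U\circ J_3=-i\,\mathrm{diag}(1,-1)\,\mathcal U$; equivalently, $u,\bar v,e^b,\bar E^b$ span the $(1,0)$-forms. Let $J_G(p)$ be the structure which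 $J_3$ induces on $\{p\}\times G\cong G$, $p\in M_{\rm sk}$. Let $Z_0\in M_{\rm ask}$, $\tilde C\in\mathbb C$ and $0\ne D\in\mathbb C^n$ with $\sum N_{AB}(Z_0)D^A\bar D^B=0$. Put $C_B=\sum_AD^AF_{AB}(Z_0)$ and assume that the matrix $G_{AB}(Z)=\sum_CD^CF_{ABC}(Z)$ has constant rank $r$ on $M_{\rm ask}$. Let $$M_{\rm sk}^\wedge=\{z\in M_{\rm sk} : D^AF_{AB}(z,1)=C_B\ \text{for all }B\},$$ $$N=\{(z,\phi,\tilde\phi,a,b)\in M : z\in M_{\rm sk}^\wedge,\ D^A(b_A-F_{AB}(z,1)a^B)=\tilde C\}.$$ **Proposition.** 1. $M_{\rm sk}^\wedge$ is a non-empty complex submanifold of $M_{\rm sk}$ of complex codimension $r$, and $N$ is a complex submanifold of $(M,J_3)$ of complex codimension $r+1$. 2. The equation $D^Ab_A-C_Aa^A=0$ defines a subgroup $G^\wedge\subset G$ which is a submanifold of real codimension 2. The equation $D^Ab_A-C_Aa^A=\tilde C$ has a solution in $G$. For every solution $x\in G$ and $S:=xG^\wedge$, the set $S$ is a submanifold of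 $G$ of real codimension 2, $N=M_{\rm sk}^\wedge\times S$, and $S$ is a complex hypersurface in $(G,J_G(p))$ for every $p\in M_{\rm sk}^\wedge$. 3. On $N=M_{\rm sk}^\wedge\times S$ one has $J_3=J+J_S$, where $J$ is the complex structure of $M_{\rm sk}^\wedge$ and $J_S(p)=J_G(p)|_S$, $p\in M_{\rm sk}^\wedge$, is a smooth family of complex structures on $S$, which are left-invariant on $G^\wedge$ under the identification $G^\wedge\cong S$, $h\mapsto xh$. 4. The projection $(N,J_3)\to M_{\rm sk}^\wedge$ is a holomorphic submersion, and for every $p\in M_{\rm sk}^\wedge$ its fibre $(S,J_S(p))$ is biholomorphic to $B_{\mathbb C}^{n-1}\times\mathbb C$, where $B_{\mathbb C}^{n-1}\subset\mathbb C^{n-1}$ is the open unit ball. 5. There is a fibre-preserving holomorphic embedding of $(N,J_3)$ onto an open subset of $M_{\rm sk}^\wedge\times\mathbb C^n$, that is, a map over $M_{\rm sk}^\wedge$ which is biholomorphic onto its open image. -/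

import Mathlib

open Complex Set
open scoped ContDiff ComplexConjugate

namespace CMap

noncomputable section

/-! ### Submanifolds of real vector spaces carrying an almost complex structure -/

section General

variable {V W : Type*} [NormedAddCommGroup V] [NormedSpace ℝ V]
  [NormedAddCommGroup W] [NormedSpace ℝ W]

/-- An embedded smooth submanifold of codimension `c`: around each of its points there is a smooth
chart of the ambient space which straightens it to a linear subspace of codimension `c`. -/
def IsSmoothSubmanifold (S : Set V) (c : ℕ) : Prop :=
  ∀ x ∈ S, ∃ (k : ℕ) (ψ : OpenPartialHomeomorph V (Fin k → ℝ)) (L : Submodule ℝ (Fin k → ℝ)),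
    x ∈ ψ.source ∧ ContDiffOn ℝ ∞ ψ ψ.source ∧ ContDiffOn ℝ ∞ ψ.symm ψ.target ∧
    Module.finrank ℝ L + c = k ∧ ψ '' (ψ.source ∩ S) = ψ.target ∩ (L : Set (Fin k → ℝ))

/-- A holomorphic chart, with values in `ℂᵏ`, of an open subset of `V` with respect to the field of
endomorphisms `J`. -/
def IsHolomorphicChart (J : V → V →L[ℝ] V) {k : ℕ}
    (ψ : OpenPartialHomeomorph V (Fin k → ℂ)) : Prop :=
  ContDiffOn ℝ ∞ ψ ψ.source ∧ ContDiffOn ℝ ∞ ψ.symm ψ.target ∧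
    ∀ y ∈ ψ.source, ∀ v : V, fderiv ℝ ψ y (J y v) = I • fderiv ℝ ψ y v

/-- `N` is a complex submanifold of complex codimension `c` of the open set `M ⊆ V` endowed with
`J`: around each of its points there is a holomorphic chart of `(M, J)` which straightens `N` to a
complex linear subspace of codimension `c`. -/
def IsComplexSubmanifold (J : V → V →L[ℝ] V) (M N : Set V) (c : ℕ) : Prop :=
  N ⊆ M ∧ ∀ x ∈ N, ∃ (k : ℕ) (ψ : OpenPartialHomeomorph V (Fin k → ℂ))
      (L : Submodule ℂ (Fin k → ℂ)),
    x ∈ ψ.source ∧ ψ.source ⊆ M ∧ IsHolomorphicChart J ψ ∧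
    Module.finrank ℂ L + c = k ∧ ψ '' (ψ.source ∩ N) = ψ.target ∩ (L : Set (Fin k → ℂ))

/-- The tangent space at `x` of a submanifold `X` of `V`. -/
def TSpace (X : Set V) (x : V) : Submodule ℝ V := Submodule.span ℝ (tangentConeAt ℝ X x)

/-- `f` restricts to a holomorphic map from the submanifold `X`, with the complex structure
induced by `J`, to the submanifold `Y`, with the complex structure induced by `J'`. -/
def IsHolomorphicMap (J : V → V →L[ℝ] V) (X : Set V) (J' : W → W →L[ℝ] W) (Y : Set W)
    (f : V → W) : Prop :=
  MapsTo f X Y ∧ ContDiffOn ℝ ∞ f X ∧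
    ∀ x ∈ X, ∃ f' : V →L[ℝ] W, HasFDerivWithinAt f f' X x ∧
      ∀ v ∈ TSpace X x, f' (J x v) = J' (f x) (f' v)

/-- `f` restricts to a holomorphic submersion from `(X, J)` to `(Y, J')`. -/
def IsHolomorphicSubmersion (J : V → V →L[ℝ] V) (X : Set V) (J' : W → W →L[ℝ] W) (Y : Set W)
    (f : V → W) : Prop :=
  IsHolomorphicMap J X J' Y f ∧
    ∀ x ∈ X, ∃ f' : V →L[ℝ] W, HasFDerivWithinAt f f' X x ∧
      (TSpace X x).map (f' : V →ₗ[ℝ] W) = TSpace Y (f x)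

/-- `f` restricts to a biholomorphic map from `(X, J)` onto `(Y, J')`. -/
def IsBiholomorphicMap (J : V → V →L[ℝ] V) (X : Set V) (J' : W → W →L[ℝ] W) (Y : Set W)
    (f : V → W) : Prop :=
  IsHolomorphicMap J X J' Y f ∧
    ∃ g : W → V, IsHolomorphicMap J' Y J X g ∧ LeftInvOn g f X ∧ RightInvOn g f Y

/-- `(X, J)` and `(Y, J')` are biholomorphic. -/
def AreBiholomorphic (J : V → V →L[ℝ] V) (X : Set V) (J' : W → W →L[ℝ] W) (Y : Set W) : Prop :=
  ∃ f : V → W, IsBiholomorphicMap J X J' Y f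

/-- Multiplication by `i`, the standard complex structure of a complex vector space. -/
def stdJ (W : Type*) [NormedAddCommGroup W] [NormedSpace ℝ W] [NormedSpace ℂ W]
    [IsScalarTower ℝ ℂ W] : W → W →L[ℝ] W :=
  fun _ => (I • ContinuousLinearMap.id ℂ W).restrictScalars ℝ

end General

/-- The open unit ball of `ℂᵏ` for the Hermitian norm. -/
def unitBall (k : ℕ) : Set (Fin k → ℂ) := {x | ∑ i, ‖x i‖ ^ 2 < 1}

/-! ### The solvable group `G` -/

/-- The Iwasawa subgroup `G` of `SU(1, n + 1)`, as the manifold `ℝ²ⁿ⁺²` with the global coordinates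
`(φ, φ̃, a, b)`. -/
def IwasawaGroup (n : ℕ) : Type := ℝ × ℝ × (Fin n → ℝ) × (Fin n → ℝ)

namespace IwasawaGroup

variable {n : ℕ}

instance : NormedAddCommGroup (IwasawaGroup n) :=
  inferInstanceAs (NormedAddCommGroup (ℝ × ℝ × (Fin n → ℝ) × (Fin n → ℝ)))

instance : NormedSpace ℝ (IwasawaGroup n) :=
  inferInstanceAs (NormedSpace ℝ (ℝ × ℝ × (Fin n → ℝ) × (Fin n → ℝ)))

instance : FiniteDimensional ℝ (IwasawaGroup n) :=
  inferInstanceAs (FiniteDimensional ℝ (ℝ × ℝ × (Fin n → ℝ) × (Fin n → ℝ)))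

/-- The coordinate `φ`. -/
def phi (g : IwasawaGroup n) : ℝ := g.1
/-- The coordinate `φ̃`. -/
def phit (g : IwasawaGroup n) : ℝ := g.2.1
/-- The coordinates `aᴬ`. -/
def a (g : IwasawaGroup n) : Fin n → ℝ := g.2.2.1
/-- The coordinates `b_A`. -/
def b (g : IwasawaGroup n) : Fin n → ℝ := g.2.2.2

/-- The point with given coordinates. -/
def mk (p pt : ℝ) (a b : Fin n → ℝ) : IwasawaGroup n := (p, pt, a, b)

@[simp] theorem phi_mk (p pt : ℝ) (x y : Fin n → ℝ) : (mk p pt x y).phi = p := rfl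
@[simp] theorem phit_mk (p pt : ℝ) (x y : Fin n → ℝ) : (mk p pt x y).phit = pt := rfl
@[simp] theorem a_mk (p pt : ℝ) (x y : Fin n → ℝ) : (mk p pt x y).a = x := rfl
@[simp] theorem b_mk (p pt : ℝ) (x y : Fin n → ℝ) : (mk p pt x y).b = y := rfl

theorem ext' {g h : IwasawaGroup n} (h1 : g.phi = h.phi) (h2 : g.phit = h.phit) (h3 : g.a = h.a)
    (h4 : g.b = h.b) : g = h :=
  Prod.ext h1 (Prod.ext h2 (Prod.ext h3 h4))

instance : Mul (IwasawaGroup n) where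
  mul g h := mk (g.phi + h.phi)
    (g.phit + Real.exp (-2 * g.phi) * h.phit
      + Real.exp (-g.phi) * ∑ A, (g.a A * h.b A - h.a A * g.b A))
    (g.a + Real.exp (-g.phi) • h.a) (g.b + Real.exp (-g.phi) • h.b)

instance : One (IwasawaGroup n) where
  one := mk 0 0 0 0

instance : Inv (IwasawaGroup n) where
  inv g := mk (-g.phi) (-(Real.exp (2 * g.phi) * g.phit)) (-(Real.exp g.phi • g.a))
    (-(Real.exp g.phi • g.b))

theorem mul_def (g h : IwasawaGroup n) : g * h = mk (g.phi + h.phi)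
    (g.phit + Real.exp (-2 * g.phi) * h.phit
      + Real.exp (-g.phi) * ∑ A, (g.a A * h.b A - h.a A * g.b A))
    (g.a + Real.exp (-g.phi) • h.a) (g.b + Real.exp (-g.phi) • h.b) := rfl

theorem one_def : (1 : IwasawaGroup n) = mk 0 0 0 0 := rfl

theorem inv_def (g : IwasawaGroup n) : g⁻¹ = mk (-g.phi) (-(Real.exp (2 * g.phi) * g.phit))
    (-(Real.exp g.phi • g.a)) (-(Real.exp g.phi • g.b)) := rfl

instance : Group (IwasawaGroup n) :=
  Group.ofLeftAxioms
    (by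
      intro g h k
      have e2 : Real.exp (-2 * (g.phi + h.phi)) = Real.exp (-2 * g.phi) * Real.exp (-2 * h.phi) := by
        rw [← Real.exp_add]; ring_nf
      have e1 : Real.exp (-(g.phi + h.phi)) = Real.exp (-g.phi) * Real.exp (-h.phi) := by
        rw [← Real.exp_add]; ring_nf
      have e3 : Real.exp (-2 * g.phi) = Real.exp (-g.phi) * Real.exp (-g.phi) := by
        rw [← Real.exp_add]; ring_nf
      apply ext'
      · simp only [mul_def, phi_mk]; ring
      · simp only [mul_def, phi_mk, phit_mk, a_mk, b_mk, e2, e1, e3, Pi.add_apply, Pi.smul_apply,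
          smul_eq_mul]
        simp only [mul_add, Finset.mul_sum, add_assoc, add_right_inj]
        rw [mul_assoc, add_left_comm]
        congr 1
        rw [← Finset.sum_add_distrib, ← Finset.sum_add_distrib]
        refine Finset.sum_congr rfl fun A _ => ?_
        ring
      · simp only [mul_def, phi_mk, a_mk, e1, smul_add, smul_smul, add_assoc]
      · simp only [mul_def, phi_mk, b_mk, e1, smul_add, smul_smul, add_assoc])
    (by
      intro g
      apply ext' <;> simp [mul_def, one_def])
    (by
      intro g
      have e2 : Real.exp (2 * g.phi) * Real.exp (-(2 * g.phi)) = 1 := by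
        rw [← Real.exp_add]; simp
      apply ext'
      · simp [mul_def, one_def, inv_def]
      · simp only [mul_def, one_def, inv_def, phi_mk, phit_mk, a_mk, b_mk, Pi.neg_apply,
          Pi.smul_apply, smul_eq_mul]
        rw [Finset.sum_eq_zero (fun A _ => by ring)]
        ring_nf
      · simp [mul_def, one_def, inv_def]
      · simp [mul_def, one_def, inv_def])

/-- The differential at `h` of the left translation by `g`. -/
def dLeft (g h : IwasawaGroup n) : IwasawaGroup n →L[ℝ] IwasawaGroup n :=
  fderiv ℝ (fun k => g * k) h

/-- The pull-back of a field of endomorphisms under the left translation by `x`. -/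
def pullLeft (x : IwasawaGroup n)
    (J : IwasawaGroup n → IwasawaGroup n →L[ℝ] IwasawaGroup n) :
    IwasawaGroup n → IwasawaGroup n →L[ℝ] IwasawaGroup n :=
  fun h => (dLeft x⁻¹ (x * h)).comp ((J (x * h)).comp (dLeft x h))

/-- `J` induces a left-invariant field of endomorphisms on the tangent bundle of the subgroup
`H`. -/
def IsLeftInvariantOn (H : Subgroup (IwasawaGroup n))
    (J : IwasawaGroup n → IwasawaGroup n →L[ℝ] IwasawaGroup n) : Prop :=
  (∀ h ∈ H, ∀ w ∈ TSpace (H : Set (IwasawaGroup n)) h,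
    J h w ∈ TSpace (H : Set (IwasawaGroup n)) h) ∧
  ∀ k ∈ H, ∀ h ∈ H, ∀ w ∈ TSpace (H : Set (IwasawaGroup n)) h,
    J (k * h) (dLeft k h w) = dLeft k h (J h w)

end IwasawaGroup

/-! ### Projective special Kähler domains -/

section Prepotential

variable {n : ℕ}

/-- The partial derivative `∂f/∂Zᴬ`. -/
def pd (A : Fin n) (f : (Fin n → ℂ) → ℂ) : (Fin n → ℂ) → ℂ :=
  fun Z => fderiv ℂ f Z (Pi.single A 1)

/-- The matrix `F_AB = ∂²F/∂Zᴬ∂Zᴮ`. -/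
def F2 (F : (Fin n → ℂ) → ℂ) (Z : Fin n → ℂ) : Matrix (Fin n) (Fin n) ℂ :=
  Matrix.of fun A B => pd A (pd B F) Z

/-- The third derivatives `F_ABC`. -/
def F3 (F : (Fin n → ℂ) → ℂ) (Z : Fin n → ℂ) (A B C : Fin n) : ℂ := pd A (pd B (pd C F)) Z

/-- The real matrix `N_AB = Im F_AB`. -/
def NMat (F : (Fin n → ℂ) → ℂ) (Z : Fin n → ℂ) : Matrix (Fin n) (Fin n) ℝ :=
  Matrix.of fun A B => (F2 F Z A B).im

/-- The Hermitian form `∑ N_AB(Z) Xᴬ conj(Yᴮ)`. -/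
def herm (F : (Fin n → ℂ) → ℂ) (Z X Y : Fin n → ℂ) : ℂ :=
  ∑ A, ∑ B, (NMat F Z A B : ℂ) * X A * conj (Y B)

/-- The matrix `G_AB(Z) = ∑_C Dᶜ F_ABC(Z)`. -/
def GMat (F : (Fin n → ℂ) → ℂ) (D Z : Fin n → ℂ) : Matrix (Fin n) (Fin n) ℂ :=
  Matrix.of fun A B => ∑ C, D C * F3 F Z A B C

end Prepotential

/-- A projective special Kähler domain of complex dimension `m`, in terms of the corresponding
conical affine special Kähler domain `Mask ⊆ ℂⁿ`, `n = m + 1`, and its holomorphic prepotential.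
The affine special Kähler metric has signature `(1, n - 1)` and is positive in the direction of the
position vector `Z`; equivalently, the projective special Kähler metric is defined and positive
definite. -/
structure SpecialKahlerDomain (m : ℕ) where
  /-- The affine special Kähler domain. -/
  Mask : Set (Fin (m + 1) → ℂ)
  /-- The prepotential. -/
  F : (Fin (m + 1) → ℂ) → ℂ
  isOpen_Mask : IsOpen Mask
  isConnected_Mask : IsConnected Mask
  smul_mem : ∀ Z ∈ Mask, ∀ t : ℂ, t ≠ 0 → t • Z ∈ Mask
  last_ne_zero : ∀ Z ∈ Mask, Z (Fin.last m) ≠ 0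
  holomorphic : AnalyticOnNhd ℂ F Mask
  homogeneous : ∀ Z ∈ Mask, ∀ t : ℂ, t ≠ 0 → F (t • Z) = t ^ 2 * F Z
  herm_pos : ∀ Z ∈ Mask, 0 < (herm F Z Z Z).re
  herm_neg : ∀ Z ∈ Mask, ∀ X : Fin (m + 1) → ℂ, X ≠ 0 → herm F Z X Z = 0 → (herm F Z X X).re < 0

/-- The point `(z, 1)` of `ℂⁿ`. -/
def hom {m : ℕ} (z : Fin m → ℂ) : Fin (m + 1) → ℂ := Fin.snoc (α := fun _ => ℂ) z 1

/-- The Wirtinger derivative `∂f/∂zᵃ`. -/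
def wirt {m : ℕ} (a : Fin m) (f : (Fin m → ℂ) → ℂ) (z : Fin m → ℂ) : ℂ :=
  (1 / 2) * (fderiv ℝ f z (Pi.single a 1) - I * fderiv ℝ f z (Pi.single a I))

/-- The Wirtinger derivative `∂f/∂z̄ᵃ`. -/
def wirtBar {m : ℕ} (a : Fin m) (f : (Fin m → ℂ) → ℂ) (z : Fin m → ℂ) : ℂ :=
  (1 / 2) * (fderiv ℝ f z (Pi.single a 1) + I * fderiv ℝ f z (Pi.single a I))

/-- The manifold `ℂᵐ × G`, `n = m + 1`, which contains `M = M_sk × G` as an open subset. It serves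
also as the tangent space of `M`. -/
abbrev Ambient (m : ℕ) : Type := (Fin m → ℂ) × IwasawaGroup (m + 1)

namespace SpecialKahlerDomain

variable {m : ℕ} (P : SpecialKahlerDomain m)

/-- The projective special Kähler domain `M_sk` in the coordinates `zᵃ = Zᵃ / Zⁿ`. -/
def Msk : Set (Fin m → ℂ) := {z | hom z ∈ P.Mask}

/-- The matrix `F_AB` at `Z = (z, 1)`. -/
def FAB (z : Fin m → ℂ) : Matrix (Fin (m + 1)) (Fin (m + 1)) ℂ := F2 P.F (hom z)

/-- The matrix `N_AB` at `Z = (z, 1)`. -/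
def NAB (z : Fin m → ℂ) : Matrix (Fin (m + 1)) (Fin (m + 1)) ℝ := NMat P.F (hom z)

/-- The Kähler potential `K(z) = -ln (2 Zᴬ N_AB conj(Zᴮ))`, `Z = (z, 1)`. -/
def K (z : Fin m → ℂ) : ℝ := -Real.log (2 * (herm P.F (hom z) (hom z) (hom z)).re)

/-- The coefficients `∂²K/∂zᵃ∂z̄ᶜ` of the projective special Kähler metric. -/
def metric (z : Fin m → ℂ) (a c : Fin m) : ℂ :=
  wirt a (wirtBar c (fun y => (P.K y : ℂ))) z

/-- `e z a b = e_a^b(z)` is a vielbein on `M_sk`: the forms `e^b = ∑_a e_a^b dzᵃ` are a smooth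
unitary coframe for the projective special Kähler metric. -/
structure IsVielbein (e : (Fin m → ℂ) → Fin m → Fin m → ℂ) : Prop where
  smooth : ContDiffOn ℝ ∞ e P.Msk
  det_ne_zero : ∀ z ∈ P.Msk, (Matrix.of (e z)).det ≠ 0
  unitary : ∀ z ∈ P.Msk, ∀ a c, ∑ b, e z a b * conj (e z c b) = P.metric z a c

/-- The `c`-map space `M = M_sk × G`. -/
def M : Set (Ambient m) := P.Msk ×ˢ univ

/-- The matrix `Π_A^b = (e_a^b, -zᵃ e_a^b)`. -/
def PiMat (e : (Fin m → ℂ) → Fin m → Fin m → ℂ) (z : Fin m → ℂ) (A : Fin (m + 1)) (b : Fin m) : ℂ :=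
  Fin.snoc (α := fun _ => ℂ) (fun a => e z a b) (-∑ a, z a * e z a b) A

/-- The one-form `u = i e^{K/2 + φ} Zᴬ (db_A - F_AB daᴮ)` at `q`, applied to `X`. -/
def formU (q X : Ambient m) : ℂ :=
  I * (Real.exp (P.K q.1 / 2 + q.2.phi) : ℂ) *
    ∑ A, hom q.1 A * ((X.2.b A : ℂ) - ∑ B, P.FAB q.1 A B * (X.2.a B : ℂ))

/-- The one-form `v = ½ e^{2φ} (d e^{-2φ} + i (dφ̃ + b_A daᴬ - aᴬ db_A))` at `q`, applied to `X`.
The sign in front of `i` is the one for which `dv̄ = - v ∧ v̄ + ū ∧ u - E ∧ Ē` holds. -/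
def formV {m : ℕ} (q X : Ambient m) : ℂ :=
  (1 / 2) * (Real.exp (2 * q.2.phi) : ℂ) *
    (((-2 * Real.exp (-2 * q.2.phi) * X.2.phi : ℝ) : ℂ) +
      I * ((X.2.phit + ∑ A, (q.2.b A * X.2.a A - q.2.a A * X.2.b A) : ℝ) : ℂ))

/-- The one-form `E^b = -(i/2) e^{φ - K/2} Π_A^b Nᴬᴮ (db_B - conj(F_BC) daᶜ)` at `q`, applied to
`X`; here `(Nᴬᴮ)` is the inverse of `(N_AB)`. -/
def formE (e : (Fin m → ℂ) → Fin m → Fin m → ℂ) (q : Ambient m) (b : Fin m) (X : Ambient m) : ℂ :=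
  -(I / 2) * (Real.exp (q.2.phi - P.K q.1 / 2) : ℂ) *
    ∑ A, ∑ B, PiMat e q.1 A b * ((P.NAB q.1)⁻¹ A B : ℂ) *
      ((X.2.b B : ℂ) - ∑ C, conj (P.FAB q.1 B C) * (X.2.a C : ℂ))

/-- The one-form `e^b = e_a^b dzᵃ` at `q`, applied to `X`. -/
def forme (e : (Fin m → ℂ) → Fin m → Fin m → ℂ) (q : Ambient m) (b : Fin m) (X : Ambient m) : ℂ :=
  ∑ a, e q.1 a b * X.1 a

/-- The quaternionic vielbein at `q`, a `2 × 2n`-matrix of one-forms, applied to `X`: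
its rows are `(ū, ē, -v, -E) / √2` and `(v̄, Ē, u, e) / √2`. -/
def quatVielbein (e : (Fin m → ℂ) → Fin m → Fin m → ℂ) (q X : Ambient m) :
    Matrix (Fin 2) ((Unit ⊕ Fin m) ⊕ (Unit ⊕ Fin m)) ℂ :=
  (1 / (Real.sqrt 2 : ℂ)) • Matrix.of ![
    Sum.elim (Sum.elim (fun _ => conj (P.formU q X)) (fun b => conj (forme e q b X)))
      (Sum.elim (fun _ => -formV q X) (fun b => -P.formE e q b X)),
    Sum.elim (Sum.elim (fun _ => conj (formV q X)) (fun b => conj (P.formE e q b X)))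
      (Sum.elim (fun _ => P.formU q X) (fun b => forme e q b X))]

/-- The third Pauli matrix. -/
def sigma3 : Matrix (Fin 2) (Fin 2) ℂ := !![1, 0; 0, -1]

/-- The condition `𝒰 ∘ J = -i σ₃ 𝒰` on an endomorphism `J` of the tangent space at `q`. -/
def IsJ3At (e : (Fin m → ℂ) → Fin m → Fin m → ℂ) (q : Ambient m)
    (J : Ambient m →L[ℝ] Ambient m) : Prop :=
  ∀ X, P.quatVielbein e q (J X) = (-I) • (sigma3 * P.quatVielbein e q X)

/-- The almost complex structure `J₃` on `M`, determined by `𝒰 ∘ J₃ = -i σ₃ 𝒰`; see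
`existsUnique_isJ3At`. -/
def J3 (e : (Fin m → ℂ) → Fin m → Fin m → ℂ) (q : Ambient m) : Ambient m →L[ℝ] Ambient m :=
  Classical.epsilon (P.IsJ3At e q)

/-! The almost complex structure `J₃` exists and is unique at every point of `M`. -/

theorem det_NAB_ne_zero {z : Fin m → ℂ} (hz : z ∈ P.Msk) : (P.NAB z).det ≠ 0 := by
  intro h
  obtain ⟨v, hv, hv0⟩ := Matrix.exists_vecMul_eq_zero_iff.mpr h
  have key : ∀ Y, herm P.F (hom z) (fun A => (v A : ℂ)) Y = 0 := by
    intro Y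
    unfold herm
    rw [Finset.sum_comm]
    refine Finset.sum_eq_zero fun B _ => ?_
    rw [← Finset.sum_mul]
    have h1 : ∑ A, v A * P.NAB z A B = 0 := congrFun hv0 B
    have h2 : ∑ A, ((NMat P.F (hom z) A B : ℝ) : ℂ) * (v A : ℂ) = 0 := by
      have h3 : ((∑ A, v A * P.NAB z A B : ℝ) : ℂ) = 0 := by rw [h1]; simp
      rw [← h3]
      push_cast
      refine Finset.sum_congr rfl fun A _ => ?_
      rw [mul_comm]; rfl
    rw [h2, zero_mul]
  have hv' : (fun A => (v A : ℂ)) ≠ 0 := by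
    intro h0
    apply hv
    funext A
    have := congrFun h0 A
    simpa using this
  have := P.herm_neg (hom z) hz _ hv' (key _)
  rw [key] at this
  simp at this

/-- The `(1,0)`-forms `e^b, u, v̄, Ē^b` of `J₃`, as a real linear map. -/
def formMap (e : (Fin m → ℂ) → Fin m → Fin m → ℂ) (q : Ambient m) :
    Ambient m →ₗ[ℝ] (Fin m → ℂ) × ℂ × ℂ × (Fin m → ℂ) where
  toFun X := (fun b => forme e q b X, P.formU q X, conj (formV q X),
    fun b => conj (P.formE e q b X))
  map_add' X Y := by
    have ha : ∀ A, (X + Y).2.a A = X.2.a A + Y.2.a A := fun _ => rfl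
    have hb : ∀ A, (X + Y).2.b A = X.2.b A + Y.2.b A := fun _ => rfl
    have hp : (X + Y).2.phi = X.2.phi + Y.2.phi := rfl
    have ht : (X + Y).2.phit = X.2.phit + Y.2.phit := rfl
    have h1 : ∀ b, forme e q b (X + Y) = forme e q b X + forme e q b Y := fun b => by
      simp [forme, mul_add, Finset.sum_add_distrib]
    have h2 : P.formU q (X + Y) = P.formU q X + P.formU q Y := by
      simp only [formU, ha, hb, Complex.ofReal_add, ← Finset.sum_add_distrib, ← mul_add]
      congr 1
      refine Finset.sum_congr rfl fun A _ => ?_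
      simp only [mul_add, Finset.sum_add_distrib]
      ring
    have h3 : formV q (X + Y) = formV q X + formV q Y := by
      have : ∑ A, (q.2.b A * (X.2.a A + Y.2.a A) - q.2.a A * (X.2.b A + Y.2.b A)) =
          ∑ A, (q.2.b A * X.2.a A - q.2.a A * X.2.b A) +
          ∑ A, (q.2.b A * Y.2.a A - q.2.a A * Y.2.b A) := by
        rw [← Finset.sum_add_distrib]
        exact Finset.sum_congr rfl fun A _ => by ring
      simp only [formV, ha, hb, hp, ht, this]
      push_cast
      ring
    have h4 : ∀ b, P.formE e q b (X + Y) = P.formE e q b X + P.formE e q b Y := fun b => by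
      simp only [formE, ha, hb, Complex.ofReal_add, ← Finset.sum_add_distrib, ← mul_add]
      congr 1
      refine Finset.sum_congr rfl fun A _ => Finset.sum_congr rfl fun B _ => ?_
      simp only [mul_add, Finset.sum_add_distrib]
      ring
    refine Prod.ext (funext h1) (Prod.ext h2 (Prod.ext ?_ (funext fun b => ?_)))
    · exact (congrArg _ h3).trans (map_add _ _ _)
    · exact (congrArg _ (h4 b)).trans (map_add _ _ _)
  map_smul' c X := by
    have ha : ∀ A, (c • X).2.a A = c * X.2.a A := fun _ => rfl
    have hb : ∀ A, (c • X).2.b A = c * X.2.b A := fun _ => rfl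
    have hp : (c • X).2.phi = c * X.2.phi := rfl
    have ht : (c • X).2.phit = c * X.2.phit := rfl
    have hs : ∀ (f : Fin (m + 1) → ℂ) (x : Fin (m + 1) → ℝ),
        ∑ A, f A * ((c * x A : ℝ) : ℂ) = (c : ℂ) * ∑ A, f A * (x A : ℂ) := fun f x => by
      rw [Finset.mul_sum]
      refine Finset.sum_congr rfl fun A _ => ?_
      push_cast
      ring
    have h1 : ∀ b, forme e q b (c • X) = (c : ℂ) * forme e q b X := fun b => by
      simp only [forme, Prod.smul_fst, Pi.smul_apply, Complex.real_smul, Finset.mul_sum]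
      exact Finset.sum_congr rfl fun A _ => by ring
    have h2 : P.formU q (c • X) = (c : ℂ) * P.formU q X := by
      simp only [formU, ha, hb, hs]
      rw [mul_left_comm]
      congr 1
      rw [Finset.mul_sum]
      refine Finset.sum_congr rfl fun A _ => ?_
      push_cast
      ring
    have h3 : formV q (c • X) = (c : ℂ) * formV q X := by
      have : ∑ A, (q.2.b A * (c * X.2.a A) - q.2.a A * (c * X.2.b A)) =
          c * ∑ A, (q.2.b A * X.2.a A - q.2.a A * X.2.b A) := by
        rw [Finset.mul_sum]
        exact Finset.sum_congr rfl fun A _ => by ring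
      simp only [formV, ha, hb, hp, ht, this]
      push_cast
      ring
    have h4 : ∀ b, P.formE e q b (c • X) = (c : ℂ) * P.formE e q b X := fun b => by
      simp only [formE, ha, hb, hs]
      rw [mul_left_comm]
      congr 1
      rw [Finset.mul_sum]
      refine Finset.sum_congr rfl fun A _ => ?_
      rw [Finset.mul_sum]
      refine Finset.sum_congr rfl fun B _ => ?_
      push_cast
      ring
    have hc : ∀ w : ℂ, conj ((c : ℂ) * w) = c • conj w := fun w => by simp
    refine Prod.ext (funext fun b => ?_) (Prod.ext ?_ (Prod.ext ?_ (funext fun b => ?_)))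
    · exact (h1 b).trans (Complex.real_smul).symm
    · exact h2.trans (Complex.real_smul).symm
    · exact (congrArg _ h3).trans (hc _)
    · exact (congrArg _ (h4 b)).trans (hc _)

variable {P} in
theorem formMap_injective {e : (Fin m → ℂ) → Fin m → Fin m → ℂ} (he : P.IsVielbein e)
    {q : Ambient m} (hq : q.1 ∈ P.Msk) : Function.Injective (P.formMap e q) := by
  rw [injective_iff_map_eq_zero]
  intro X hX
  have hN : IsUnit (P.NAB q.1).det := isUnit_iff_ne_zero.mpr (P.det_NAB_ne_zero hq)
  have h1 : ∀ b, forme e q b X = 0 := fun b => congrFun (congrArg Prod.fst hX) b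
  have h2 : P.formU q X = 0 := congrArg (fun t => t.2.1) hX
  have h3 : formV q X = 0 := by
    have : conj (formV q X) = 0 := congrArg (fun t => t.2.2.1) hX
    simpa using this
  have h4 : ∀ b, conj (P.formE e q b X) = 0 :=
    fun b => congrFun (congrArg (fun t => t.2.2.2) hX) b
  have hX1 : X.1 = 0 := by
    apply Matrix.eq_zero_of_vecMul_eq_zero (he.det_ne_zero q.1 hq)
    funext b
    have := h1 b
    simp only [forme] at this
    simp only [Matrix.vecMul, dotProduct, Matrix.of_apply, Pi.zero_apply]
    rw [← this]
    exact Finset.sum_congr rfl fun a _ => mul_comm _ _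
  -- the complex vector `η = db - F da`
  set η : Fin (m + 1) → ℂ := fun A => (X.2.b A : ℂ) - ∑ B, P.FAB q.1 A B * (X.2.a B : ℂ) with hη
  have hu : ∑ A, hom q.1 A * η A = 0 := by
    simp only [formU] at h2
    rcases mul_eq_zero.mp h2 with h | h
    · exact absurd h (mul_ne_zero I_ne_zero (ofReal_ne_zero.mpr (Real.exp_pos _).ne'))
    · exact h
  set Nc : Matrix (Fin (m + 1)) (Fin (m + 1)) ℂ := (P.NAB q.1).map Complex.ofReal with hNc
  set Ni : Matrix (Fin (m + 1)) (Fin (m + 1)) ℂ := (P.NAB q.1)⁻¹.map Complex.ofReal with hNi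
  have hNN : Nc * Ni = 1 := by
    have := congrArg (fun T : Matrix (Fin (m + 1)) (Fin (m + 1)) ℝ => T.map Complex.ofRealHom)
      (Matrix.mul_nonsing_inv (P.NAB q.1) hN)
    simp only [Matrix.map_mul] at this
    rw [hNc, hNi]
    refine Eq.trans ?_ (this.trans ?_)
    · rfl
    · simp
  set ξ : Fin (m + 1) → ℂ := Ni.mulVec η with hξ
  have hNξ : Nc.mulVec ξ = η := by
    rw [hξ, Matrix.mulVec_mulVec, hNN, Matrix.one_mulVec]
  have hE : ∀ b, ∑ A, conj (PiMat e q.1 A b) * ξ A = 0 := by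
    intro b
    have := h4 b
    simp only [formE, map_mul] at this
    rcases mul_eq_zero.mp this with h | h
    · exfalso
      revert h
      simp
    · rw [← h, map_sum]
      refine Finset.sum_congr rfl fun A _ => ?_
      rw [map_sum]
      simp only [hξ, Matrix.mulVec, dotProduct, Finset.mul_sum]
      refine Finset.sum_congr rfl fun B _ => ?_
      simp [hη, hNi, mul_assoc]
  have hξa : ∀ a : Fin m, ξ a.castSucc = conj (q.1 a) * ξ (Fin.last m) := by
    have : (fun a : Fin m => conj (ξ a.castSucc) - q.1 a * conj (ξ (Fin.last m))) = 0 := by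
      apply Matrix.eq_zero_of_vecMul_eq_zero (he.det_ne_zero q.1 hq)
      funext b
      have hb := congrArg conj (hE b)
      rw [Fin.sum_univ_castSucc] at hb
      simp only [PiMat, Fin.snoc_castSucc, Fin.snoc_last, map_add, map_sum, map_mul, map_neg,
        Complex.conj_conj, map_zero] at hb
      simp only [Matrix.vecMul, dotProduct, Matrix.of_apply, Pi.zero_apply]
      rw [← hb, neg_mul, Finset.sum_mul, ← sub_eq_add_neg, ← Finset.sum_sub_distrib]
      exact Finset.sum_congr rfl fun a _ => by ring
    intro a
    have ha := congrArg conj (congrFun this a)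
    simp only [map_sub, map_mul, Complex.conj_conj, Pi.zero_apply, map_zero] at ha
    exact sub_eq_zero.mp ha
  have hξZ : ∀ A, ξ A = ξ (Fin.last m) * conj (hom q.1 A) := by
    intro A
    refine Fin.lastCases ?_ (fun a => ?_) A
    · simp [hom]
    · rw [hξa a]; simp [hom, mul_comm]
  have hlast : ξ (Fin.last m) = 0 := by
    have h5 : ξ (Fin.last m) * herm P.F (hom q.1) (hom q.1) (hom q.1) = 0 := by
      rw [← hu, ← hNξ]
      unfold herm
      rw [Finset.mul_sum]
      refine Finset.sum_congr rfl fun A _ => ?_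
      simp only [Matrix.mulVec, dotProduct, Finset.mul_sum]
      refine Finset.sum_congr rfl fun B _ => ?_
      rw [hξZ B]
      simp only [hNc, Matrix.map_apply, NAB]
      ring
    rcases mul_eq_zero.mp h5 with h | h
    · exact h
    · have := P.herm_pos (hom q.1) hq
      rw [h] at this
      simp at this
  have hη0 : η = 0 := by
    rw [← hNξ]
    have : ξ = 0 := by
      funext A
      rw [hξZ A, hlast, zero_mul]; rfl
    rw [this, Matrix.mulVec_zero]
  have hXa : X.2.a = 0 := by
    apply Matrix.eq_zero_of_mulVec_eq_zero (P.det_NAB_ne_zero hq)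
    funext A
    have := congrArg Complex.im (congrFun hη0 A)
    simp only [hη, Complex.sub_im, Complex.ofReal_im, Complex.im_sum, Complex.mul_im,
      Complex.ofReal_re, mul_zero, zero_add, Pi.zero_apply, Complex.zero_im, zero_sub,
      neg_eq_zero] at this
    simp only [Matrix.mulVec, dotProduct, Pi.zero_apply]
    rw [← this]
    rfl
  have hXb : X.2.b = 0 := by
    funext A
    have := congrFun hη0 A
    simpa [hη, hXa] using this
  have hV : ((-2 * Real.exp (-2 * q.2.phi) * X.2.phi : ℝ) : ℂ) + I * ((X.2.phit : ℝ) : ℂ) = 0 := by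
    simp only [formV, hXa, hXb] at h3
    rcases mul_eq_zero.mp h3 with h | h
    · exact absurd h (mul_ne_zero (by norm_num) (ofReal_ne_zero.mpr (Real.exp_pos _).ne'))
    · simpa using h
  have hp : X.2.phi = 0 := by
    have := congrArg Complex.re hV
    simp only [Complex.add_re, Complex.ofReal_re, Complex.mul_re, Complex.I_re, Complex.I_im,
      Complex.ofReal_im, Complex.zero_re] at this
    have h6 : (-2 * Real.exp (-2 * q.2.phi)) * X.2.phi = 0 := by linarith
    rcases mul_eq_zero.mp h6 with h | h
    · exact absurd h (mul_ne_zero (by norm_num) (Real.exp_pos _).ne')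
    · exact h
  have ht : X.2.phit = 0 := by
    have := congrArg Complex.im hV
    simp only [Complex.add_im, Complex.ofReal_re, Complex.mul_im, Complex.I_re, Complex.I_im,
      Complex.ofReal_im, Complex.zero_im] at this
    linarith
  exact Prod.ext hX1 (IwasawaGroup.ext' hp ht hXa hXb)

variable {P} in
theorem isJ3At_iff {e : (Fin m → ℂ) → Fin m → Fin m → ℂ} {q : Ambient m}
    {J : Ambient m →L[ℝ] Ambient m} :
    P.IsJ3At e q J ↔ ∀ X, P.formMap e q (J X) = I • P.formMap e q X := by
  have h2 : (1 / (Real.sqrt 2 : ℂ)) ≠ 0 := by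
    simp
  refine forall_congr' fun X => ?_
  rw [quatVielbein, quatVielbein, Matrix.mul_smul, smul_comm, smul_right_inj h2]
  constructor
  · intro h
    refine Prod.ext ?_ (Prod.ext ?_ (Prod.ext ?_ ?_))
    · funext b
      have := congrFun (congrFun h 1) (Sum.inr (Sum.inr b))
      simpa [sigma3, Matrix.mul_apply, formMap] using this
    · have := congrFun (congrFun h 1) (Sum.inr (Sum.inl ()))
      simpa [sigma3, Matrix.mul_apply, formMap] using this
    · have := congrFun (congrFun h 1) (Sum.inl (Sum.inl ()))
      simpa [sigma3, Matrix.mul_apply, formMap] using this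
    · funext b
      have := congrFun (congrFun h 1) (Sum.inl (Sum.inr b))
      simpa [sigma3, Matrix.mul_apply, formMap] using this
  · intro h
    have h1 : ∀ b, forme e q b (J X) = I * forme e q b X :=
      fun b => congrFun (congrArg Prod.fst h) b
    have h2 : P.formU q (J X) = I * P.formU q X := congrArg (fun t => t.2.1) h
    have h3 : conj (formV q (J X)) = I * conj (formV q X) := congrArg (fun t => t.2.2.1) h
    have h4 : ∀ b, conj (P.formE e q b (J X)) = I * conj (P.formE e q b X) :=
      fun b => congrFun (congrArg (fun t => t.2.2.2) h) b
    have h3' : formV q (J X) = -I * formV q X := by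
      have := congrArg conj h3; simpa using this
    have h4' : ∀ b, P.formE e q b (J X) = -I * P.formE e q b X := by
      intro b
      have := congrArg conj (h4 b); simpa using this
    funext i k
    fin_cases i <;> rcases k with (k | k) | (k | k) <;>
      simp [sigma3, h1, h2, h3', h4']

variable {P} in
/-- At each point of `M` there is exactly one endomorphism `J₃` with `𝒰 ∘ J₃ = -i σ₃ 𝒰`. -/
theorem existsUnique_isJ3At {e : (Fin m → ℂ) → Fin m → Fin m → ℂ} (he : P.IsVielbein e)
    {q : Ambient m} (hq : q ∈ P.M) : ∃! J, P.IsJ3At e q J := by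
  have hinj := formMap_injective he hq.1
  have hdim : Module.finrank ℝ (Ambient m) =
      Module.finrank ℝ ((Fin m → ℂ) × ℂ × ℂ × (Fin m → ℂ)) := by
    have h1 : Module.finrank ℝ (IwasawaGroup (m + 1)) =
        Module.finrank ℝ (ℝ × ℝ × (Fin (m + 1) → ℝ) × (Fin (m + 1) → ℝ)) := rfl
    have h2 : Module.finrank ℝ (Fin m → ℂ) = m * 2 := by
      rw [Module.finrank_pi_fintype]; simp
    simp only [Module.finrank_prod, h1, h2, Module.finrank_self, Complex.finrank_real_complex,
      Module.finrank_fin_fun]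
    ring
  let Φ : Ambient m ≃ₗ[ℝ] ((Fin m → ℂ) × ℂ × ℂ × (Fin m → ℂ)) :=
    LinearEquiv.ofInjectiveOfFinrankEq (P.formMap e q) hinj hdim
  have hΦ : ∀ X, Φ X = P.formMap e q X := fun X => rfl
  let mulI : ((Fin m → ℂ) × ℂ × ℂ × (Fin m → ℂ)) →ₗ[ℝ] ((Fin m → ℂ) × ℂ × ℂ × (Fin m → ℂ)) :=
    (I • (LinearMap.id : _ →ₗ[ℂ] ((Fin m → ℂ) × ℂ × ℂ × (Fin m → ℂ)))).restrictScalars ℝ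
  let J : Ambient m →ₗ[ℝ] Ambient m := Φ.symm.toLinearMap ∘ₗ mulI ∘ₗ Φ.toLinearMap
  refine ⟨LinearMap.toContinuousLinearMap J, ?_, ?_⟩
  · refine isJ3At_iff.mpr fun X => ?_
    rw [← hΦ, ← hΦ]
    exact Φ.apply_symm_apply _
  · intro J' hJ'
    refine ContinuousLinearMap.ext fun X => hinj ?_
    rw [isJ3At_iff.mp hJ' X, ← hΦ, ← hΦ]
    exact (Φ.apply_symm_apply _).symm

variable {P} in
theorem J3_spec {e : (Fin m → ℂ) → Fin m → Fin m → ℂ} (he : P.IsVielbein e)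
    {q : Ambient m} (hq : q ∈ P.M) : P.IsJ3At e q (P.J3 e q) :=
  Classical.epsilon_spec (existsUnique_isJ3At he hq).exists

/-- The field of endomorphisms `J_G(p)` on `G` induced by `J₃` on the fibre `{p} × G`. -/
def JG (e : (Fin m → ℂ) → Fin m → Fin m → ℂ) (p : Fin m → ℂ) (g : IwasawaGroup (m + 1)) :
    IwasawaGroup (m + 1) →L[ℝ] IwasawaGroup (m + 1) :=
  (ContinuousLinearMap.snd ℝ _ _).comp
    ((P.J3 e (p, g)).comp (ContinuousLinearMap.inr ℝ (Fin m → ℂ) (IwasawaGroup (m + 1))))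

/-- The subset of `M_sk` defined by `Dᴬ F_AB = C_B`. -/
def MskHat (D C : Fin (m + 1) → ℂ) : Set (Fin m → ℂ) :=
  {z | z ∈ P.Msk ∧ ∀ B, ∑ A, D A * P.FAB z A B = C B}

/-- The subset `N` of `M` defined by `Dᴬ F_AB = C_B` and `Dᴬ (b_A - F_AB aᴮ) = C̃`. -/
def N (D C : Fin (m + 1) → ℂ) (Ct : ℂ) : Set (Ambient m) :=
  {q | q ∈ P.M ∧ (∀ B, ∑ A, D A * P.FAB q.1 A B = C B) ∧
    ∑ A, D A * ((q.2.b A : ℂ) - ∑ B, P.FAB q.1 A B * (q.2.a B : ℂ)) = Ct}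

end SpecialKahlerDomain

/-- The subset of `G` defined by the affine equation `Dᴬ b_A - C_A aᴬ = c`. -/
def affineSet {n : ℕ} (D C : Fin n → ℂ) (c : ℂ) : Set (IwasawaGroup n) :=
  {g | ∑ A, D A * (g.b A : ℂ) - ∑ A, C A * (g.a A : ℂ) = c}

end

end CMap

open CMap

/-! Everything rests on one global holomorphic chart of $(M,J_3)$. The forms $e^b$ are complex
combinations of the $dz^a$, while $u$ and $\bar E^b$ are complex combinations of
$\eta_A=db_A-F_{AB}da^B$. Hence $J_3$ is characterised by saying that $dz^a,\eta_A,\bar v$ are of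
type $(1,0)$ (`formMap_eq_of_eta_eq`, `J3_forms`). Put $w_A=b_A-F_{AB}a^B$ and
$\tau=e^{-2\phi}-i\tilde\phi-ia^Aw_A$. Modulo complex multiples of the $dz^a$, $dw_A=\eta_A$ and
$d\tau=2e^{-2\phi}\bar v-2ia^A\eta_A$, so $(z,w,\tau)$ are holomorphic coordinates
(`isHolChart_holChart`). Their image is cut out by $z\in M_{\rm sk}$ and
$\operatorname{Re}\tau+\operatorname{Im}w\,N^{-1}\operatorname{Im}w>0$, the left side being
$e^{-2\phi}$.

In these coordinates $N$ is given by $D^AF_{AB}(z)=C_B$ and $D^Aw_A=\tilde C$. The first system is a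
level set of a holomorphic map whose rank is that of $G_{AB}$ (`rank_fderiv_levelMap`), and the
constant rank theorem `exists_straightening` applies. On its solution set the second equation reads
$D^Ab_A-C_Aa^A=\tilde C$, with no $z$ left in it, whence the product structure (`N_eq`). Its left
side $\ell$ satisfies $\ell(gh)=\ell(g)+e^{-\phi(g)}\ell(h)$ (`groupForm_mul`), so the zero set is a
subgroup and the other level sets are its left cosets. Since $\eta$ and $v$ do not involve $dz$,
$J_3$ is block diagonal (`J3_apply`). Left translations multiply $\eta$ by a positive constant and
preserve $v$, so $J_G(p)$ is left-invariant (`JG_mul`).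

For the fibres, $N(D,\bar D)=\operatorname{Im}(C_B\bar D^B)$ on $M_{\rm sk}^\wedge$, so $D$ is null
at every one of its points (`herm_eq_of_sum_eq`). Writing $w=w_0+N\xi$ turns $D^Aw_A=\tilde C$ into
orthogonality of $\xi$ to the null vector $\bar D$. On that complement the form is negative
semidefinite with radical $\mathbb C\bar D$ (`exists_null_coordinates`). A holomorphic quadratic
shear of $\tau$ absorbs the pluriharmonic part of $\operatorname{Im}w\,N^{-1}\operatorname{Im}w$,
and the fibre becomes a Siegel domain $\sum|v_i|^2<\operatorname{Re}\sigma$ times the line of the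
radical (`exists_fibre_coordinates`). The Cayley transform makes the Siegel domain a ball. For the
embedding, $D^Aw_A=\tilde C$ allows one coordinate $w_A$ with $D^A\ne0$ to be discarded
(`exists_embedding`). -/

namespace CMap

/-! ### Holomorphic charts and maps for a field of endomorphisms. -/

section HolomorphicCharts

variable {V E E' W : Type*} [NormedAddCommGroup V] [NormedSpace ℝ V]
  [NormedAddCommGroup E] [NormedSpace ℝ E] [NormedSpace ℂ E] [IsScalarTower ℝ ℂ E]
  [NormedAddCommGroup E'] [NormedSpace ℝ E'] [NormedSpace ℂ E'] [IsScalarTower ℝ ℂ E']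
  [NormedAddCommGroup W] [NormedSpace ℝ W] [NormedSpace ℂ W] [IsScalarTower ℝ ℂ W]

/-- A holomorphic chart with values in an arbitrary complex normed space. -/
structure IsHolChart (J : V → V →L[ℝ] V) (ψ : OpenPartialHomeomorph V E) : Prop where
  smooth : ContDiffOn ℝ ∞ ψ ψ.source
  smooth_symm : ContDiffOn ℝ ∞ ψ.symm ψ.target
  comm : ∀ y ∈ ψ.source, ∀ v : V, fderiv ℝ ψ y (J y v) = I • fderiv ℝ ψ y v

/-- A local biholomorphism between complex normed spaces. -/
structure IsBihol (φ : OpenPartialHomeomorph E E') : Prop where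
  hol : ContDiffOn ℂ ∞ φ φ.source
  hol_symm : ContDiffOn ℂ ∞ φ.symm φ.target

theorem fderiv_real_I_smul {f : E → E'} {x : E} (hf : DifferentiableAt ℂ f x) (v : E) :
    fderiv ℝ f x (I • v) = I • fderiv ℝ f x v := by
  rw [hf.fderiv_restrictScalars ℝ]
  simp

theorem IsBihol.isHolChart {φ : OpenPartialHomeomorph E E'} (h : IsBihol φ) :
    IsHolChart (stdJ E) φ where
  smooth := h.hol.restrict_scalars ℝ
  smooth_symm := h.hol_symm.restrict_scalars ℝ
  comm y hy v := by
    have : DifferentiableAt ℂ φ y :=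
      (h.hol.contDiffAt (φ.open_source.mem_nhds hy)).differentiableAt (by simp)
    exact fderiv_real_I_smul this v

theorem IsHolChart.trans {J : V → V →L[ℝ] V} {ψ : OpenPartialHomeomorph V E}
    (hψ : IsHolChart J ψ) {φ : OpenPartialHomeomorph E E'} (hφ : IsBihol φ) :
    IsHolChart J (ψ.trans φ) where
  smooth := by
    rw [OpenPartialHomeomorph.trans_source]
    exact (hφ.hol.restrict_scalars ℝ).comp (hψ.smooth.mono inter_subset_left)
      (fun x hx => hx.2)
  smooth_symm := by
    rw [OpenPartialHomeomorph.trans_target]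
    exact hψ.smooth_symm.comp ((hφ.hol_symm.restrict_scalars ℝ).mono inter_subset_left)
      (fun x hx => hx.2)
  comm y hy v := by
    rw [OpenPartialHomeomorph.trans_source] at hy
    have h1 : DifferentiableAt ℝ ψ y :=
      (hψ.smooth.contDiffAt (ψ.open_source.mem_nhds hy.1)).differentiableAt (by simp)
    have h2 : DifferentiableAt ℂ φ (ψ y) :=
      (hφ.hol.contDiffAt (φ.open_source.mem_nhds hy.2)).differentiableAt (by simp)
    rw [OpenPartialHomeomorph.coe_trans, fderiv_comp y (h2.restrictScalars ℝ) h1]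
    simp only [ContinuousLinearMap.comp_apply]
    rw [hψ.comm y hy.1, fderiv_real_I_smul h2]

omit [NormedSpace ℂ E] [IsScalarTower ℝ ℂ E] in
theorem fderiv_symm_fderiv {ψ : OpenPartialHomeomorph V E} (s1 : ContDiffOn ℝ ∞ ψ ψ.source)
    (s2 : ContDiffOn ℝ ∞ ψ.symm ψ.target) {x : V} (hx : x ∈ ψ.source) (v : V) :
    fderiv ℝ ψ.symm (ψ x) (fderiv ℝ ψ x v) = v := by
  have h1 : DifferentiableAt ℝ ψ x :=
    (s1.contDiffAt (ψ.open_source.mem_nhds hx)).differentiableAt (by simp)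
  have h2 : DifferentiableAt ℝ ψ.symm (ψ x) :=
    (s2.contDiffAt (ψ.open_target.mem_nhds (ψ.map_source hx))).differentiableAt (by simp)
  have e : (fderiv ℝ ψ.symm (ψ x)).comp (fderiv ℝ ψ x) = ContinuousLinearMap.id ℝ V := by
    rw [← fderiv_comp x h2 h1, ← fderiv_id (x := x)]
    refine Filter.EventuallyEq.fderiv_eq ?_
    filter_upwards [ψ.open_source.mem_nhds hx] with z hz using ψ.left_inv hz
  exact congrArg (fun T => T v) e

-- The differentials of a chart and of its inverse are mutually inverse, so if one intertwines `J`
-- with multiplication by $i$, so does the other.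
omit [IsScalarTower ℝ ℂ E] in
theorem IsHolChart.fderiv_symm_comm {J : V → V →L[ℝ] V} {ψ : OpenPartialHomeomorph V E}
    (hψ : IsHolChart J ψ) {y : E} (hy : y ∈ ψ.target) (v : E) :
    fderiv ℝ ψ.symm y (I • v) = J (ψ.symm y) (fderiv ℝ ψ.symm y v) := by
  have hx : ψ.symm y ∈ ψ.source := ψ.map_target hy
  have e1' : ∀ w, fderiv ℝ ψ (ψ.symm y) (fderiv ℝ ψ.symm y w) = w := fun w =>
    fderiv_symm_fderiv (ψ := ψ.symm) hψ.smooth_symm hψ.smooth hy w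
  have e2' : ∀ w, fderiv ℝ ψ.symm y (fderiv ℝ ψ (ψ.symm y) w) = w := fun w => by
    simpa [ψ.right_inv hy] using fderiv_symm_fderiv hψ.smooth hψ.smooth_symm hx w
  rw [← e2' (J (ψ.symm y) (fderiv ℝ ψ.symm y v)), hψ.comm _ hx, e1']

/-- On the source $J=d\psi^{-1}\circ i\circ d\psi$. This gives regularity of `J3`, which is only
chosen point by point. -/
theorem IsHolChart.contDiffOn_J {J : V → V →L[ℝ] V} {ψ : OpenPartialHomeomorph V E}
    (hψ : IsHolChart J ψ) : ContDiffOn ℝ ∞ J ψ.source := by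
  have h1 : ContDiffOn ℝ ∞ (fderiv ℝ ψ) ψ.source :=
    hψ.smooth.fderiv_of_isOpen ψ.open_source (by simp)
  have h2 : ContDiffOn ℝ ∞ (fun x => fderiv ℝ ψ.symm (ψ x)) ψ.source :=
    (hψ.smooth_symm.fderiv_of_isOpen ψ.open_target (by simp)).comp hψ.smooth
      fun x hx => ψ.map_source hx
  refine (h2.clm_comp ((contDiffOn_const (c := stdJ E 0)).clm_comp h1)).congr
    fun x hx => ContinuousLinearMap.ext fun v => ?_
  have h := hψ.fderiv_symm_comm (ψ.map_source hx) (fderiv ℝ ψ x v)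
  rw [ψ.left_inv hx, fderiv_symm_fderiv hψ.smooth hψ.smooth_symm hx] at h
  exact h.symm

/-- A chart into a finite-dimensional complex space can be replaced by one into `ℂᵏ`. -/
theorem exists_fin_chart [FiniteDimensional ℂ E] {J : V → V →L[ℝ] V}
    {ψ : OpenPartialHomeomorph V E} (hψ : IsHolChart J ψ) {L : Submodule ℂ E} {c : ℕ}
    (hL : Module.finrank ℂ L + c = Module.finrank ℂ E) {M N : Set V} {x : V} (hx : x ∈ ψ.source)
    (hM : ψ.source ⊆ M) (hN : ψ '' (ψ.source ∩ N) = ψ.target ∩ (L : Set E)) :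
    ∃ (k : ℕ) (ψ : OpenPartialHomeomorph V (Fin k → ℂ)) (L : Submodule ℂ (Fin k → ℂ)),
    x ∈ ψ.source ∧ ψ.source ⊆ M ∧ IsHolomorphicChart J ψ ∧
    Module.finrank ℂ L + c = k ∧ ψ '' (ψ.source ∩ N) = ψ.target ∩ (L : Set (Fin k → ℂ)) := by
  let T : E ≃L[ℂ] (Fin (Module.finrank ℂ E) → ℂ) := ContinuousLinearEquiv.ofFinrankEq (by simp)
  have hT : IsBihol T.toHomeomorph.toOpenPartialHomeomorph :=
    ⟨T.contDiff.contDiffOn, T.symm.contDiff.contDiffOn⟩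
  have h := hψ.trans hT
  refine ⟨_, ψ.trans T.toHomeomorph.toOpenPartialHomeomorph, L.map (T : E →ₗ[ℂ] _), ?_, ?_,
    ⟨h.smooth, h.smooth_symm, h.comm⟩, ?_, ?_⟩
  · simpa using hx
  · simpa using hM
  · exact (congrArg (· + c) (LinearEquiv.finrank_map_eq T.toLinearEquiv L)).trans hL
  · have : ψ.source ∩ ψ ⁻¹' univ ∩ N = ψ.source ∩ N := by simp
    rw [OpenPartialHomeomorph.trans_source, OpenPartialHomeomorph.trans_target]
    simp only [Homeomorph.toOpenPartialHomeomorph_source,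
      Homeomorph.toOpenPartialHomeomorph_target, OpenPartialHomeomorph.coe_trans, image_comp,
      this, hN]
    ext y
    simp only [mem_image, mem_inter_iff, SetLike.mem_coe, Submodule.mem_map, mem_univ, true_and,
      mem_preimage]
    constructor
    · rintro ⟨z, ⟨hz, hzL⟩, rfl⟩
      exact ⟨by simpa using hz, z, hzL, rfl⟩
    · rintro ⟨h1, z, hzL, rfl⟩
      exact ⟨z, ⟨by simpa using h1, hzL⟩, rfl⟩

/-- The tangent spaces of a complex submanifold are complex. -/
theorem IsComplexSubmanifold.map_mem_tspace {J : V → V →L[ℝ] V} {M N : Set V} {c : ℕ}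
    (h : IsComplexSubmanifold J M N c) {x : V} (hx : x ∈ N) {v : V} (hv : v ∈ TSpace N x) :
    J x v ∈ TSpace N x := by
  obtain ⟨k, ψ, L, hxs, -, ⟨s1, s2, hJ⟩, -, him⟩ := h.2 x hx
  have h1 : HasFDerivAt ψ (fderiv ℝ ψ x) x :=
    ((s1.contDiffAt (ψ.open_source.mem_nhds hxs)).differentiableAt (by simp)).hasFDerivAt
  have h2 : HasFDerivAt ψ.symm (fderiv ℝ ψ.symm (ψ x)) (ψ x) :=
    ((s2.contDiffAt (ψ.open_target.mem_nhds (ψ.map_source hxs))).differentiableAt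
      (by simp)).hasFDerivAt
  have e2 : ∀ w, fderiv ℝ ψ.symm (ψ x) (fderiv ℝ ψ x w) = w := fderiv_symm_fderiv s1 s2 hxs
  have hψx : ψ x ∈ ψ.target ∩ (L : Set (Fin k → ℂ)) := him ▸ mem_image_of_mem _ ⟨hxs, hx⟩
  -- Together with `hsup` this identifies the tangent cone with $d\psi^{-1}(L)$. Limits of scaled
  -- differences of points of `L` stay in `L`, a closed subspace.
  have hsub : ∀ w ∈ tangentConeAt ℝ N x, fderiv ℝ ψ x w ∈ L := by
    intro w hw
    rw [← tangentConeAt_inter_nhds (ψ.open_source.mem_nhds hxs)] at hw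
    have := h1.hasFDerivWithinAt.mapsTo_tangent_cone hw
    rw [inter_comm, him] at this
    have h3 := tangentConeAt_mono inter_subset_right this
    obtain ⟨α, l, _, a, d, -, hd, had⟩ := exists_fun_of_mem_tangentConeAt h3
    refine L.closed_of_finiteDimensional.mem_of_frequently_of_tendsto
      (Filter.Eventually.frequently ?_) had
    filter_upwards [hd] with i hi
    have h5 : d i ∈ L := by simpa using L.sub_mem hi hψx.2
    rw [← Complex.coe_smul]
    exact L.smul_mem _ h5
  -- Segments in `L` starting at `ψ x` give tangent vectors there, and the inverse chart carries
  -- them back to `N`.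
  have hsup : ∀ w, fderiv ℝ ψ x w ∈ L → w ∈ tangentConeAt ℝ N x := by
    intro w hw
    have h3 : fderiv ℝ ψ x w ∈ tangentConeAt ℝ (L : Set (Fin k → ℂ)) (ψ x) := by
      have : segment ℝ (ψ x) (ψ x + fderiv ℝ ψ x w) ⊆ (L : Set (Fin k → ℂ)) :=
        (L.restrictScalars ℝ).convex.segment_subset hψx.2 (L.add_mem hψx.2 hw)
      simpa using mem_tangentConeAt_of_segment_subset this
    rw [← tangentConeAt_inter_nhds (ψ.open_target.mem_nhds hψx.1), inter_comm, ← him] at h3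
    have h4 := h2.hasFDerivWithinAt.mapsTo_tangent_cone h3
    rw [e2, ψ.left_inv hxs, ← image_comp] at h4
    refine tangentConeAt_mono ?_ h4
    rintro _ ⟨z, hz, rfl⟩
    simpa [ψ.left_inv hz.1] using hz.2
  refine Submodule.span_induction (fun w hw => Submodule.subset_span (hsup _ ?_)) ?_ ?_ ?_ hv
  · rw [hJ x hxs]
    exact L.smul_mem _ (hsub w hw)
  · simp
  · intro a b _ _ ha hb
    rw [map_add]
    exact add_mem ha hb
  · intro t a _ ha
    rw [map_smul]
    exact Submodule.smul_mem _ _ ha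

/-- Near each point of `X` the map is defined and holomorphic on an open subset of the ambient
space, so the condition on tangent vectors of `X` holds for all vectors. -/
theorem isHolomorphicMap_comp_chart {J : V → V →L[ℝ] V} {ψ : OpenPartialHomeomorph V E}
    (hψ : IsHolChart J ψ) {X : Set V} (hX : X ⊆ ψ.source) {Y : Set W} {k : E → W}
    (hk : ∀ x ∈ X, ContDiffAt ℂ ∞ k (ψ x)) (hm : MapsTo (fun x => k (ψ x)) X Y) :
    IsHolomorphicMap J X (stdJ W) Y (fun x => k (ψ x)) := by
  have h1 : ∀ x ∈ X, ContDiffAt ℝ ∞ ψ x := fun x hx =>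
    hψ.smooth.contDiffAt (ψ.open_source.mem_nhds (hX hx))
  have h2 : ∀ x ∈ X, ContDiffAt ℝ ∞ (fun x => k (ψ x)) x := fun x hx =>
    ((hk x hx).restrict_scalars ℝ).comp x (h1 x hx)
  refine ⟨hm, fun x hx => (h2 x hx).contDiffWithinAt, fun x hx =>
    ⟨_, ((h2 x hx).differentiableAt (by simp)).hasFDerivAt.hasFDerivWithinAt, fun v _ => ?_⟩⟩
  have hk' : DifferentiableAt ℂ k (ψ x) := (hk x hx).differentiableAt (by simp)
  have := fderiv_comp (𝕜 := ℝ) x (hk'.restrictScalars ℝ)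
    ((h1 x hx).differentiableAt (by simp))
  rw [Function.comp_def] at this
  rw [this, ContinuousLinearMap.comp_apply, ContinuousLinearMap.comp_apply, hψ.comm x (hX hx),
    fderiv_real_I_smul hk']
  rfl

theorem isHolomorphicMap_symm_comp {J : V → V →L[ℝ] V} {ψ : OpenPartialHomeomorph V E}
    (hψ : IsHolChart J ψ) {X : Set V} {Y : Set W} {h : W → E}
    (hh : ∀ y ∈ Y, ContDiffAt ℂ ∞ h y) (ht : ∀ y ∈ Y, h y ∈ ψ.target)
    (hm : MapsTo (fun y => ψ.symm (h y)) Y X) :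
    IsHolomorphicMap (stdJ W) Y J X (fun y => ψ.symm (h y)) := by
  have h1 : ∀ y ∈ Y, ContDiffAt ℝ ∞ ψ.symm (h y) := fun y hy =>
    hψ.smooth_symm.contDiffAt (ψ.open_target.mem_nhds (ht y hy))
  have h2 : ∀ y ∈ Y, ContDiffAt ℝ ∞ (fun y => ψ.symm (h y)) y := fun y hy =>
    (h1 y hy).comp y ((hh y hy).restrict_scalars ℝ)
  refine ⟨hm, fun x hx => (h2 x hx).contDiffWithinAt, fun x hx =>
    ⟨_, ((h2 x hx).differentiableAt (by simp)).hasFDerivAt.hasFDerivWithinAt, fun v _ => ?_⟩⟩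
  have hh' : DifferentiableAt ℂ h x := (hh x hx).differentiableAt (by simp)
  have := fderiv_comp (𝕜 := ℝ) x ((h1 x hx).differentiableAt (by simp))
    (hh'.restrictScalars ℝ)
  rw [Function.comp_def] at this
  rw [this, ContinuousLinearMap.comp_apply, ContinuousLinearMap.comp_apply]
  rw [← hψ.fderiv_symm_comm (ht x hx), ← fderiv_real_I_smul hh']
  rfl

end HolomorphicCharts

/-! ### Partial derivatives of the prepotential. -/

section PartialDerivatives

variable {n : ℕ}

theorem analyticOnNhd_pd {f : (Fin n → ℂ) → ℂ} {U : Set (Fin n → ℂ)} (hf : AnalyticOnNhd ℂ f U)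
    (A : Fin n) : AnalyticOnNhd ℂ (pd A f) U :=
  fun Z hZ => ((ContinuousLinearMap.apply ℂ ℂ
    (Pi.single A (1 : ℂ) : Fin n → ℂ)).analyticAt (fderiv ℂ f Z)).comp (hf.fderiv Z hZ)

theorem pd_comm {f : (Fin n → ℂ) → ℂ} {Z : Fin n → ℂ} (hf : AnalyticAt ℂ f Z) (A B : Fin n) :
    pd A (pd B f) Z = pd B (pd A f) Z := by
  have h : ∀ C D : Fin n, pd C (pd D f) Z =
      fderiv ℂ (fderiv ℂ f) Z (Pi.single C 1) (Pi.single D 1) := by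
    intro C D
    have := (((ContinuousLinearMap.apply ℂ ℂ (Pi.single D (1 : ℂ))).hasFDerivAt).comp Z
      hf.fderiv.differentiableAt.hasFDerivAt).fderiv
    have h2 := congrArg (fun T => T (Pi.single C 1)) this
    exact h2
  rw [h, h]
  exact (hf.contDiffAt (n := 2)).isSymmSndFDerivAt (by simp) _ _

theorem pd_congr {f g : (Fin n → ℂ) → ℂ} {U : Set (Fin n → ℂ)} (hU : IsOpen U) (h : EqOn f g U)
    {Z : Fin n → ℂ} (hZ : Z ∈ U) (A : Fin n) : pd A f Z = pd A g Z := by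
  unfold pd
  rw [Filter.EventuallyEq.fderiv_eq (h.eventuallyEq_of_mem (hU.mem_nhds hZ))]

theorem F2_comm {F : (Fin n → ℂ) → ℂ} {Z : Fin n → ℂ} (hF : AnalyticAt ℂ F Z) (A B : Fin n) :
    F2 F Z A B = F2 F Z B A :=
  pd_comm hF A B

theorem F3_swap_left {F : (Fin n → ℂ) → ℂ} {U : Set (Fin n → ℂ)} (hF : AnalyticOnNhd ℂ F U)
    {Z : Fin n → ℂ} (hZ : Z ∈ U) (A B C : Fin n) : F3 F Z A B C = F3 F Z B A C :=
  pd_comm (analyticOnNhd_pd hF C Z hZ) A B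

theorem F3_swap_right {F : (Fin n → ℂ) → ℂ} {U : Set (Fin n → ℂ)} (hU : IsOpen U)
    (hF : AnalyticOnNhd ℂ F U) {Z : Fin n → ℂ} (hZ : Z ∈ U) (A B C : Fin n) :
    F3 F Z A B C = F3 F Z A C B :=
  pd_congr hU (fun _ hY => pd_comm (hF _ hY) B C) hZ A

/-- Differentiating $f(tY)=cf(Y)$ at fixed $t$ gives the relation. The factor `c` is left free so
that the lemma can be iterated, each derivative lowering the degree by one. -/
theorem pd_smul {f : (Fin n → ℂ) → ℂ} {U : Set (Fin n → ℂ)} (hU : IsOpen U)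
    (hf : AnalyticOnNhd ℂ f U) {t c : ℂ} (ht : ∀ Z ∈ U, t • Z ∈ U)
    (hh : ∀ Z ∈ U, f (t • Z) = c * f Z) {Z : Fin n → ℂ} (hZ : Z ∈ U) (A : Fin n) :
    t * pd A f (t • Z) = c * pd A f Z := by
  have h1 : HasFDerivAt (fun Y => f (t • Y))
      ((fderiv ℂ f (t • Z)).comp (t • ContinuousLinearMap.id ℂ (Fin n → ℂ))) Z :=
    HasFDerivAt.comp Z (hf _ (ht Z hZ)).differentiableAt.hasFDerivAt
      ((hasFDerivAt_id Z).const_smul t)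
  have h2 : HasFDerivAt (fun Y => f (t • Y)) (c • fderiv ℂ f Z) Z :=
    ((hf _ hZ).differentiableAt.hasFDerivAt.const_mul c).congr_of_eventuallyEq
      (Filter.eventuallyEq_of_mem (hU.mem_nhds hZ) hh)
  have := congrArg (fun T => T (Pi.single A 1)) (h1.unique h2)
  simpa [pd] using this

theorem fderiv_eq_sum_pd (f : (Fin n → ℂ) → ℂ) (Z V : Fin n → ℂ) :
    fderiv ℂ f Z V = ∑ A, V A * pd A f Z := by
  conv_lhs => rw [pi_eq_sum_univ' V]
  simp [pd, map_sum, map_smul]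

end PartialDerivatives

/-- The linear part of `z ↦ (z, 1)`. -/
noncomputable def homL (m : ℕ) : (Fin m → ℂ) →L[ℂ] (Fin (m + 1) → ℂ) :=
  LinearMap.toContinuousLinearMap
    { toFun := fun v => Fin.snoc (α := fun _ => ℂ) v 0
      map_add' := fun v w => by
        funext A
        refine Fin.lastCases ?_ (fun a => ?_) A <;> simp
      map_smul' := fun c v => by
        funext A
        refine Fin.lastCases ?_ (fun a => ?_) A <;> simp }

theorem homL_apply {m : ℕ} (v : Fin m → ℂ) : homL m v = Fin.snoc (α := fun _ => ℂ) v 0 := rfl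

theorem hom_eq {m : ℕ} (z : Fin m → ℂ) : hom z = homL m z + Pi.single (Fin.last m) 1 := by
  funext A
  refine Fin.lastCases ?_ (fun a => ?_) A <;> simp [hom, homL_apply]

theorem hasFDerivAt_hom {m : ℕ} (z : Fin m → ℂ) : HasFDerivAt hom (homL m) z := by
  have : (hom : (Fin m → ℂ) → _) = fun z => homL m z + Pi.single (Fin.last m) 1 := funext hom_eq
  rw [this]
  exact (homL m).hasFDerivAt.add_const _

theorem contDiff_hom {m : ℕ} : ContDiff ℂ ω (hom : (Fin m → ℂ) → _) := by
  have : (hom : (Fin m → ℂ) → _) = fun z => homL m z + Pi.single (Fin.last m) 1 := funext hom_eq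
  rw [this]
  exact (homL m).contDiff.add contDiff_const

/-! ### Homogeneity and the rank of the map defining $M_{\rm sk}^\wedge$. -/

namespace SpecialKahlerDomain

variable {m : ℕ} (P : SpecialKahlerDomain m)

theorem isOpen_Msk : IsOpen P.Msk :=
  P.isOpen_Mask.preimage contDiff_hom.continuous

theorem isOpen_M : IsOpen P.M := P.isOpen_Msk.prod isOpen_univ

theorem analyticOnNhd_F2 (A B : Fin (m + 1)) : AnalyticOnNhd ℂ (fun Z => F2 P.F Z A B) P.Mask :=
  analyticOnNhd_pd (analyticOnNhd_pd P.holomorphic B) A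

theorem analyticAt_FAB {z : Fin m → ℂ} (hz : z ∈ P.Msk) (A B : Fin (m + 1)) :
    AnalyticAt ℂ (fun z => P.FAB z A B) z :=
  (P.analyticOnNhd_F2 A B (hom z) hz).comp (contDiff_hom.contDiffAt.analyticAt)

theorem FAB_comm {z : Fin m → ℂ} (hz : z ∈ P.Msk) (A B : Fin (m + 1)) :
    P.FAB z A B = P.FAB z B A :=
  F2_comm (P.holomorphic _ hz) A B

theorem F2_smul {Z : Fin (m + 1) → ℂ} (hZ : Z ∈ P.Mask) {t : ℂ} (ht : t ≠ 0) :
    F2 P.F (t • Z) = F2 P.F Z := by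
  have h1 : ∀ Y ∈ P.Mask, ∀ B, pd B P.F (t • Y) = t * pd B P.F Y := by
    intro Y hY B
    have := pd_smul P.isOpen_Mask P.holomorphic (fun Z hZ => P.smul_mem Z hZ t ht)
      (fun Z hZ => P.homogeneous Z hZ t ht) hY B
    refine mul_left_cancel₀ ht (this.trans (by ring))
  ext A B
  have := pd_smul P.isOpen_Mask (analyticOnNhd_pd P.holomorphic B)
    (fun Z hZ => P.smul_mem Z hZ t ht) (fun Z hZ => h1 Z hZ B) hZ A
  exact mul_left_cancel₀ ht this

/-- Euler's relation in degree zero: $t\mapsto F_{AB}(tZ)$ is constant near $t=1$, and its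
derivative there is the radial one. -/
theorem F2_fderiv_self {Z : Fin (m + 1) → ℂ} (hZ : Z ∈ P.Mask) (A B : Fin (m + 1)) :
    fderiv ℂ (fun Z => F2 P.F Z A B) Z Z = 0 := by
  have h1 : HasDerivAt (fun t : ℂ => F2 P.F (t • Z) A B)
      (fderiv ℂ (fun Z => F2 P.F Z A B) Z Z) 1 := by
    have h2 : HasFDerivAt (fun Z => F2 P.F Z A B) (fderiv ℂ (fun Z => F2 P.F Z A B) Z)
        ((1 : ℂ) • Z) := by
      rw [one_smul]
      exact (P.analyticOnNhd_F2 A B Z hZ).differentiableAt.hasFDerivAt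
    have h3 : HasDerivAt (fun t : ℂ => t • Z) Z 1 := by
      simpa using (hasDerivAt_id (1 : ℂ)).smul_const Z
    exact h2.comp_hasDerivAt (1 : ℂ) h3
  have h4 : (fun t : ℂ => F2 P.F (t • Z) A B) =ᶠ[nhds 1] fun _ => F2 P.F Z A B := by
    filter_upwards [isOpen_ne.mem_nhds (one_ne_zero (α := ℂ))] with t ht
    rw [P.F2_smul hZ ht]
  exact h1.unique ((hasDerivAt_const (1 : ℂ) _).congr_of_eventuallyEq h4)

/-- The map whose level set is `MskHat`. -/
noncomputable def levelMap (D : Fin (m + 1) → ℂ) (z : Fin m → ℂ) : Fin (m + 1) → ℂ :=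
  fun B => ∑ A, D A * P.FAB z A B

theorem contDiffOn_levelMap (D : Fin (m + 1) → ℂ) : ContDiffOn ℂ ∞ (P.levelMap D) P.Msk := by
  refine contDiffOn_pi.mpr fun B => ?_
  refine ContDiffOn.sum fun A _ => contDiffOn_const.mul fun z hz => ?_
  exact (P.analyticAt_FAB hz A B).contDiffAt.contDiffWithinAt

/-- The differential is $G_{AB}$ restricted to the hyperplane of vectors with last coordinate zero.
No rank is lost, because $G$ annihilates $Z=(z,1)$, which is transversal to that hyperplane. -/
theorem rank_fderiv_levelMap (D : Fin (m + 1) → ℂ) {z : Fin m → ℂ} (hz : z ∈ P.Msk) :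
    Module.finrank ℂ (LinearMap.range (fderiv ℂ (P.levelMap D) z).toLinearMap) =
      (GMat P.F D (hom z)).rank := by
  have hZ : hom z ∈ P.Mask := hz
  let g : (Fin (m + 1) → ℂ) → Fin (m + 1) → ℂ := fun Z B => ∑ A, D A * F2 P.F Z A B
  have hg' : ∀ B, HasFDerivAt (fun Z => g Z B)
      (∑ A, D A • fderiv ℂ (fun Z => F2 P.F Z A B) (hom z)) (hom z) := fun B =>
    HasFDerivAt.fun_sum fun A _ =>
      (P.analyticOnNhd_F2 A B _ hZ).differentiableAt.hasFDerivAt.const_mul (D A)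
  have hg : HasFDerivAt g (ContinuousLinearMap.pi fun B =>
      (∑ A, D A • fderiv ℂ (fun Z => F2 P.F Z A B) (hom z))) (hom z) := hasFDerivAt_pi.mpr hg'
  set T := ContinuousLinearMap.pi fun B =>
      (∑ A, D A • fderiv ℂ (fun Z => F2 P.F Z A B) (hom z)) with hT
  have hTm : ∀ V, T V = (GMat P.F D (hom z)).mulVec V := by
    intro V
    funext B
    simp only [hT, ContinuousLinearMap.coe_pi', sum_apply,
      smul_apply, fderiv_eq_sum_pd, Matrix.mulVec, dotProduct, GMat,
      Matrix.of_apply, smul_eq_mul, Finset.mul_sum, Finset.sum_mul]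
    rw [Finset.sum_comm]
    refine Finset.sum_congr rfl fun E _ => Finset.sum_congr rfl fun A _ => ?_
    have : pd E (fun Z => F2 P.F Z A B) (hom z) = F3 P.F (hom z) B E A := by
      rw [F3_swap_left P.holomorphic hZ, F3_swap_right P.isOpen_Mask P.holomorphic hZ]
      rfl
    rw [this]
    ring
  have hTZ : T (hom z) = 0 := by
    funext B
    simp [hT, P.F2_fderiv_self hZ]
  have hf : HasFDerivAt (P.levelMap D) (T.comp (homL m)) z := hg.comp z (hasFDerivAt_hom z)
  rw [hf.fderiv]
  have hr : LinearMap.range (T.comp (homL m)).toLinearMap =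
      LinearMap.range (GMat P.F D (hom z)).mulVecLin := by
    apply le_antisymm
    · rintro _ ⟨v, rfl⟩
      exact ⟨homL m v, (hTm _).symm⟩
    · rintro _ ⟨V, rfl⟩
      -- Subtracting the multiple $V^nZ$ moves `V` into the hyperplane without changing $GV$.
      refine ⟨fun a => V a.castSucc - V (Fin.last m) * z a, ?_⟩
      have : homL m (fun a => V a.castSucc - V (Fin.last m) * z a) =
          V - V (Fin.last m) • hom z := by
        funext A
        refine Fin.lastCases ?_ (fun a => ?_) A <;> simp [hom, homL_apply]
      rw [ContinuousLinearMap.coe_coe, ContinuousLinearMap.comp_apply, this, map_sub, map_smul,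
        hTZ, smul_zero, sub_zero, hTm, Matrix.mulVecLin_apply]
  rw [hr]
  rfl

theorem mskHat_eq (D C : Fin (m + 1) → ℂ) : P.MskHat D C = {z ∈ P.Msk | P.levelMap D z = C} := by
  ext z
  simp [MskHat, levelMap, funext_iff]

/-- Dividing $Z_0$ by its last coordinate gives a point $(z,1)$ of the same ray, where $F_{AB}$, of
degree zero, takes the same value. -/
theorem mskHat_nonempty {Z₀ : Fin (m + 1) → ℂ} (hZ₀ : Z₀ ∈ P.Mask) {D C : Fin (m + 1) → ℂ}
    (hC : ∀ B, C B = ∑ A, D A * F2 P.F Z₀ A B) : (P.MskHat D C).Nonempty := by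
  have hl := P.last_ne_zero Z₀ hZ₀
  have h : hom (fun a : Fin m => (Z₀ (Fin.last m))⁻¹ * Z₀ a.castSucc) =
      (Z₀ (Fin.last m))⁻¹ • Z₀ := by
    funext A
    refine Fin.lastCases ?_ (fun a => ?_) A <;> simp [hom, hl]
  refine ⟨fun a : Fin m => (Z₀ (Fin.last m))⁻¹ * Z₀ a.castSucc, ?_, fun B => ?_⟩
  · rw [Msk, mem_ofPred_eq, h]
    exact P.smul_mem _ hZ₀ _ (inv_ne_zero hl)
  · rw [hC, FAB, h, P.F2_smul hZ₀ (inv_ne_zero hl)]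

end SpecialKahlerDomain

/-! ### Linear coordinates and left translations on $G$. -/

namespace IwasawaGroup

variable {n : ℕ}

/-- The coordinates as a continuous linear equivalence. -/
noncomputable def equivProd (n : ℕ) :
    IwasawaGroup n ≃L[ℝ] ℝ × ℝ × (Fin n → ℝ) × (Fin n → ℝ) :=
  ContinuousLinearEquiv.refl ℝ (ℝ × ℝ × (Fin n → ℝ) × (Fin n → ℝ))

/-- The coordinate `φ` as a continuous linear map. -/
noncomputable def phiL : IwasawaGroup n →L[ℝ] ℝ :=
  LinearMap.toContinuousLinearMap
    { toFun := fun g => g.phi, map_add' := fun _ _ => rfl, map_smul' := fun _ _ => rfl }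

/-- The coordinate `φ̃` as a continuous linear map. -/
noncomputable def phitL : IwasawaGroup n →L[ℝ] ℝ :=
  LinearMap.toContinuousLinearMap
    { toFun := fun g => g.phit, map_add' := fun _ _ => rfl, map_smul' := fun _ _ => rfl }

/-- The coordinate `aᴬ` as a continuous linear map. -/
noncomputable def aL (A : Fin n) : IwasawaGroup n →L[ℝ] ℝ :=
  LinearMap.toContinuousLinearMap
    { toFun := fun g => g.a A, map_add' := fun _ _ => rfl, map_smul' := fun _ _ => rfl }

/-- The coordinate `b_A` as a continuous linear map. -/
noncomputable def bL (A : Fin n) : IwasawaGroup n →L[ℝ] ℝ :=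
  LinearMap.toContinuousLinearMap
    { toFun := fun g => g.b A, map_add' := fun _ _ => rfl, map_smul' := fun _ _ => rfl }

theorem phiL_apply (g : IwasawaGroup n) : phiL g = g.phi := rfl
theorem phitL_apply (g : IwasawaGroup n) : phitL g = g.phit := rfl
theorem aL_apply (A : Fin n) (g : IwasawaGroup n) : aL A g = g.a A := rfl
theorem bL_apply (A : Fin n) (g : IwasawaGroup n) : bL A g = g.b A := rfl

theorem contDiffOn_mk {E : Type*} [NormedAddCommGroup E] [NormedSpace ℝ E] {s : Set E}
    {p pt : E → ℝ} {a b : E → Fin n → ℝ} (h1 : ContDiffOn ℝ ∞ p s) (h2 : ContDiffOn ℝ ∞ pt s)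
    (h3 : ContDiffOn ℝ ∞ a s) (h4 : ContDiffOn ℝ ∞ b s) :
    ContDiffOn ℝ ∞ (fun x => mk (p x) (pt x) (a x) (b x)) s :=
  (equivProd n).symm.contDiff.comp_contDiffOn (h1.prodMk (h2.prodMk (h3.prodMk h4)))

@[simp] theorem phi_add (g h : IwasawaGroup n) : (g + h).phi = g.phi + h.phi := rfl
@[simp] theorem phit_add (g h : IwasawaGroup n) : (g + h).phit = g.phit + h.phit := rfl
@[simp] theorem a_add (g h : IwasawaGroup n) : (g + h).a = g.a + h.a := rfl
@[simp] theorem b_add (g h : IwasawaGroup n) : (g + h).b = g.b + h.b := rfl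
@[simp] theorem phi_smul (c : ℝ) (g : IwasawaGroup n) : (c • g).phi = c * g.phi := rfl
@[simp] theorem phit_smul (c : ℝ) (g : IwasawaGroup n) : (c • g).phit = c * g.phit := rfl
@[simp] theorem a_smul (c : ℝ) (g : IwasawaGroup n) : (c • g).a = c • g.a := rfl
@[simp] theorem b_smul (c : ℝ) (g : IwasawaGroup n) : (c • g).b = c • g.b := rfl

/-- The linear part of the left translation by `k`. -/
noncomputable def leftL (k : IwasawaGroup n) : IwasawaGroup n →L[ℝ] IwasawaGroup n :=
  LinearMap.toContinuousLinearMap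
    { toFun := fun w => mk w.phi (Real.exp (-2 * k.phi) * w.phit
        + Real.exp (-k.phi) * ∑ A, (k.a A * w.b A - w.a A * k.b A))
        (Real.exp (-k.phi) • w.a) (Real.exp (-k.phi) • w.b)
      map_add' := fun v w => by
        apply ext'
        · simp
        · simp only [phit_mk, phit_add, a_add, b_add, Pi.add_apply]
          have : ∑ A, (k.a A * (v.b A + w.b A) - (v.a A + w.a A) * k.b A) =
              ∑ A, (k.a A * v.b A - v.a A * k.b A) + ∑ A, (k.a A * w.b A - w.a A * k.b A) := by
            rw [← Finset.sum_add_distrib]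
            exact Finset.sum_congr rfl fun A _ => by ring
          rw [this]
          ring
        · simp
        · simp
      map_smul' := fun c w => by
        apply ext'
        · simp
        · simp only [phit_mk, phit_smul, a_smul, b_smul, Pi.smul_apply, smul_eq_mul,
            RingHom.id_apply]
          have : ∑ A, (k.a A * (c * w.b A) - (c * w.a A) * k.b A) =
              c * ∑ A, (k.a A * w.b A - w.a A * k.b A) := by
            rw [Finset.mul_sum]
            exact Finset.sum_congr rfl fun A _ => by ring
          rw [this]
          ring
        · simp only [a_mk, a_smul, RingHom.id_apply]
          rw [smul_comm]
        · simp only [b_mk, b_smul, RingHom.id_apply]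
          rw [smul_comm] }

theorem leftL_apply (k w : IwasawaGroup n) : leftL k w = mk w.phi (Real.exp (-2 * k.phi) * w.phit
    + Real.exp (-k.phi) * ∑ A, (k.a A * w.b A - w.a A * k.b A))
    (Real.exp (-k.phi) • w.a) (Real.exp (-k.phi) • w.b) := rfl

/-- Left translations are affine in the global coordinates, so their differential at every point is
the linear part `leftL k`. -/
theorem mul_eq_leftL (k h : IwasawaGroup n) : k * h = leftL k h + k := by
  rw [leftL_apply, mul_def]
  apply ext'
  · simp [add_comm]
  · simp only [phit_mk, phit_add]
    ring
  · simp [add_comm]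
  · simp [add_comm]

theorem dLeft_eq (k h : IwasawaGroup n) : dLeft k h = leftL k := by
  have : (fun h => k * h) = fun h => leftL k h + k := funext (mul_eq_leftL k)
  rw [dLeft, this]
  exact ((leftL k).hasFDerivAt.add_const k).fderiv

theorem leftL_inv_leftL (k w : IwasawaGroup n) : leftL k⁻¹ (leftL k w) = w := by
  have h1 : leftL k w = k * w - k := by rw [mul_eq_leftL, add_sub_cancel_right]
  have h2 : ∀ u, leftL k⁻¹ u = k⁻¹ * u - k⁻¹ := fun u => by
    rw [mul_eq_leftL, add_sub_cancel_right]
  rw [h1, map_sub, h2, h2]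
  simp only [inv_mul_cancel_left, inv_mul_cancel]
  -- The unit of the group is the origin of the coordinate space.
  have : (1 : IwasawaGroup n) = 0 := rfl
  rw [this]
  abel

end IwasawaGroup

/-! ### Smooth dependence of the inverse matrix. -/

section InverseMatrix

/-- Cramer's rule: each entry of the inverse is a determinant with one row replaced by a constant
row, divided by the determinant. -/
theorem contDiffOn_matrix_inv {k : ℕ} {E : Type*} [NormedAddCommGroup E] [NormedSpace ℝ E]
    {s : Set E} {N : E → Matrix (Fin k) (Fin k) ℝ} (h : ∀ i j, ContDiffOn ℝ ∞ (fun x => N x i j) s)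
    (hd : ∀ x ∈ s, (N x).det ≠ 0) (i j : Fin k) : ContDiffOn ℝ ∞ (fun x => (N x)⁻¹ i j) s := by
  have hdet : ∀ M : E → Matrix (Fin k) (Fin k) ℝ, (∀ i j, ContDiffOn ℝ ∞ (fun x => M x i j) s) →
      ContDiffOn ℝ ∞ (fun x => (M x).det) s := by
    intro M hM
    simp only [Matrix.det_apply]
    refine ContDiffOn.sum fun σ _ => ContDiffOn.const_smul _ ?_
    exact contDiffOn_prod fun i _ => hM _ _
  simp only [Matrix.inv_def, Ring.inverse_eq_inv', Matrix.smul_apply, Matrix.adjugate_apply,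
    smul_eq_mul]
  refine ((hdet N h).inv hd).mul (hdet _ fun a b => ?_)
  by_cases hb : a = j
  · subst hb
    simp only [Matrix.updateRow_self]
    exact contDiffOn_const
  · simp only [Matrix.updateRow_ne hb]
    exact h a b

end InverseMatrix

open IwasawaGroup

/-! ### The $(1,0)$-forms of $J_3$ and the global holomorphic coordinates. -/

namespace SpecialKahlerDomain

variable {m : ℕ} (P : SpecialKahlerDomain m)

/-- The real vector `a` in the solution of `b - F a = w`. -/
noncomputable def solA (z : Fin m → ℂ) (w : Fin (m + 1) → ℂ) : Fin (m + 1) → ℝ :=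
  -((P.NAB z)⁻¹.mulVec fun B => (w B).im)

/-- The real vector `b` in the solution of `b - F a = w`. -/
noncomputable def solB (z : Fin m → ℂ) (w : Fin (m + 1) → ℂ) : Fin (m + 1) → ℝ :=
  fun A => (w A).re + ∑ B, (P.FAB z A B).re * P.solA z w B

/-- As $a$ and $b$ are real, the imaginary part of $b-Fa=w$ is $-Na=\operatorname{Im}w$, which
determines $a$; the real part then determines $b$. -/
theorem sol_spec {z : Fin m → ℂ} (hz : z ∈ P.Msk) (w : Fin (m + 1) → ℂ) (A : Fin (m + 1)) :
    (P.solB z w A : ℂ) - ∑ B, P.FAB z A B * (P.solA z w B : ℂ) = w A := by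
  have hN : IsUnit (P.NAB z).det := isUnit_iff_ne_zero.mpr (P.det_NAB_ne_zero hz)
  apply Complex.ext
  · simp [solB]
  · have h : (P.NAB z).mulVec (P.solA z w) = -fun B => (w B).im := by
      rw [solA, Matrix.mulVec_neg, Matrix.mulVec_mulVec, Matrix.mul_nonsing_inv _ hN,
        Matrix.one_mulVec]
    have h' : ∑ B, (P.FAB z A B).im * P.solA z w B = -(w A).im := congrFun h A
    simp [h']

theorem sol_unique {z : Fin m → ℂ} (hz : z ∈ P.Msk) {w : Fin (m + 1) → ℂ}
    {a b : Fin (m + 1) → ℝ} (h : ∀ A, (b A : ℂ) - ∑ B, P.FAB z A B * (a B : ℂ) = w A) :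
    P.solA z w = a ∧ P.solB z w = b := by
  have hN : IsUnit (P.NAB z).det := isUnit_iff_ne_zero.mpr (P.det_NAB_ne_zero hz)
  have ha : P.solA z w = a := by
    have h1 : (fun B => (w B).im) = -(P.NAB z).mulVec a := by
      funext A
      rw [← h A]
      simp [Matrix.mulVec, dotProduct, NAB, NMat, FAB]
    rw [solA, h1, Matrix.mulVec_neg, neg_neg, Matrix.mulVec_mulVec, Matrix.nonsing_inv_mul _ hN,
      Matrix.one_mulVec]
  refine ⟨ha, funext fun A => ?_⟩
  rw [solB, ha, ← h A]
  simp

/-- The `(1,0)`-forms `db_A - F_AB daᴮ`. -/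
noncomputable def eta (q X : Ambient m) : Fin (m + 1) → ℂ :=
  fun A => (X.2.b A : ℂ) - ∑ B, P.FAB q.1 A B * (X.2.a B : ℂ)

/-- $e^b$ is a complex combination of $dz$, and $u$, $\bar E^b$ are complex combinations of $\eta$.
Complex scaling of $dz,\eta,\bar v$ therefore scales all the defining forms, whatever the vielbein
is. -/
theorem formMap_eq_of_eta_eq {e : (Fin m → ℂ) → Fin m → Fin m → ℂ} {q X Y : Ambient m} {c : ℂ}
    (h1 : Y.1 = c • X.1) (h2 : P.eta q Y = c • P.eta q X)
    (h3 : formV q Y = conj c * formV q X) : P.formMap e q Y = c • P.formMap e q X := by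
  have h2' : ∀ A, (Y.2.b A : ℂ) - ∑ B, P.FAB q.1 A B * (Y.2.a B : ℂ) =
      c * ((X.2.b A : ℂ) - ∑ B, P.FAB q.1 A B * (X.2.a B : ℂ)) := fun A => congrFun h2 A
  refine Prod.ext (funext fun b => ?_) (Prod.ext ?_ (Prod.ext ?_ (funext fun b => ?_)))
  · simp only [formMap, LinearMap.coe_mk, AddHom.coe_mk, forme, h1, Pi.smul_apply, smul_eq_mul,
      Prod.smul_fst, Finset.mul_sum]
    exact Finset.sum_congr rfl fun a _ => by ring
  · simp only [formMap, LinearMap.coe_mk, AddHom.coe_mk, formU, h2', Prod.smul_snd, Prod.smul_fst,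
      smul_eq_mul, Finset.mul_sum]
    exact Finset.sum_congr rfl fun a _ => by ring
  · simp only [formMap, LinearMap.coe_mk, AddHom.coe_mk, h3, Prod.smul_snd, Prod.smul_fst,
      smul_eq_mul, map_mul, Complex.conj_conj]
  · have h4 : ∀ A, (Y.2.b A : ℂ) - ∑ B, conj (P.FAB q.1 A B) * (Y.2.a B : ℂ) =
        conj c * ((X.2.b A : ℂ) - ∑ B, conj (P.FAB q.1 A B) * (X.2.a B : ℂ)) := fun A => by
      simpa using congrArg conj (h2' A)
    simp only [formMap, LinearMap.coe_mk, AddHom.coe_mk, formE, h4, Prod.smul_snd, Pi.smul_apply,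
      smul_eq_mul, map_mul, Finset.mul_sum, map_sum, Complex.conj_conj]
    exact Finset.sum_congr rfl fun A _ => Finset.sum_congr rfl fun B _ => by ring

theorem J3_eq {e : (Fin m → ℂ) → Fin m → Fin m → ℂ} (he : P.IsVielbein e) {q X Y : Ambient m}
    (hq : q ∈ P.M) (h1 : Y.1 = I • X.1) (h2 : P.eta q Y = I • P.eta q X)
    (h3 : formV q Y = -I * formV q X) : P.J3 e q X = Y := by
  apply formMap_injective he hq.1
  rw [isJ3At_iff.mp (J3_spec he hq) X, P.formMap_eq_of_eta_eq h1 h2 (by simpa using h3)]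

theorem exists_forms_eq {q : Ambient m} (hq : q ∈ P.M) (v : Fin m → ℂ) (w : Fin (m + 1) → ℂ)
    (ν : ℂ) : ∃ Y : Ambient m, Y.1 = v ∧ P.eta q Y = w ∧ formV q Y = ν := by
  let a := P.solA q.1 w
  let b := P.solB q.1 w
  have hexp : Real.exp (2 * q.2.phi) * Real.exp (-2 * q.2.phi) = 1 := by
    rw [← Real.exp_add]; simp
  -- The real part of $v$ is $-d\phi$; the $\tilde\phi$-component solves the equation for the
  -- imaginary part once $a,b$ are fixed by $\eta=w$.
  refine ⟨(v, IwasawaGroup.mk (-ν.re) (2 * Real.exp (-2 * q.2.phi) * ν.im -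
    ∑ A, (q.2.b A * a A - q.2.a A * b A)) a b), rfl, ?_, ?_⟩
  · funext A
    exact P.sol_spec hq.1 w A
  · simp only [formV, phi_mk, phit_mk, a_mk, b_mk, sub_add_cancel]
    have hc : (Real.exp (2 * q.2.phi) : ℂ) * (Real.exp (-2 * q.2.phi) : ℂ) = 1 := by
      rw [← Complex.ofReal_mul, hexp, Complex.ofReal_one]
    conv_rhs => rw [← Complex.re_add_im ν]
    push_cast at hc ⊢
    linear_combination ((ν.re : ℂ) + ν.im * I) * hc

theorem J3_forms {e : (Fin m → ℂ) → Fin m → Fin m → ℂ} (he : P.IsVielbein e) {q : Ambient m}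
    (hq : q ∈ P.M) (X : Ambient m) : (P.J3 e q X).1 = I • X.1 ∧
      P.eta q (P.J3 e q X) = I • P.eta q X ∧ formV q (P.J3 e q X) = -I * formV q X := by
  obtain ⟨Y, h1, h2, h3⟩ := P.exists_forms_eq hq (I • X.1) (I • P.eta q X) (-I * formV q X)
  rw [P.J3_eq he hq h1 h2 h3]
  exact ⟨h1, h2, h3⟩

/-- Block diagonality holds because $\eta$ and $v$ do not see the component of a tangent vector
along $M_{\rm sk}$. -/
theorem J3_apply {e : (Fin m → ℂ) → Fin m → Fin m → ℂ} (he : P.IsVielbein e) {p : Fin m → ℂ}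
    {g : IwasawaGroup (m + 1)} (hp : p ∈ P.Msk) (v : Fin m → ℂ) (w : IwasawaGroup (m + 1)) :
    P.J3 e (p, g) (v, w) = (I • v, P.JG e p g w) := by
  obtain ⟨-, h2, h3⟩ := P.J3_forms he (q := (p, g)) ⟨hp, mem_univ _⟩ (0, w)
  exact P.J3_eq he ⟨hp, mem_univ _⟩ rfl h2 h3

theorem JG_eq {e : (Fin m → ℂ) → Fin m → Fin m → ℂ} (he : P.IsVielbein e) {p : Fin m → ℂ}
    {g w w' : IwasawaGroup (m + 1)} (hp : p ∈ P.Msk)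
    (h2 : P.eta (p, g) (0, w') = I • P.eta (p, g) (0, w))
    (h3 : formV (m := m) (p, g) (0, w') = -I * formV (m := m) (p, g) (0, w)) :
    P.JG e p g w = w' := by
  have := P.J3_eq he (X := (0, w)) (Y := (0, w')) ⟨hp, mem_univ _⟩ (by simp) h2 h3
  rw [P.J3_apply he hp] at this
  exact congrArg Prod.snd this

theorem JG_forms {e : (Fin m → ℂ) → Fin m → Fin m → ℂ} (he : P.IsVielbein e) {p : Fin m → ℂ}
    (hp : p ∈ P.Msk) (g w : IwasawaGroup (m + 1)) :
    P.eta (p, g) (0, P.JG e p g w) = I • P.eta (p, g) (0, w) ∧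
      formV (m := m) (p, g) (0, P.JG e p g w) = -I * formV (m := m) (p, g) (0, w) :=
  (P.J3_forms he (q := (p, g)) ⟨hp, mem_univ _⟩ (0, w)).2

theorem JG_JG {e : (Fin m → ℂ) → Fin m → Fin m → ℂ} (he : P.IsVielbein e) {p : Fin m → ℂ}
    (hp : p ∈ P.Msk) (g w : IwasawaGroup (m + 1)) : P.JG e p g (P.JG e p g w) = -w := by
  obtain ⟨h2, h3⟩ := P.JG_forms he hp g w
  refine P.JG_eq he hp ?_ ?_
  · rw [h2, smul_smul, I_mul_I]
    funext A
    have hb : (-w).b A = -w.b A := rfl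
    have ha : ∀ B, (-w).a B = -w.a B := fun _ => rfl
    simp [eta, hb, ha]
    ring
  · rw [h3]
    have hb : ∀ A, (-w).b A = -w.b A := fun _ => rfl
    have ha : ∀ B, (-w).a B = -w.a B := fun _ => rfl
    have hp : (-w).phi = -w.phi := rfl
    have hpt : (-w).phit = -w.phit := rfl
    have hs : ∑ A, (g.b A * -w.a A - g.a A * -w.b A) = -∑ A, (g.b A * w.a A - g.a A * w.b A) := by
      rw [← Finset.sum_neg_distrib]
      exact Finset.sum_congr rfl fun A _ => by ring
    simp only [formV, ha, hb, hp, hpt, hs]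
    push_cast
    linear_combination -(1 / 2) * Complex.exp (2 * g.phi) *
      ((-2 * Complex.exp (-2 * g.phi) * w.phi) +
      I * (w.phit + ∑ A, (g.b A * w.a A - g.a A * w.b A))) * (I_mul_I)

/-- `J_G(p)` is left-invariant. -/
theorem JG_mul {e : (Fin m → ℂ) → Fin m → Fin m → ℂ} (he : P.IsVielbein e) {p : Fin m → ℂ}
    (hp : p ∈ P.Msk) (k h w : IwasawaGroup (m + 1)) :
    P.JG e p (k * h) (dLeft k h w) = dLeft k h (P.JG e p h w) := by
  obtain ⟨h2, h3⟩ := P.JG_forms he hp h w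
  -- $F_{AB}$ depends on $p$ alone, so left translation only rescales $\eta$. The constant factor is
  -- harmless, since it commutes with multiplication by $i$.
  have eta_left : ∀ u, P.eta (p, k * h) (0, leftL k u) =
      (Real.exp (-k.phi) : ℂ) • P.eta (p, h) (0, u) := by
    intro u
    funext A
    simp only [eta, leftL_apply, a_mk, b_mk, Pi.smul_apply, smul_eq_mul, Complex.ofReal_mul,
      mul_sub, Finset.mul_sum]
    congr 1
    exact Finset.sum_congr rfl fun B _ => by ring
  -- The form $d\tilde\phi+b\,da-a\,db$ is multiplied by $e^{-2\phi(k)}$, which the prefactor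
  -- $e^{2\phi}$ compensates.
  have v_left : ∀ u, formV (m := m) (p, k * h) (0, leftL k u) = formV (m := m) (p, h) (0, u) := by
    intro u
    have e1 : Real.exp (2 * (k.phi + h.phi)) * Real.exp (-2 * (k.phi + h.phi)) =
        Real.exp (2 * h.phi) * Real.exp (-2 * h.phi) := by
      rw [← Real.exp_add, ← Real.exp_add]; ring_nf
    have e2 : Real.exp (2 * (k.phi + h.phi)) * (Real.exp (-2 * k.phi)) = Real.exp (2 * h.phi) := by
      rw [← Real.exp_add]; ring_nf
    have e3 : Real.exp (-k.phi) * Real.exp (-k.phi) = Real.exp (-2 * k.phi) := by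
      rw [← Real.exp_add]; ring_nf
    have hs : (Real.exp (-2 * k.phi) * u.phit
          + Real.exp (-k.phi) * ∑ A, (k.a A * u.b A - u.a A * k.b A))
        + ∑ A, ((k.b + Real.exp (-k.phi) • h.b) A * (Real.exp (-k.phi) • u.a) A -
          (k.a + Real.exp (-k.phi) • h.a) A * (Real.exp (-k.phi) • u.b) A) =
        Real.exp (-2 * k.phi) * (u.phit + ∑ A, (h.b A * u.a A - h.a A * u.b A)) := by
      rw [mul_add, add_assoc, Finset.mul_sum, Finset.mul_sum, ← Finset.sum_add_distrib]
      congr 1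
      refine Finset.sum_congr rfl fun A _ => ?_
      simp only [Pi.add_apply, Pi.smul_apply, smul_eq_mul, ← e3]
      ring
    simp only [formV, leftL_apply, mul_def, phi_mk, phit_mk, a_mk, b_mk, hs]
    have e1' := congrArg (fun t : ℝ => (t : ℂ)) e1
    have e2' := congrArg (fun t : ℝ => (t : ℂ)) e2
    simp only [Complex.ofReal_mul] at e1' e2' ⊢
    linear_combination (1 / 2) * ((-2 : ℝ) : ℂ) * (u.phi : ℂ) * e1' +
      (1 / 2) * I * ((u.phit + ∑ A, (h.b A * u.a A - h.a A * u.b A) : ℝ) : ℂ) * e2'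
  rw [dLeft_eq]
  refine P.JG_eq he hp ?_ ?_
  · rw [eta_left, eta_left, h2, smul_comm]
  · rw [v_left, v_left, h3]

theorem pullLeft_JG {e : (Fin m → ℂ) → Fin m → Fin m → ℂ} (he : P.IsVielbein e) {p : Fin m → ℂ}
    (hp : p ∈ P.Msk) (x : IwasawaGroup (m + 1)) : pullLeft x (P.JG e p) = P.JG e p := by
  funext h
  refine ContinuousLinearMap.ext fun w => ?_
  simp only [pullLeft, ContinuousLinearMap.comp_apply]
  rw [P.JG_mul he hp, dLeft_eq, dLeft_eq, leftL_inv_leftL]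

/-- The global holomorphic coordinates `(z, w, τ)` of `(M, J₃)`. -/
noncomputable def holCoord (q : Ambient m) : (Fin m → ℂ) × (Fin (m + 1) → ℂ) × ℂ :=
  (q.1, P.eta q q, (Real.exp (-2 * q.2.phi) : ℂ) - I * (q.2.phit : ℂ) -
    I * ∑ A, (q.2.a A : ℂ) * P.eta q q A)

/-- The function `e^{-2φ}` in terms of the holomorphic coordinates. -/
noncomputable def holHeight (t : (Fin m → ℂ) × (Fin (m + 1) → ℂ) × ℂ) : ℝ :=
  t.2.2.re - ∑ A, P.solA t.1 t.2.1 A * (t.2.1 A).im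

/-- The inverse of the holomorphic coordinates. -/
noncomputable def holCoordInv (t : (Fin m → ℂ) × (Fin (m + 1) → ℂ) × ℂ) : Ambient m :=
  (t.1, IwasawaGroup.mk (-(1 / 2) * Real.log (P.holHeight t))
    (-t.2.2.im - ∑ A, P.solA t.1 t.2.1 A * (t.2.1 A).re) (P.solA t.1 t.2.1) (P.solB t.1 t.2.1))

theorem contDiffOn_FAB (A B : Fin (m + 1)) : ContDiffOn ℝ ∞ (fun z => P.FAB z A B) P.Msk :=
  fun _ hz => ((P.analyticAt_FAB hz A B).contDiffAt.restrict_scalars ℝ).contDiffWithinAt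

theorem contDiffOn_NAB (A B : Fin (m + 1)) : ContDiffOn ℝ ∞ (fun z => P.NAB z A B) P.Msk :=
  imCLM.contDiff.comp_contDiffOn (P.contDiffOn_FAB A B)

theorem hasFDerivAt_coord (L : IwasawaGroup (m + 1) →L[ℝ] ℝ) (q : Ambient m) :
    HasFDerivAt (fun q : Ambient m => (L q.2 : ℂ))
      (ofRealCLM.comp (L.comp (ContinuousLinearMap.snd ℝ _ _))) q :=
  (ofRealCLM.comp (L.comp (ContinuousLinearMap.snd ℝ (Fin m → ℂ) _))).hasFDerivAt

theorem contDiff_coord (L : IwasawaGroup (m + 1) →L[ℝ] ℝ) :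
    ContDiff ℝ ∞ (fun q : Ambient m => (L q.2 : ℂ)) :=
  (ofRealCLM.comp (L.comp (ContinuousLinearMap.snd ℝ (Fin m → ℂ) _))).contDiff

theorem contDiffOn_eta : ContDiffOn ℝ ∞ (fun q : Ambient m => P.eta q q) P.M := by
  refine contDiffOn_pi.mpr fun A => ?_
  refine (contDiff_coord (bL A)).contDiffOn.sub (ContDiffOn.sum fun B _ => ContDiffOn.mul ?_
    (contDiff_coord (aL B)).contDiffOn)
  exact (P.contDiffOn_FAB A B).comp contDiff_fst.contDiffOn fun q hq => hq.1

theorem contDiffOn_holCoord : ContDiffOn ℝ ∞ P.holCoord P.M := by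
  have h2 : ContDiff ℝ ∞ (fun q : Ambient m => (Real.exp (-2 * q.2.phi) : ℂ)) :=
    ofRealCLM.contDiff.comp (Real.contDiff_exp.comp
      (contDiff_const.mul (phiL.comp (ContinuousLinearMap.snd ℝ (Fin m → ℂ) _)).contDiff))
  refine contDiff_fst.contDiffOn.prodMk (P.contDiffOn_eta.prodMk ?_)
  refine (h2.contDiffOn.sub (contDiff_const.mul (contDiff_coord phitL)).contDiffOn).sub
    (contDiffOn_const.mul (ContDiffOn.sum fun A _ => (contDiff_coord (aL A)).contDiffOn.mul ?_))
  exact contDiffOn_pi.mp P.contDiffOn_eta A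

theorem contDiffOn_solA :
    ContDiffOn ℝ ∞ (fun t : (Fin m → ℂ) × (Fin (m + 1) → ℂ) × ℂ => P.solA t.1 t.2.1)
      {t | t.1 ∈ P.Msk} := by
  refine contDiffOn_pi.mpr fun A => ?_
  simp only [solA, Pi.neg_apply, Matrix.mulVec, dotProduct]
  refine ContDiffOn.neg (ContDiffOn.sum fun B _ => ContDiffOn.mul ?_ ?_)
  · exact (contDiffOn_matrix_inv P.contDiffOn_NAB (fun z hz => P.det_NAB_ne_zero hz) A B).comp
      contDiff_fst.contDiffOn fun t ht => ht
  · exact (imCLM.contDiff.comp ((contDiff_apply ℝ ℂ B).comp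
      (contDiff_fst.comp contDiff_snd))).contDiffOn

theorem contDiffOn_holHeight : ContDiffOn ℝ ∞ P.holHeight {t | t.1 ∈ P.Msk} := by
  refine (reCLM.contDiff.comp (contDiff_snd.comp contDiff_snd)).contDiffOn.sub
    (ContDiffOn.sum fun A _ => (contDiffOn_pi.mp P.contDiffOn_solA A).mul ?_)
  exact (imCLM.contDiff.comp ((contDiff_apply ℝ ℂ A).comp
      (contDiff_fst.comp contDiff_snd))).contDiffOn

theorem contDiffOn_holCoordInv :
    ContDiffOn ℝ ∞ P.holCoordInv {t | t.1 ∈ P.Msk ∧ 0 < P.holHeight t} := by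
  have hA := P.contDiffOn_solA.mono (fun t (ht : t.1 ∈ P.Msk ∧ 0 < P.holHeight t) => ht.1)
  have hre : ∀ A, ContDiff ℝ ∞ (fun t : (Fin m → ℂ) × (Fin (m + 1) → ℂ) × ℂ => (t.2.1 A).re) :=
    fun A => reCLM.contDiff.comp ((contDiff_apply ℝ ℂ A).comp (contDiff_fst.comp contDiff_snd))
  refine contDiff_fst.contDiffOn.prodMk (contDiffOn_mk ?_ ?_ hA ?_)
  · exact contDiffOn_const.mul ((P.contDiffOn_holHeight.mono fun t ht => ht.1).log
      fun t ht => ht.2.ne')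
  · exact (imCLM.contDiff.comp (contDiff_snd.comp contDiff_snd)).neg.contDiffOn.sub
      (ContDiffOn.sum fun A _ => (contDiffOn_pi.mp hA A).mul (hre A).contDiffOn)
  · refine contDiffOn_pi.mpr fun A => (hre A).contDiffOn.add (ContDiffOn.sum fun B _ =>
      ContDiffOn.mul ?_ (contDiffOn_pi.mp hA B))
    exact reCLM.contDiff.comp_contDiffOn ((P.contDiffOn_FAB A B).comp contDiff_fst.contDiffOn
      fun t ht => ht.1)

/-- From the definition of $\tau$, $\operatorname{Re}\tau=e^{-2\phi}+a^A\operatorname{Im}w_A$, and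
$a$ is recovered from $w$. Positivity of this function is thus the only condition on $(w,\tau)$ in
the image. -/
theorem holHeight_holCoord {q : Ambient m} (hq : q ∈ P.M) :
    P.holHeight (P.holCoord q) = Real.exp (-2 * q.2.phi) := by
  have h : P.solA q.1 (P.eta q q) = q.2.a := (P.sol_unique hq.1 fun A => rfl).1
  simp only [holHeight, holCoord, h]
  have hs : (∑ A, (q.2.a A : ℂ) * P.eta q q A).im = ∑ A, q.2.a A * (P.eta q q A).im := by
    simp [Complex.im_sum]
  simp only [Complex.sub_re, Complex.mul_re, I_re, I_im, Complex.ofReal_re, Complex.ofReal_im, hs]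
  ring

theorem holCoordInv_holCoord {q : Ambient m} (hq : q ∈ P.M) : P.holCoordInv (P.holCoord q) = q := by
  have h0 := P.holHeight_holCoord hq
  obtain ⟨h1, h2⟩ := P.sol_unique hq.1 (w := P.eta q q) fun A => rfl
  refine Prod.ext rfl (ext' ?_ ?_ h1 h2)
  · simp only [holCoordInv, h0, phi_mk, Real.log_exp]
    ring
  · simp only [holCoordInv, phit_mk, holCoord, h1]
    have hs : (∑ A, (q.2.a A : ℂ) * P.eta q q A).re = ∑ A, q.2.a A * (P.eta q q A).re := by
      simp [Complex.re_sum]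
    simp only [Complex.sub_im, Complex.mul_im, I_re, I_im, Complex.ofReal_re, Complex.ofReal_im, hs]
    ring

theorem holCoord_holCoordInv {t : (Fin m → ℂ) × (Fin (m + 1) → ℂ) × ℂ} (h1 : t.1 ∈ P.Msk)
    (h2 : 0 < P.holHeight t) : P.holCoord (P.holCoordInv t) = t := by
  have hw : P.eta (P.holCoordInv t) (P.holCoordInv t) = t.2.1 := funext fun A =>
    P.sol_spec h1 t.2.1 A
  have hexp : Real.exp (-2 * (P.holCoordInv t).2.phi) = P.holHeight t := by
    simp only [holCoordInv, phi_mk]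
    rw [← Real.exp_log h2]
    simp
  refine Prod.ext rfl (Prod.ext hw ?_)
  simp only [holCoord, hexp, hw]
  simp only [holCoordInv, phit_mk, a_mk, holHeight]
  have hre : (∑ A, (P.solA t.1 t.2.1 A : ℂ) * t.2.1 A).re =
      ∑ A, P.solA t.1 t.2.1 A * (t.2.1 A).re := by
    simp [Complex.re_sum]
  have him : (∑ A, (P.solA t.1 t.2.1 A : ℂ) * t.2.1 A).im =
      ∑ A, P.solA t.1 t.2.1 A * (t.2.1 A).im := by
    simp [Complex.im_sum]
  apply Complex.ext
  · simp only [Complex.sub_re, Complex.mul_re, I_re, I_im, Complex.ofReal_re, Complex.ofReal_im,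
      him]
    ring
  · simp only [Complex.sub_im, Complex.mul_im, I_re, I_im, Complex.ofReal_re, Complex.ofReal_im,
      hre]
    ring

/-- The global holomorphic chart of `(M, J₃)`. -/
noncomputable def holChart :
    OpenPartialHomeomorph (Ambient m) ((Fin m → ℂ) × (Fin (m + 1) → ℂ) × ℂ) where
  toFun := P.holCoord
  invFun := P.holCoordInv
  source := P.M
  target := {t | t.1 ∈ P.Msk ∧ 0 < P.holHeight t}
  map_source' q hq := ⟨hq.1, by rw [P.holHeight_holCoord hq]; exact Real.exp_pos _⟩
  map_target' t ht := ⟨ht.1, mem_univ _⟩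
  left_inv' q hq := P.holCoordInv_holCoord hq
  right_inv' t ht := P.holCoord_holCoordInv ht.1 ht.2
  open_source := P.isOpen_M
  open_target := P.contDiffOn_holHeight.continuousOn.isOpen_inter_preimage
    (P.isOpen_Msk.preimage continuous_fst) isOpen_Ioi
  continuousOn_toFun := P.contDiffOn_holCoord.continuousOn
  continuousOn_invFun := P.contDiffOn_holCoordInv.continuousOn

/-- $dw_A$ is $\eta_A$ minus the term from differentiating $F_{AB}$. As $F_{AB}$ is holomorphic,
that term is complex linear in $dz$ and does not spoil the type $(1,0)$; only this linearity of `R`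
matters. -/
theorem exists_hasFDerivAt_eta {q : Ambient m} (hq : q ∈ P.M) (A : Fin (m + 1)) :
    ∃ (T : Ambient m →L[ℝ] ℂ) (R : (Fin m → ℂ) →L[ℂ] ℂ),
      HasFDerivAt (fun q : Ambient m => P.eta q q A) T q ∧
      ∀ X, T X = P.eta q X A - R X.1 := by
  have hF : ∀ B, HasFDerivAt (fun q : Ambient m => P.FAB q.1 A B)
      (((fderiv ℂ (fun z => P.FAB z A B) q.1).restrictScalars ℝ).comp
        (ContinuousLinearMap.fst ℝ _ _)) q := fun B =>
    ((P.analyticAt_FAB hq.1 A B).differentiableAt.hasFDerivAt.restrictScalars ℝ).comp q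
      hasFDerivAt_fst
  refine ⟨_, ∑ B, (q.2.a B : ℂ) • fderiv ℂ (fun z => P.FAB z A B) q.1,
    (hasFDerivAt_coord (bL A) q).sub
    (HasFDerivAt.fun_sum fun B _ => (hF B).mul (hasFDerivAt_coord (aL B) q)), fun X => ?_⟩
  simp only [eta, sub_apply, sum_apply, add_apply, smul_apply, ContinuousLinearMap.comp_apply,
    ContinuousLinearMap.coe_snd', ContinuousLinearMap.coe_fst', bL_apply, aL_apply, ofRealCLM_apply,
    ContinuousLinearMap.coe_restrictScalars', Finset.sum_add_distrib, smul_eq_mul]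
  ring

theorem exists_hasFDerivAt_tau {q : Ambient m} (hq : q ∈ P.M) :
    ∃ (T : Ambient m →L[ℝ] ℂ) (R : (Fin m → ℂ) →L[ℂ] ℂ),
      HasFDerivAt (fun q : Ambient m => (P.holCoord q).2.2) T q ∧
      ∀ X, T X = 2 * (Real.exp (-2 * q.2.phi) : ℂ) * conj (formV q X) -
        2 * I * ∑ A, (q.2.a A : ℂ) * P.eta q X A + R X.1 := by
  choose T R hT hTR using P.exists_hasFDerivAt_eta hq
  have h2 : HasFDerivAt (fun q : Ambient m => (Real.exp (-2 * q.2.phi) : ℂ))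
      (ofRealCLM.comp (Real.exp (-2 * q.2.phi) •
        ((-2 : ℝ) • phiL.comp (ContinuousLinearMap.snd ℝ _ _)))) q :=
    ofRealCLM.hasFDerivAt.comp q
      (((phiL.comp (ContinuousLinearMap.snd ℝ (Fin m → ℂ) _)).hasFDerivAt.const_mul (-2)).exp)
  refine ⟨_, I • ∑ A, (q.2.a A : ℂ) • R A,
    (h2.sub ((hasFDerivAt_coord phitL q).const_mul I)).sub
    ((HasFDerivAt.fun_sum fun A _ => (hasFDerivAt_coord (aL A) q).mul (hT A)).const_mul I),
    fun X => ?_⟩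
  have hexp : (Real.exp (2 * q.2.phi) : ℂ) * (Real.exp (-2 * q.2.phi) : ℂ) = 1 := by
    rw [← Complex.ofReal_mul, ← Real.exp_add]; simp
  -- The symmetry of $F_{AB}$ makes the derivative of $a^Aw_A$ produce exactly $b\,da-a\,db$, the
  -- form inside $v$, up to a multiple of $\eta$.
  have hs : ∑ A, (X.2.a A : ℂ) * P.eta q q A + ∑ A, (q.2.a A : ℂ) * P.eta q X A =
      ∑ A, ((q.2.b A : ℂ) * X.2.a A - q.2.a A * X.2.b A) +
        2 * ∑ A, (q.2.a A : ℂ) * P.eta q X A := by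
    have hsym : ∑ A, ∑ B, (X.2.a A : ℂ) * (P.FAB q.1 A B * q.2.a B) =
        ∑ A, ∑ B, (q.2.a A : ℂ) * (P.FAB q.1 A B * X.2.a B) := by
      rw [Finset.sum_comm]
      refine Finset.sum_congr rfl fun A _ => Finset.sum_congr rfl fun B _ => ?_
      rw [P.FAB_comm hq.1]
      ring
    simp only [eta, mul_sub, Finset.sum_sub_distrib, Finset.mul_sum] at hsym ⊢
    simp only [← Finset.mul_sum] at hsym ⊢
    have hc : ∑ A, (X.2.a A : ℂ) * q.2.b A = ∑ A, (q.2.b A : ℂ) * X.2.a A :=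
      Finset.sum_congr rfl fun A _ => mul_comm _ _
    linear_combination hc - hsym
  simp only [formV, sub_apply, sum_apply, add_apply, smul_apply, ContinuousLinearMap.comp_apply,
    ContinuousLinearMap.coe_snd', aL_apply, phiL_apply, phitL_apply, ofRealCLM_apply, hTR,
    smul_eq_mul, mul_sub, Finset.sum_sub_distrib, Finset.sum_add_distrib]
  simp only [map_mul, map_add, Complex.conj_ofReal, conj_I, map_div₀, map_one, map_ofNat]
  push_cast at hs hexp ⊢
  rw [Finset.sum_sub_distrib] at hs
  have hc : ∑ A, P.eta q q A * (X.2.a A : ℂ) = ∑ A, (X.2.a A : ℂ) * P.eta q q A :=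
    Finset.sum_congr rfl fun A _ => mul_comm _ _
  rw [hc]
  linear_combination -I * hs - (-2 * cexp (-2 * q.2.phi) * X.2.phi - I * (X.2.phit +
    (∑ x, (q.2.b x : ℂ) * X.2.a x - ∑ x, (q.2.a x : ℂ) * X.2.b x))) * hexp

/-- The differentials $dz,dw,d\tau$ are complex combinations of $dz,\eta,\bar v$, each of which
$J_3$ multiplies by $i$. -/
theorem isHolChart_holChart {e : (Fin m → ℂ) → Fin m → Fin m → ℂ} (he : P.IsVielbein e) :
    IsHolChart (P.J3 e) P.holChart where
  smooth := P.contDiffOn_holCoord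
  smooth_symm := P.contDiffOn_holCoordInv
  comm q hq X := by
    obtain ⟨h1, h2, h3⟩ := P.J3_forms he hq X
    choose T R hT hTR using P.exists_hasFDerivAt_eta hq
    obtain ⟨T', R', hT', hTR'⟩ := P.exists_hasFDerivAt_tau hq
    have hd : HasFDerivAt P.holChart
        ((ContinuousLinearMap.fst ℝ _ _).prod ((ContinuousLinearMap.pi T).prod T')) q :=
      hasFDerivAt_fst.prodMk ((hasFDerivAt_pi.mpr hT).prodMk hT')
    have h2' : ∀ A, P.eta q (P.J3 e q X) A = I * P.eta q X A := fun A => congrFun h2 A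
    rw [hd.fderiv]
    refine Prod.ext h1 (Prod.ext (funext fun A => ?_) ?_)
    · change T A (P.J3 e q X) = I * T A X
      rw [hTR, hTR, h1, h2', map_smul, smul_eq_mul, mul_sub]
    · change T' (P.J3 e q X) = I * T' X
      rw [hTR', hTR', h1, h3, map_smul, smul_eq_mul]
      have hs : ∑ A, (q.2.a A : ℂ) * P.eta q (P.J3 e q X) A =
          I * ∑ A, (q.2.a A : ℂ) * P.eta q X A := by
        rw [Finset.mul_sum]
        exact Finset.sum_congr rfl fun A _ => by rw [h2']; ring
      rw [hs]
      simp only [map_mul, map_neg, conj_I]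
      ring

theorem contDiffOn_J3 {e : (Fin m → ℂ) → Fin m → Fin m → ℂ} (he : P.IsVielbein e) :
    ContDiffOn ℝ ∞ (P.J3 e) P.M :=
  (P.isHolChart_holChart he).contDiffOn_J

theorem contDiffOn_JG {e : (Fin m → ℂ) → Fin m → Fin m → ℂ} (he : P.IsVielbein e) :
    ContDiffOn ℝ ∞ (fun q : Ambient m => P.JG e q.1 q.2) P.M :=
  contDiffOn_const.clm_comp ((P.contDiffOn_J3 he).clm_comp contDiffOn_const)

end SpecialKahlerDomain

/-! ### The holomorphic constant rank theorem. -/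

section ConstantRank

variable {E₁ E₂ : Type*} [NormedAddCommGroup E₁] [NormedSpace ℂ E₁] [FiniteDimensional ℂ E₁]
  [NormedAddCommGroup E₂] [NormedSpace ℂ E₂] [FiniteDimensional ℂ E₂]

/-- A linear map whose composition with a linear map onto a space of the dimension of its range is
surjective vanishes wherever the composition does. -/
theorem apply_eq_zero_of_comp_surjective {V W R : Type*} [AddCommGroup V] [Module ℂ V]
    [FiniteDimensional ℂ V] [AddCommGroup W] [Module ℂ W] [AddCommGroup R]
    [Module ℂ R] [FiniteDimensional ℂ R] (T : V →ₗ[ℂ] W) (Q : W →ₗ[ℂ] R)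
    (hs : Function.Surjective (Q ∘ₗ T))
    (hr : Module.finrank ℂ (LinearMap.range T) ≤ Module.finrank ℂ R) {v : V} (hv : Q (T v) = 0) :
    T v = 0 := by
  have h := LinearMap.finrank_range_add_finrank_ker (Q.domRestrict (LinearMap.range T))
  have hsur : LinearMap.range (Q.domRestrict (LinearMap.range T)) = ⊤ := by
    rw [LinearMap.range_eq_top]
    intro y
    obtain ⟨x, hx⟩ := hs y
    exact ⟨⟨T x, x, rfl⟩, hx⟩
  rw [hsur, finrank_top] at h
  have hk : LinearMap.ker (Q.domRestrict (LinearMap.range T)) = ⊥ :=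
    Submodule.finrank_eq_zero.mp (by omega)
  have hm : (⟨T v, v, rfl⟩ : LinearMap.range T) ∈ LinearMap.ker (Q.domRestrict (LinearMap.range T)) :=
    hv
  rw [hk, Submodule.mem_bot] at hm
  exact congrArg Subtype.val hm

theorem finrank_submodule_prod (p : Submodule ℂ E₁) (q : Submodule ℂ E₂) :
    Module.finrank ℂ (p.prod q) = Module.finrank ℂ p + Module.finrank ℂ q := by
  rw [← Module.finrank_prod]
  exact LinearEquiv.finrank_eq
    { toFun := fun x => (⟨x.1.1, x.2.1⟩, ⟨x.1.2, x.2.2⟩)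
      invFun := fun x => ⟨(x.1, x.2), x.1.2, x.2.2⟩
      map_add' := fun _ _ => rfl
      map_smul' := fun _ _ => rfl
      left_inv := fun _ => rfl
      right_inv := fun _ => rfl }

/-- The level sets of a holomorphic map of constant rank can be straightened. -/
theorem exists_straightening {U : Set E₁} (hU : IsOpen U) {f : E₁ → E₂} (hf : ContDiffOn ℂ ∞ f U)
    {r : ℕ} (hr : ∀ z ∈ U, Module.finrank ℂ (LinearMap.range (fderiv ℂ f z).toLinearMap) = r)
    {p : E₁} (hp : p ∈ U) :
    ∃ (R : Submodule ℂ E₂) (K : Submodule ℂ E₁) (ψ : OpenPartialHomeomorph E₁ (R × K))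
      (L : Submodule ℂ (R × K)), p ∈ ψ.source ∧ ψ.source ⊆ U ∧
      ContDiffOn ℂ ∞ ψ ψ.source ∧ ContDiffOn ℂ ∞ ψ.symm ψ.target ∧
      Module.finrank ℂ L + r = Module.finrank ℂ (R × K) ∧
      ψ '' (ψ.source ∩ {z | z ∈ U ∧ f z = f p}) = ψ.target ∩ (L : Set (R × K)) := by
  set A := fderiv ℂ f p with hA
  let R : Submodule ℂ E₂ := LinearMap.range A.toLinearMap
  let K : Submodule ℂ E₁ := LinearMap.ker A.toLinearMap
  -- `Q₀` and `S₀` are linear projections onto the range and the kernel of the differential at `p`.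
  -- They make the map `g` below a local biholomorphism at `p`.
  obtain ⟨Q₀, hQ₀⟩ := LinearMap.exists_leftInverse_of_injective R.subtype R.ker_subtype
  obtain ⟨S₀, hS₀⟩ := LinearMap.exists_leftInverse_of_injective K.subtype K.ker_subtype
  let Q : E₂ →L[ℂ] R := LinearMap.toContinuousLinearMap Q₀
  let S : E₁ →L[ℂ] K := LinearMap.toContinuousLinearMap S₀
  have hQ : ∀ x : R, Q x = x := fun x => congrArg (fun T => T x) hQ₀
  have hS : ∀ x : K, S x = x := fun x => congrArg (fun T => T x) hS₀
  have hRr : Module.finrank ℂ R = r := hr p hp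
  have hdim : Module.finrank ℂ R + Module.finrank ℂ K = Module.finrank ℂ E₁ :=
    LinearMap.finrank_range_add_finrank_ker A.toLinearMap
  have hfd : ∀ z ∈ U, HasFDerivAt f (fderiv ℂ f z) z := fun z hz =>
    ((hf.contDiffAt (hU.mem_nhds hz)).differentiableAt (by simp)).hasFDerivAt
  let g : E₁ → R × K := fun z => (Q (f z - f p), S (z - p))
  have hg : ContDiffOn ℂ ∞ g U :=
    (Q.contDiff.comp_contDiffOn (hf.sub contDiffOn_const)).prodMk
      (S.contDiff.comp (contDiff_id.sub contDiff_const)).contDiffOn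
  have hgd : ∀ z ∈ U, HasFDerivAt g ((Q.comp (fderiv ℂ f z)).prod S) z := fun z hz => by
    have h1 : HasFDerivAt (fun z => Q (f z - f p)) (Q.comp (fderiv ℂ f z)) z :=
      Q.hasFDerivAt.comp z ((hfd z hz).sub_const (f p))
    have h2 : HasFDerivAt (fun z => S (z - p)) S z := by
      exact S.hasFDerivAt.comp z ((hasFDerivAt_id z).sub_const p)
    exact h1.prodMk h2
  have hgp : g p = 0 := by simp [g]
  have hinj : Function.Injective ((Q.comp A).prod S).toLinearMap := by
    rw [injective_iff_map_eq_zero]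
    intro x hx
    have h1 : Q (A x) = 0 := congrArg Prod.fst hx
    have h2 : S x = 0 := congrArg Prod.snd hx
    have h3 : A x = 0 := by
      have := hQ ⟨A x, x, rfl⟩
      rw [h1] at this
      exact (congrArg Subtype.val this).symm
    have := hS ⟨x, h3⟩
    rw [h2] at this
    exact (congrArg Subtype.val this).symm
  let G : E₁ ≃L[ℂ] R × K := (LinearEquiv.ofInjectiveOfFinrankEq _ hinj
    (by rw [Module.finrank_prod, hdim])).toContinuousLinearEquiv
  have hG : (G : E₁ →L[ℂ] R × K) = (Q.comp A).prod S := rfl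
  have hgc : ContDiffAt ℂ ∞ g p := hg.contDiffAt (hU.mem_nhds hp)
  have hgG : HasFDerivAt g (G : E₁ →L[ℂ] R × K) p := hG ▸ hgd p hp
  let φ := hgc.toOpenPartialHomeomorph g hgG (by simp)
  have hφ : ∀ z, φ z = g z := fun z => rfl
  have hpφ : p ∈ φ.source := hgc.mem_toOpenPartialHomeomorph_source hgG (by simp)
  -- shrink the source to the set where the differential is invertible
  let U' : Set E₁ := U ∩ fderiv ℂ g ⁻¹' range ((↑) : (E₁ ≃L[ℂ] R × K) → E₁ →L[ℂ] R × K)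
  have hU' : IsOpen U' := (hg.continuousOn_fderiv_of_isOpen hU (by simp)).isOpen_inter_preimage hU
    ContinuousLinearEquiv.isOpen
  have hpU' : p ∈ U' := ⟨hp, G, hgG.fderiv.symm⟩
  let φ' := φ.restrOpen U' hU'
  have h0 : (0 : R × K) ∈ φ'.target := by
    rw [← hgp]
    exact φ'.map_source (x := p) ⟨hpφ, hpU'⟩
  -- The target is cut down to a ball so that its slice over $0\in R$ is a ball in `K`, hence
  -- connected.
  obtain ⟨ε, hε, hball⟩ := Metric.isOpen_iff.mp φ'.open_target 0 h0
  let ψ := (φ'.symm.restrOpen (Metric.ball 0 ε) Metric.isOpen_ball).symm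
  have hψt : ψ.target = Metric.ball 0 ε := inter_eq_right.mpr hball
  have hψ : ∀ z, ψ z = g z := fun z => rfl
  have hψs : ψ.source ⊆ U' := by
    intro z hz
    have h1 := ψ.map_source hz
    have h2 := φ'.map_target (hball (hψt ▸ h1))
    have h3 : φ'.symm (ψ z) = z := ψ.left_inv hz
    rw [h3] at h2
    exact h2.2
  have hpψ : p ∈ ψ.source := by
    have h1 : ψ.symm 0 ∈ ψ.source := ψ.map_target (by rw [hψt]; exact Metric.mem_ball_self hε)
    have h2 : ψ.symm 0 = p := by
      rw [← hgp]
      exact φ'.left_inv (x := p) ⟨hpφ, hpU'⟩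
    rwa [h2] at h1
  have hsymm : ContDiffOn ℂ ∞ ψ.symm ψ.target := by
    intro y hy
    obtain ⟨hyU, e, he⟩ := hψs (ψ.map_target hy)
    have h1 : ContDiffAt ℂ ∞ ψ (ψ.symm y) := hg.contDiffAt (hU.mem_nhds hyU)
    refine (ψ.contDiffAt_symm (f₀' := e) hy ?_ h1).contDiffWithinAt
    rw [he]
    exact (h1.differentiableAt (by simp)).hasFDerivAt
  have hsd : ∀ y ∈ ψ.target, HasFDerivAt ψ.symm (fderiv ℂ ψ.symm y) y := fun y hy =>
    ((hsymm.contDiffAt (ψ.open_target.mem_nhds hy)).differentiableAt (by simp)).hasFDerivAt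
  -- `f` does not depend on the second coordinate
  have hker : ∀ y ∈ ψ.target, ∀ k : K,
      fderiv ℂ f (ψ.symm y) (fderiv ℂ ψ.symm y (0, k)) = 0 := by
    intro y hy k
    have hyU : ψ.symm y ∈ U := (hψs (ψ.map_target hy)).1
    have h1 : HasFDerivAt (fun y => Q (f (ψ.symm y) - f p))
        (Q.comp ((fderiv ℂ f (ψ.symm y)).comp (fderiv ℂ ψ.symm y))) y :=
      Q.hasFDerivAt.comp y (((hfd _ hyU).comp y (hsd y hy)).sub_const (f p))
    have h2 : HasFDerivAt (fun y => Q (f (ψ.symm y) - f p)) (ContinuousLinearMap.fst ℂ R K) y := by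
      refine hasFDerivAt_fst.congr_of_eventuallyEq ?_
      filter_upwards [ψ.open_target.mem_nhds hy] with x hx
      exact congrArg Prod.fst (ψ.right_inv hx)
    have h3 : ∀ v, Q (fderiv ℂ f (ψ.symm y) (fderiv ℂ ψ.symm y v)) = v.1 := fun v =>
      congrArg (fun T => T v) (h1.unique h2)
    -- Constant rank enters here: `Q` composed with the differential of $f\circ\psi^{-1}$ is the
    -- projection onto `R`, whose dimension is the rank, so `Q` is injective on the range of that
    -- differential.
    refine apply_eq_zero_of_comp_surjective
      ((fderiv ℂ f (ψ.symm y)).toLinearMap ∘ₗ (fderiv ℂ ψ.symm y).toLinearMap) Q.toLinearMap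
      (fun x => ⟨(x, 0), h3 (x, 0)⟩) ?_ (v := (0, k)) (h3 (0, k))
    rw [hRr, ← hr _ hyU]
    exact Submodule.finrank_mono (LinearMap.range_comp_le_range _ _)
  have hconst : ∀ k : K, ((0 : R), k) ∈ ψ.target → f (ψ.symm (0, k)) = f p := by
    intro k hk
    have hmem : ∀ x ∈ Metric.ball (0 : K) ε, ((0 : R), x) ∈ ψ.target := fun x hx => by
      rw [hψt]
      simpa [Prod.norm_def, hε] using hx
    have hd : ∀ x ∈ Metric.ball (0 : K) ε, HasFDerivAt (fun x : K => f (ψ.symm (0, x)))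
        (0 : K →L[ℂ] E₂) x := fun x hx => by
      have h1 : HasFDerivAt (fun x : K => ((0 : R), x)) (ContinuousLinearMap.inr ℂ R K) x :=
        hasFDerivAt_prodMk_right 0 x
      have h2 := ((hfd _ (hψs (ψ.map_target (hmem x hx))).1).comp _ (hsd _ (hmem x hx))).comp x h1
      refine h2.congr_fderiv (ContinuousLinearMap.ext fun v => hker _ (hmem x hx) v)
    have hk' : k ∈ Metric.ball (0 : K) ε := by
      rw [hψt] at hk
      simpa [Prod.norm_def, hε] using hk
    have := Metric.isOpen_ball.is_const_of_fderiv_eq_zero (𝕜 := ℂ)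
      (convex_ball (0 : K) ε).isPreconnected
      (fun x hx => (hd x hx).differentiableAt.differentiableWithinAt)
      (fun x hx => (hd x hx).fderiv) hk' (Metric.mem_ball_self hε)
    rw [this]
    congr 1
    have h2 : ψ.symm (g p) = p := φ'.left_inv (x := p) ⟨hpφ, hpU'⟩
    rw [hgp] at h2
    exact h2
  -- The level set is the slice $0\times K$, of codimension $\dim R=r$.
  refine ⟨R, K, ψ, Submodule.prod ⊥ ⊤, hpψ, fun z hz => (hψs hz).1,
    hg.mono fun z hz => (hψs hz).1, hsymm, ?_, ?_⟩
  · rw [finrank_submodule_prod, Module.finrank_prod, finrank_bot, finrank_top, hRr]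
    omega
  · ext y
    constructor
    · rintro ⟨z, ⟨hz, hzU, hzf⟩, rfl⟩
      refine ⟨ψ.map_source hz, ?_, trivial⟩
      change Q (f z - f p) = 0
      rw [hzf, sub_self, map_zero]
    · rintro ⟨hy, hyL, -⟩
      have hy0 : y = (0, y.2) := Prod.ext hyL rfl
      refine ⟨ψ.symm y, ⟨ψ.map_target hy, (hψs (ψ.map_target hy)).1, ?_⟩, ψ.right_inv hy⟩
      rw [hy0] at hy ⊢
      exact hconst _ hy

end ConstantRank

/-! ### Linear forms and elementary biholomorphisms. -/

/-- The linear form `w ↦ ∑ Dᴬ w_A`. -/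
noncomputable def linForm {n : ℕ} (D : Fin n → ℂ) : (Fin n → ℂ) →ₗ[ℂ] ℂ where
  toFun w := ∑ A, D A * w A
  map_add' v w := by simp [mul_add, Finset.sum_add_distrib]
  map_smul' c w := by
    simp only [Pi.smul_apply, smul_eq_mul, RingHom.id_apply, Finset.mul_sum]
    exact Finset.sum_congr rfl fun A _ => by ring

theorem linForm_apply {n : ℕ} (D w : Fin n → ℂ) : linForm D w = ∑ A, D A * w A := rfl

theorem linForm_surjective {n : ℕ} {D : Fin n → ℂ} (hD : D ≠ 0) :
    Function.Surjective (linForm D) := by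
  apply LinearMap.surjective
  intro h
  apply hD
  funext A
  have := congrArg (fun T => T (Pi.single A 1)) h
  simpa [linForm, Pi.single_apply] using this

theorem finrank_ker_linForm {n : ℕ} {D : Fin n → ℂ} (hD : D ≠ 0) :
    Module.finrank ℂ (LinearMap.ker (linForm D)) + 1 = n := by
  have h := LinearMap.finrank_range_add_finrank_ker (linForm D)
  rw [LinearMap.range_eq_top.mpr (linForm_surjective hD)] at h
  simp at h
  omega

theorem isBihol_addRight {E : Type*} [NormedAddCommGroup E] [NormedSpace ℂ E] (v : E) :
    IsBihol (Homeomorph.addRight v).toOpenPartialHomeomorph :=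
  ⟨(contDiff_id.add contDiff_const).contDiffOn, (contDiff_id.add contDiff_const).contDiffOn⟩

theorem IsBihol.prod_refl {E E' F : Type*} [NormedAddCommGroup E] [NormedSpace ℂ E]
    [NormedAddCommGroup E'] [NormedSpace ℂ E'] [NormedAddCommGroup F] [NormedSpace ℂ F]
    {φ : OpenPartialHomeomorph E E'} (h : IsBihol φ) :
    IsBihol (φ.prod (OpenPartialHomeomorph.refl F)) :=
  ⟨(h.hol.comp contDiff_fst.contDiffOn fun _ hx => hx.1).prodMk contDiff_snd.contDiffOn,
    (h.hol_symm.comp contDiff_fst.contDiffOn fun _ hx => hx.1).prodMk contDiff_snd.contDiffOn⟩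

/-! ### The subgroup $G^\wedge$ and its cosets. -/

section Affine

variable {n : ℕ} (D C : Fin n → ℂ)

/-- The linear form on `G` whose level sets are the sets `affineSet D C c`. -/
noncomputable def groupForm : IwasawaGroup n →ₗ[ℝ] ℂ where
  toFun g := ∑ A, D A * (g.b A : ℂ) - ∑ A, C A * (g.a A : ℂ)
  map_add' g h := by
    simp only [a_add, b_add, Pi.add_apply, Complex.ofReal_add, mul_add, Finset.sum_add_distrib]
    ring
  map_smul' c g := by
    simp only [a_smul, b_smul, Pi.smul_apply, smul_eq_mul, Complex.ofReal_mul, RingHom.id_apply,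
      Complex.real_smul, mul_sub, Finset.mul_sum]
    congr 1 <;> exact Finset.sum_congr rfl fun A _ => by ring

theorem mem_affineSet {c : ℂ} {g : IwasawaGroup n} : g ∈ affineSet D C c ↔ groupForm D C g = c :=
  Iff.rfl

/-- The form involves only $a$ and $b$, which multiply as in a semidirect product with scaling
$e^{-\phi}$. This cocycle rule makes the zero set a subgroup and the level sets its left cosets. -/
theorem groupForm_mul (g h : IwasawaGroup n) :
    groupForm D C (g * h) = groupForm D C g + (Real.exp (-g.phi) : ℂ) * groupForm D C h := by
  simp only [groupForm, LinearMap.coe_mk, AddHom.coe_mk, mul_def, a_mk, b_mk, Pi.add_apply,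
    Pi.smul_apply, smul_eq_mul, Complex.ofReal_add, Complex.ofReal_mul, mul_add, mul_sub,
    Finset.sum_add_distrib, Finset.mul_sum]
  have h1 : ∀ (E : Fin n → ℂ) (t : ℂ) (x : Fin n → ℝ),
      ∑ A, E A * (t * (x A : ℂ)) = ∑ A, t * (E A * (x A : ℂ)) := fun E t x =>
    Finset.sum_congr rfl fun A _ => by ring
  rw [h1, h1]
  ring

/-- The subgroup defined by `Dᴬ b_A - C_A aᴬ = 0`. -/
noncomputable def affineSubgroup : Subgroup (IwasawaGroup n) where
  carrier := affineSet D C 0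
  mul_mem' {g h} hg hh := by
    rw [mem_affineSet] at hg hh ⊢
    rw [groupForm_mul, hg, hh]
    simp
  one_mem' := (groupForm D C).map_zero
  inv_mem' {g} hg := by
    rw [mem_affineSet] at hg ⊢
    have h := groupForm_mul D C g⁻¹ g
    rw [inv_mul_cancel, hg, mul_zero, add_zero] at h
    rw [← h]
    exact (groupForm D C).map_zero

theorem image_mul_affineSubgroup {c : ℂ} {x : IwasawaGroup n} (hx : x ∈ affineSet D C c) :
    (fun h => x * h) '' (affineSubgroup D C : Set (IwasawaGroup n)) = affineSet D C c := by
  ext g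
  constructor
  · rintro ⟨h, hh, rfl⟩
    have hh' : groupForm D C h = 0 := hh
    rw [mem_affineSet] at hx ⊢
    rw [groupForm_mul, hh', hx]
    simp
  · intro hg
    refine ⟨x⁻¹ * g, ?_, by simp⟩
    rw [mem_affineSet] at hx hg
    have h := groupForm_mul D C x (x⁻¹ * g)
    rw [mul_inv_cancel_left, hx, hg] at h
    have h0 := left_eq_add.mp h
    exact (mul_eq_zero.mp h0).resolve_left (ofReal_ne_zero.mpr (Real.exp_pos _).ne')

theorem isSmoothSubmanifold_affineSet (hs : Function.Surjective (groupForm D C)) (c : ℂ) :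
    IsSmoothSubmanifold (affineSet D C c) 2 := by
  intro x hx
  let T : IwasawaGroup n ≃L[ℝ] (Fin (Module.finrank ℝ (IwasawaGroup n)) → ℝ) :=
    ContinuousLinearEquiv.ofFinrankEq (by simp)
  let ψ := (Homeomorph.addRight (-x)).trans T.toHomeomorph
  refine ⟨_, ψ.toOpenPartialHomeomorph,
    (LinearMap.ker (groupForm D C)).map (T : IwasawaGroup n →ₗ[ℝ] _), mem_univ _, ?_, ?_, ?_, ?_⟩
  · exact (T.contDiff.comp (contDiff_id.add contDiff_const)).contDiffOn
  · exact ((contDiff_id.add contDiff_const).comp T.symm.contDiff).contDiffOn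
  · have h := LinearMap.finrank_range_add_finrank_ker (groupForm D C)
    rw [LinearMap.range_eq_top.mpr hs, finrank_top, Complex.finrank_real_complex, add_comm] at h
    exact (congrArg (· + 2) (LinearEquiv.finrank_map_eq T.toLinearEquiv _)).trans h
  · refine OpenPartialHomeomorph.IsImage.image_eq fun g _ => ?_
    change T (g + -x) ∈ Submodule.map (T : IwasawaGroup n →ₗ[ℝ] _) (LinearMap.ker (groupForm D C)) ↔
      groupForm D C g = c
    have hx' : groupForm D C x = c := hx
    constructor
    · rintro ⟨y, hy, hyT⟩
      have : y = g + -x := T.injective hyT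
      rw [this] at hy
      have hy' : groupForm D C (g + -x) = 0 := hy
      rw [map_add, map_neg, hx', add_neg_eq_zero] at hy'
      exact hy'
    · intro h
      refine ⟨g + -x, ?_, rfl⟩
      change groupForm D C (g + -x) = 0
      rw [map_add, map_neg, hx', h, add_neg_cancel]

end Affine

/-! ### Complex submanifolds, the product structure of $N$ and the projection. -/

namespace SpecialKahlerDomain

variable {m : ℕ} (P : SpecialKahlerDomain m)

theorem isComplexSubmanifold_mskHat (D C : Fin (m + 1) → ℂ) {r : ℕ}
    (hr : ∀ Z ∈ P.Mask, (GMat P.F D Z).rank = r) :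
    IsComplexSubmanifold (stdJ (Fin m → ℂ)) P.Msk (P.MskHat D C) r := by
  refine ⟨fun z hz => hz.1, fun z hz => ?_⟩
  rw [mskHat_eq] at hz ⊢
  obtain ⟨R, K, ψ, L, h1, h2, h3, h4, h5, h6⟩ := exists_straightening P.isOpen_Msk
    (P.contDiffOn_levelMap D) (fun z hz => (P.rank_fderiv_levelMap D hz).trans (hr _ hz)) hz.1
  rw [hz.2] at h6
  exact exists_fin_chart (IsBihol.mk h3 h4).isHolChart h5 h1 h2 h6

/-- On $M_{\rm sk}^\wedge$ the coefficients $D^AF_{AB}$ equal $C_B$, which removes the dependence on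
$z$. It serves both for tangent vectors and, with $w=g$, for the coordinate $w_A$ itself. -/
theorem linForm_eta {D C : Fin (m + 1) → ℂ} {z : Fin m → ℂ} (hz : z ∈ P.MskHat D C)
    (g w : IwasawaGroup (m + 1)) (v : Fin m → ℂ) :
    linForm D (P.eta (z, g) (v, w)) = groupForm D C w := by
  simp only [linForm_apply, eta, groupForm, LinearMap.coe_mk, AddHom.coe_mk, mul_sub,
    Finset.sum_sub_distrib, ← hz.2, Finset.mul_sum, Finset.sum_mul]
  congr 1
  rw [Finset.sum_comm]
  exact Finset.sum_congr rfl fun A _ => Finset.sum_congr rfl fun B _ => by ring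

/-- At a point of $M_{\rm sk}^\wedge$ the form is $D^A\eta_A$, and $\eta$ takes every value in
$\mathbb C^n$ because $N_{AB}$ is invertible. This yields both real codimension two and solvability.
-/
theorem groupForm_surjective {D C : Fin (m + 1) → ℂ} (hD : D ≠ 0) {z : Fin m → ℂ}
    (hz : z ∈ P.MskHat D C) : Function.Surjective (groupForm D C) := by
  intro c
  obtain ⟨w, hw⟩ := linForm_surjective hD c
  obtain ⟨Y, -, h2, -⟩ := P.exists_forms_eq (q := (z, 0)) ⟨hz.1, mem_univ _⟩ 0 w 0
  refine ⟨Y.2, ?_⟩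
  rw [← P.linForm_eta hz 0 Y.2 Y.1, ← hw, ← h2]

theorem N_eq (D C : Fin (m + 1) → ℂ) (Ct : ℂ) :
    P.N D C Ct = P.MskHat D C ×ˢ affineSet D C Ct := by
  ext q
  have h : q.1 ∈ P.MskHat D C → (∑ A, D A * P.eta q q A = Ct ↔ q.2 ∈ affineSet D C Ct) :=
    fun hq => by rw [← linForm_apply, mem_affineSet, ← P.linForm_eta hq q.2 q.2 q.1]
  constructor
  · rintro ⟨h1, h2, h3⟩
    exact ⟨⟨h1.1, h2⟩, (h ⟨h1.1, h2⟩).mp h3⟩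
  · rintro ⟨h1, h2⟩
    exact ⟨⟨h1.1, mem_univ _⟩, h1.2, (h h1).mpr h2⟩

/-- In the coordinates $(z,w,\tau)$, straightening the level set in $z$ and translating $w$ by a
solution of $D^Aw_A=\tilde C$ makes `N` linear: $r$ equations from $z$ and one from $w$. -/
theorem isComplexSubmanifold_N {e : (Fin m → ℂ) → Fin m → Fin m → ℂ} (he : P.IsVielbein e)
    {D C : Fin (m + 1) → ℂ} (hD : D ≠ 0) (Ct : ℂ) {r : ℕ}
    (hr : ∀ Z ∈ P.Mask, (GMat P.F D Z).rank = r) :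
    IsComplexSubmanifold (P.J3 e) P.M (P.N D C Ct) (r + 1) := by
  refine ⟨fun q hq => hq.1, fun q hq => ?_⟩
  rw [P.N_eq] at hq ⊢
  have hz := hq.1
  rw [mskHat_eq] at hz
  obtain ⟨R, K, ψ, L, h1, h2, h3, h4, h5, h6⟩ := exists_straightening P.isOpen_Msk
    (P.contDiffOn_levelMap D) (fun z hz => (P.rank_fderiv_levelMap D hz).trans (hr _ hz)) hz.1
  rw [hz.2, ← P.mskHat_eq] at h6
  obtain ⟨w₀, hw₀⟩ := linForm_surjective hD Ct
  have hc := ((P.isHolChart_holChart he).trans (IsBihol.mk h3 h4).prod_refl).trans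
    (isBihol_addRight ((0 : R × K), (-w₀, (0 : ℂ))))
  refine exists_fin_chart hc (L := L.prod ((LinearMap.ker (linForm D)).prod ⊤)) ?_ ?_ ?_ ?_
  · have := finrank_ker_linForm hD
    simp only [finrank_submodule_prod, Module.finrank_prod, finrank_top, Module.finrank_self,
      Module.finrank_fin_fun] at h5 ⊢
    omega
  · exact ⟨⟨⟨hz.1, mem_univ _⟩, h1, mem_univ _⟩, mem_univ _⟩
  · exact fun x hx => hx.1.1
  · refine OpenPartialHomeomorph.IsImage.image_eq fun x hx => ?_
    have h7 : ψ x.1 ∈ L ↔ x.1 ∈ P.MskHat D C :=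
      OpenPartialHomeomorph.IsImage.of_image_eq h6 hx.1.2.1
    have e1 : ∀ y : (R × K) × (Fin (m + 1) → ℂ) × ℂ, y ∈ L.prod ((LinearMap.ker (linForm D)).prod ⊤) ↔
        y.1 ∈ L ∧ linForm D y.2.1 = 0 := fun y => by simp [Submodule.mem_prod]
    refine (e1 _).trans ?_
    change ψ x.1 + 0 ∈ L ∧ linForm D (P.eta x x + -w₀) = 0 ↔ _
    rw [add_zero, map_add, map_neg, hw₀, add_neg_eq_zero]
    constructor
    · rintro ⟨ha, hb⟩
      refine ⟨h7.mp ha, ?_⟩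
      rw [mem_affineSet, ← hb, ← P.linForm_eta (h7.mp ha) x.2 x.2 x.1]
    · rintro ⟨ha, hb⟩
      refine ⟨h7.mpr ha, ?_⟩
      rw [mem_affineSet] at hb
      rw [← hb, ← P.linForm_eta ha x.2 x.2 x.1]

/-- The global holomorphic chart of the fibre `(G, J_G(p))`. -/
noncomputable def fibreChart {p : Fin m → ℂ} (hp : p ∈ P.Msk) :
    OpenPartialHomeomorph (IwasawaGroup (m + 1)) ((Fin (m + 1) → ℂ) × ℂ) where
  toFun g := (P.holCoord (p, g)).2
  invFun t := (P.holCoordInv (p, t)).2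
  source := univ
  target := {t | (p, t) ∈ P.holChart.target}
  map_source' g _ := P.holChart.map_source (x := (p, g)) ⟨hp, mem_univ _⟩
  map_target' t _ := mem_univ _
  left_inv' g _ := congrArg Prod.snd (P.holCoordInv_holCoord (q := (p, g)) ⟨hp, mem_univ _⟩)
  right_inv' t ht := congrArg Prod.snd (P.holCoord_holCoordInv ht.1 ht.2)
  open_source := isOpen_univ
  open_target := P.holChart.open_target.preimage (by fun_prop)
  continuousOn_toFun := continuous_snd.comp_continuousOn (P.holChart.continuousOn.comp
    (by fun_prop) fun g _ => ⟨hp, mem_univ _⟩)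
  continuousOn_invFun := continuous_snd.comp_continuousOn (P.holChart.symm.continuousOn.comp
    (by fun_prop) fun t ht => ht)

theorem isHolChart_fibreChart {e : (Fin m → ℂ) → Fin m → Fin m → ℂ} (he : P.IsVielbein e)
    {p : Fin m → ℂ} (hp : p ∈ P.Msk) : IsHolChart (P.JG e p) (P.fibreChart hp) where
  smooth := contDiff_snd.comp_contDiffOn (P.contDiffOn_holCoord.comp
    (contDiff_const.prodMk contDiff_id).contDiffOn fun g _ => ⟨hp, mem_univ _⟩)
  smooth_symm := contDiff_snd.comp_contDiffOn (P.contDiffOn_holCoordInv.comp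
    (contDiff_const.prodMk contDiff_id).contDiffOn fun t ht => ht)
  comm g _ w := by
    have hq : (p, g) ∈ P.M := ⟨hp, mem_univ _⟩
    have h0 : HasFDerivAt P.holChart (fderiv ℝ P.holChart (p, g)) (p, g) :=
      ((P.contDiffOn_holCoord.contDiffAt (P.isOpen_M.mem_nhds hq)).differentiableAt
        (by simp)).hasFDerivAt
    have h1 : HasFDerivAt (fun g => (P.holChart (p, g)).2) ((ContinuousLinearMap.snd ℝ _ _).comp
        ((fderiv ℝ P.holChart (p, g)).comp (ContinuousLinearMap.inr ℝ _ _))) g :=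
      hasFDerivAt_snd.comp g (h0.comp g (hasFDerivAt_prodMk_right p g))
    have h2 := (P.isHolChart_holChart he).comm (p, g) hq (0, w)
    rw [P.J3_apply he hp, smul_zero] at h2
    have h3 : fderiv ℝ (P.fibreChart hp) g = _ := h1.fderiv
    rw [h3]
    exact congrArg Prod.snd h2

theorem isComplexSubmanifold_affineSet {e : (Fin m → ℂ) → Fin m → Fin m → ℂ} (he : P.IsVielbein e)
    {D C : Fin (m + 1) → ℂ} (hD : D ≠ 0) {p : Fin m → ℂ} (hp : p ∈ P.MskHat D C) (c : ℂ) :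
    IsComplexSubmanifold (P.JG e p) univ (affineSet D C c) 1 := by
  refine ⟨subset_univ _, fun g _ => ?_⟩
  obtain ⟨w₀, hw₀⟩ := linForm_surjective hD c
  have hc := (P.isHolChart_fibreChart he hp.1).trans (isBihol_addRight (-w₀, (0 : ℂ)))
  refine exists_fin_chart hc (L := (LinearMap.ker (linForm D)).prod ⊤) ?_
    ⟨mem_univ _, mem_univ _⟩ (subset_univ _) ?_
  · have := finrank_ker_linForm hD
    simp only [finrank_submodule_prod, Module.finrank_prod, finrank_top, Module.finrank_self,
      Module.finrank_fin_fun]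
    omega
  · refine OpenPartialHomeomorph.IsImage.image_eq fun x _ => ?_
    have e1 : ∀ y : (Fin (m + 1) → ℂ) × ℂ, y ∈ (LinearMap.ker (linForm D)).prod ⊤ ↔
        linForm D y.1 = 0 := fun y => by simp [Submodule.mem_prod]
    refine (e1 _).trans ?_
    change linForm D (P.eta (p, x) (p, x) + -w₀) = 0 ↔ _
    rw [map_add, map_neg, hw₀, add_neg_eq_zero, P.linForm_eta hp, mem_affineSet]

theorem isHolomorphicSubmersion_fst {e : (Fin m → ℂ) → Fin m → Fin m → ℂ} (he : P.IsVielbein e)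
    (D C : Fin (m + 1) → ℂ) (Ct : ℂ) :
    IsHolomorphicSubmersion (P.J3 e) (P.N D C Ct) (stdJ (Fin m → ℂ)) (P.MskHat D C) Prod.fst := by
  rw [P.N_eq]
  refine ⟨⟨fun q hq => hq.1, contDiff_fst.contDiffOn, fun q hq =>
    ⟨_, hasFDerivWithinAt_fst, fun X _ => ?_⟩⟩, fun q hq => ⟨_, hasFDerivWithinAt_fst, ?_⟩⟩
  · exact (P.J3_forms he ⟨hq.1.1, mem_univ _⟩ X).1
  · apply le_antisymm
    · rw [TSpace, Submodule.map_span, Submodule.span_le]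
      rintro _ ⟨v, hv, rfl⟩
      have h1 := (hasFDerivWithinAt_fst (𝕜 := ℝ)
        (s := P.MskHat D C ×ˢ affineSet D C Ct) (p := q)).mapsTo_tangent_cone hv
      refine Submodule.subset_span (tangentConeAt_mono ?_ h1)
      rintro _ ⟨x, hx, rfl⟩
      exact hx.1
    -- The section $z\mapsto(z,g)$ maps $M_{\rm sk}^\wedge$ into the product and lifts its tangent
    -- vectors.
    · rw [TSpace, Submodule.span_le]
      intro v hv
      have h1 := ((hasFDerivAt_prodMk_left (𝕜 := ℝ) q.1 q.2).hasFDerivWithinAt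
        (s := P.MskHat D C)).mapsTo_tangent_cone hv
      refine ⟨_, Submodule.subset_span (tangentConeAt_mono ?_ h1), rfl⟩
      rintro _ ⟨x, hx, rfl⟩
      exact ⟨hx, hq.2⟩

end SpecialKahlerDomain

/-! ### The Lorentzian Hermitian form and its null vectors. -/

section Hermitian

/-- Orthonormal coordinates for a positive definite Hermitian form. -/
theorem exists_orthonormal_coordinates {W : Type*} [AddCommGroup W] [Module ℂ W]
    [FiniteDimensional ℂ W] (c : InnerProductSpace.Core ℂ W) :
    ∃ V : W ≃ₗ[ℂ] (Fin (Module.finrank ℂ W) → ℂ),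
      ∀ x, ∑ i, ‖V x i‖ ^ 2 = (c.inner x x).re := by
  let _ : NormedAddCommGroup W := c.toNormedAddCommGroup
  let _ : InnerProductSpace ℂ W := InnerProductSpace.ofCore c.toCore
  let b := stdOrthonormalBasis ℂ W
  refine ⟨b.repr.toLinearEquiv.trans (WithLp.linearEquiv 2 ℂ _), fun x => ?_⟩
  have h1 : ‖b.repr x‖ ^ 2 = ‖x‖ ^ 2 := by rw [b.repr.norm_map]
  rw [EuclideanSpace.norm_sq_eq] at h1
  exact h1.trans (norm_sq_eq_re_inner (𝕜 := ℂ) x)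

variable {n : ℕ}

/-- The Hermitian form `∑ N_AB Xᴬ conj(Yᴮ)` as a linear form in `X`. -/
noncomputable def hermL (F : (Fin n → ℂ) → ℂ) (Z Y : Fin n → ℂ) : (Fin n → ℂ) →ₗ[ℂ] ℂ where
  toFun X := herm F Z X Y
  map_add' X X' := by
    simp only [herm, Pi.add_apply, mul_add, add_mul, Finset.sum_add_distrib]
  map_smul' c X := by
    simp only [herm, Pi.smul_apply, smul_eq_mul, RingHom.id_apply, Finset.mul_sum]
    exact Finset.sum_congr rfl fun A _ => Finset.sum_congr rfl fun B _ => by ring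

theorem hermL_apply (F : (Fin n → ℂ) → ℂ) (Z X Y : Fin n → ℂ) : hermL F Z Y X = herm F Z X Y := rfl

theorem conj_herm {F : (Fin n → ℂ) → ℂ} {Z : Fin n → ℂ} (hF : AnalyticAt ℂ F Z) (X Y : Fin n → ℂ) :
    conj (herm F Z X Y) = herm F Z Y X := by
  simp only [herm, map_sum, map_mul, Complex.conj_conj, Complex.conj_ofReal]
  rw [Finset.sum_comm]
  refine Finset.sum_congr rfl fun A _ => Finset.sum_congr rfl fun B _ => ?_
  have : NMat F Z B A = NMat F Z A B := congrArg Complex.im (F2_comm hF B A)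
  rw [this]
  ring

theorem herm_conj (F : (Fin n → ℂ) → ℂ) (Z X Y : Fin n → ℂ) :
    herm F Z (fun A => conj (X A)) (fun A => conj (Y A)) = conj (herm F Z X Y) := by
  simp [herm]

end Hermitian

namespace SpecialKahlerDomain

variable {m : ℕ} (P : SpecialKahlerDomain m)

/-- Coordinates of `ℂⁿ` adapted to a null vector of the Lorentzian Hermitian form. -/
theorem exists_null_coordinates {Z : Fin (m + 1) → ℂ} (hZ : Z ∈ P.Mask) {D : Fin (m + 1) → ℂ}
    (hD : D ≠ 0) (hnull : herm P.F Z D D = 0) :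
    ∃ (k : ℕ) (_ : m = k + 1) (T : (Fin (m + 1) → ℂ) ≃ₗ[ℂ] ℂ × ℂ × (Fin k → ℂ)),
      (∀ X, (T X).1 = herm P.F Z X (fun A => conj (D A))) ∧
      ∀ X, herm P.F Z X (fun A => conj (D A)) = 0 →
        (herm P.F Z X X).re = -∑ i, ‖(T X).2.2 i‖ ^ 2 := by
  -- The vectors are conjugated because $D^A(NX)_A$ is the product of $X$ with $\bar D$. As $N$ is
  -- real, nullity and the sign conditions pass to the conjugates.
  have hF := P.holomorphic Z hZ
  set D' : Fin (m + 1) → ℂ := fun A => conj (D A) with hD'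
  set Z' : Fin (m + 1) → ℂ := fun A => conj (Z A) with hZ'
  have hD'0 : D' ≠ 0 := fun h => hD (funext fun A => by
    have := congrFun h A
    simpa [hD'] using this)
  have hnull' : herm P.F Z D' D' = 0 := by rw [herm_conj, hnull, map_zero]
  have hneg : ∀ X, X ≠ 0 → herm P.F Z X Z' = 0 → (herm P.F Z X X).re < 0 := by
    intro X hX h
    have h1 : X = fun A => conj (conj (X A)) := funext fun A => (Complex.conj_conj _).symm
    rw [h1, herm_conj] at h
    have := P.herm_neg Z hZ (fun A => conj (X A)) (fun h0 => hX (funext fun A => by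
      have := congrFun h0 A
      simpa using this)) ((map_eq_zero _).mp h)
    rw [h1, herm_conj, Complex.conj_re]
    exact this
  -- A non-zero null vector cannot lie in the complement of `Z'`, where the form is negative
  -- definite.
  have hDZ : herm P.F Z D' Z' ≠ 0 := fun h => by
    have := hneg D' hD'0 h
    rw [hnull'] at this
    simp at this
  have hZD : herm P.F Z Z' D' ≠ 0 := fun h => hDZ (by rw [← conj_herm hF, h, map_zero])
  -- `Y` contains the null vector `D'`, which is the radical of the form on `Y`; `W` is a complement
  -- of it in `Y` on which the form is definite.
  let Y : Submodule ℂ (Fin (m + 1) → ℂ) := LinearMap.ker (hermL P.F Z D')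
  let W : Submodule ℂ (Fin (m + 1) → ℂ) := LinearMap.ker (hermL P.F Z D') ⊓
    LinearMap.ker (hermL P.F Z Z')
  have hWneg : ∀ x : W, x ≠ 0 → (herm P.F Z x x).re < 0 := fun x hx =>
    hneg x (fun h => hx (Subtype.ext h)) x.2.2
  let c : InnerProductSpace.Core ℂ W :=
    -- The arguments are exchanged because the inner product is conjugate linear in its first
    -- argument.
    { inner := fun x y => -herm P.F Z y x
      conj_inner_symm := fun x y => by rw [map_neg, conj_herm hF]
      re_inner_nonneg := fun x => by
        by_cases hx : x = 0
        · subst hx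
          simp [herm]
        · have := hWneg x hx
          simp only [map_neg, RCLike.re_to_complex]
          linarith
      add_left := fun x y z => by
        have h1 : ∀ y, herm P.F Z z y = conj (hermL P.F Z z y) := fun y =>
          (conj_herm hF _ _).symm
        simp only [h1, Submodule.coe_add, map_add]
        ring
      smul_left := fun x y r => by
        have h1 : ∀ x, herm P.F Z y x = conj (hermL P.F Z y x) := fun x =>
          (conj_herm hF _ _).symm
        simp only [h1, Submodule.coe_smul, map_smul, smul_eq_mul, map_mul]
        ring
      definite := fun x hx => by
        by_contra h0
        have := hWneg x h0
        have hx' : herm P.F Z x x = 0 := neg_eq_zero.mp hx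
        rw [hx'] at this
        simp at this }
  obtain ⟨V, hV⟩ := exists_orthonormal_coordinates c
  -- `Y` is the direct sum of `W` and the line spanned by `D'`
  have hproj : ∀ X : Y, (X : Fin (m + 1) → ℂ) -
      (herm P.F Z X Z' / herm P.F Z D' Z') • D' ∈ W := by
    intro X
    have hX : hermL P.F Z D' X = 0 := X.2
    constructor
    · change hermL P.F Z D' _ = 0
      rw [map_sub, map_smul, hX, hermL_apply P.F Z D' D', hnull']
      simp
    · change hermL P.F Z Z' _ = 0
      rw [map_sub, map_smul, hermL_apply, hermL_apply, smul_eq_mul, div_mul_cancel₀ _ hDZ, sub_self]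
  let pr : Y →ₗ[ℂ] W := LinearMap.codRestrict W
    (Y.subtype - (LinearMap.toSpanSingleton ℂ (Fin (m + 1) → ℂ) D') ∘ₗ
      ((herm P.F Z D' Z')⁻¹ • (hermL P.F Z Z') ∘ₗ Y.subtype)) fun X => by
        have := hproj X
        rw [div_eq_inv_mul] at this
        exact this
  have hpr : ∀ X : Y, (X : Fin (m + 1) → ℂ) =
      (pr X : Fin (m + 1) → ℂ) + ((herm P.F Z D' Z')⁻¹ * herm P.F Z X Z') • D' := fun X =>
    (sub_add_cancel _ _).symm
  obtain ⟨π, hπ⟩ := LinearMap.exists_leftInverse_of_injective Y.subtype Y.ker_subtype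
  have hπ' : ∀ X : Y, π X = X := fun X => congrArg (fun T => T X) hπ
  -- The coordinates are the product with `D'`, the coefficient along `D'` and orthonormal
  -- coordinates on `W`. The last two are extended from `Y` by an arbitrary linear projection `π`.
  let T₀ : (Fin (m + 1) → ℂ) →ₗ[ℂ] ℂ × ℂ × (Fin (Module.finrank ℂ W) → ℂ) :=
    (hermL P.F Z D').prod (((herm P.F Z D' Z')⁻¹ • (hermL P.F Z Z') ∘ₗ Y.subtype ∘ₗ π).prod
      (V.toLinearMap ∘ₗ pr ∘ₗ π))
  have hinj : Function.Injective T₀ := by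
    rw [injective_iff_map_eq_zero]
    intro X hX
    have h1 : hermL P.F Z D' X = 0 := congrArg Prod.fst hX
    have hXY : π X = ⟨X, h1⟩ := hπ' ⟨X, h1⟩
    have h2 : (herm P.F Z D' Z')⁻¹ * herm P.F Z (π X) Z' = 0 := congrArg (fun t => t.2.1) hX
    have h3 : V (pr (π X)) = 0 := congrArg (fun t => t.2.2) hX
    have h4 := hpr (π X)
    rw [h2, (map_eq_zero_iff V V.injective).mp h3, hXY] at h4
    simpa using h4
  -- The products with `D'` and `Z'` are independent functionals; in particular the existence of a
  -- null vector forces $m\ge1$.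
  have hdim : m + 1 = Module.finrank ℂ W + 2 := by
    have hsurj : LinearMap.range ((hermL P.F Z D').prod (hermL P.F Z Z')) = ⊤ := by
      rw [LinearMap.range_eq_top]
      rintro ⟨s, t⟩
      refine ⟨(s / herm P.F Z Z' D') • Z' + ((t - s / herm P.F Z Z' D' * herm P.F Z Z' Z') /
        herm P.F Z D' Z') • D', Prod.ext ?_ ?_⟩
      · change hermL P.F Z D' _ = s
        rw [map_add, map_smul, map_smul, hermL_apply, hermL_apply, hnull']
        simp [hZD]
      · change hermL P.F Z Z' _ = t
        rw [map_add, map_smul, map_smul, hermL_apply, hermL_apply]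
        simp [hDZ]
    have h := LinearMap.finrank_range_add_finrank_ker ((hermL P.F Z D').prod (hermL P.F Z Z'))
    rw [hsurj, LinearMap.ker_prod, finrank_top] at h
    change _ + Module.finrank ℂ W = _ at h
    simp only [Module.finrank_prod, Module.finrank_self, Module.finrank_fin_fun] at h
    omega
  refine ⟨Module.finrank ℂ W, by omega, LinearEquiv.ofInjectiveOfFinrankEq T₀ hinj ?_,
    fun X => rfl, fun X hX => ?_⟩
  · simp only [Module.finrank_prod, Module.finrank_self, Module.finrank_fin_fun]
    omega
  · have hXY : π X = ⟨X, hX⟩ := hπ' ⟨X, hX⟩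
    have h4 := hpr ⟨X, hX⟩
    set x : W := pr ⟨X, hX⟩ with hx
    set d := (herm P.F Z D' Z')⁻¹ * herm P.F Z X Z' with hd
    have hTx : (LinearEquiv.ofInjectiveOfFinrankEq T₀ hinj (by
        simp only [Module.finrank_prod, Module.finrank_self, Module.finrank_fin_fun]
        omega) X).2.2 = V x := congrArg (fun t => V (pr t)) hXY
    rw [hTx, hV]
    change _ = -(-herm P.F Z x x).re
    have hxD : herm P.F Z x D' = 0 := x.2.1
    have hDx : herm P.F Z D' x = 0 := by rw [← conj_herm hF, hxD, map_zero]
    have h4' : X = (x : Fin (m + 1) → ℂ) + d • D' := h4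
    -- `D'` is orthogonal to all of `Y`, so the component along it does not contribute.
    have e1 : herm P.F Z X X = herm P.F Z x x := by
      have a1 : herm P.F Z X X = herm P.F Z x X + d * herm P.F Z D' X := by
        rw [← hermL_apply, ← hermL_apply, ← hermL_apply, ← smul_eq_mul, ← map_smul, ← map_add, ← h4']
      have a2 : herm P.F Z D' X = 0 := by rw [← conj_herm hF, hX, map_zero]
      have a3 : herm P.F Z x X = herm P.F Z x x := by
        rw [← conj_herm hF, ← hermL_apply, h4', map_add, map_smul, hermL_apply, hermL_apply, hDx,
          smul_zero, add_zero, conj_herm hF]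
      rw [a1, a2, a3, mul_zero, add_zero]
    rw [e1, Complex.neg_re, neg_neg]

end SpecialKahlerDomain

/-! ### The Cayley transform. -/

section Cayley

variable {k : ℕ}

/-- The Cayley transform from the Siegel domain `∑ |vᵢ|² < Re σ` to the unit ball. -/
noncomputable def siegelToBall (x : ℂ × (Fin k → ℂ)) : Fin (k + 1) → ℂ :=
  Fin.cons (α := fun _ => ℂ) ((x.1 - 1) / (x.1 + 1)) fun i => 2 * x.2 i / (x.1 + 1)

/-- The inverse Cayley transform. -/
noncomputable def ballToSiegel (y : Fin (k + 1) → ℂ) : ℂ × (Fin k → ℂ) :=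
  ((1 + y 0) / (1 - y 0), fun i => y i.succ / (1 - y 0))

/-- The identity $|\sigma+1|^2-|\sigma-1|^2=4\operatorname{Re}\sigma$ is decisive; the factor 2 in
the components of $v$ matches its 4. -/
theorem siegelToBall_mem_iff {x : ℂ × (Fin k → ℂ)} (hx : x.1 + 1 ≠ 0) :
    siegelToBall x ∈ unitBall (k + 1) ↔ ∑ i, ‖x.2 i‖ ^ 2 < x.1.re := by
  have hpos : 0 < ‖x.1 + 1‖ ^ 2 := by positivity
  have h1 : ∑ i, ‖siegelToBall x i‖ ^ 2 =
      (‖x.1 - 1‖ ^ 2 + 4 * ∑ i, ‖x.2 i‖ ^ 2) / ‖x.1 + 1‖ ^ 2 := by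
    rw [Fin.sum_univ_succ, add_div, Finset.mul_sum, Finset.sum_div]
    simp only [siegelToBall, Fin.cons_zero, Fin.cons_succ, norm_div, norm_mul, div_pow, mul_pow]
    norm_num
  have h2 : ‖x.1 + 1‖ ^ 2 - ‖x.1 - 1‖ ^ 2 = 4 * x.1.re := by
    simp only [← Complex.normSq_eq_norm_sq, Complex.normSq_apply, Complex.add_re, Complex.add_im,
      Complex.sub_re, Complex.sub_im, Complex.one_re, Complex.one_im]
    ring
  change ∑ i, ‖siegelToBall x i‖ ^ 2 < 1 ↔ _
  rw [h1, div_lt_one hpos]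
  constructor <;> intro h <;> linarith

theorem ballToSiegel_siegelToBall {x : ℂ × (Fin k → ℂ)} (hx : x.1 + 1 ≠ 0) :
    ballToSiegel (siegelToBall x) = x := by
  have h : 1 - (x.1 - 1) / (x.1 + 1) = 2 / (x.1 + 1) := by
    field_simp
    ring
  refine Prod.ext ?_ (funext fun i => ?_)
  · simp only [ballToSiegel, siegelToBall, Fin.cons_zero, h]
    field_simp
    ring
  · simp only [ballToSiegel, siegelToBall, Fin.cons_zero, Fin.cons_succ, h]
    field_simp

theorem ballToSiegel_add_one {y : Fin (k + 1) → ℂ} (hy : 1 - y 0 ≠ 0) :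
    (ballToSiegel y).1 + 1 = 2 / (1 - y 0) := by
  simp only [ballToSiegel]
  field_simp
  ring

theorem siegelToBall_ballToSiegel {y : Fin (k + 1) → ℂ} (hy : 1 - y 0 ≠ 0) :
    siegelToBall (ballToSiegel y) = y := by
  funext i
  refine Fin.cases ?_ (fun i => ?_) i
  · simp only [siegelToBall, Fin.cons_zero, ballToSiegel_add_one hy]
    simp only [ballToSiegel]
    field_simp
    ring
  · simp only [siegelToBall, Fin.cons_succ, ballToSiegel_add_one hy]
    simp only [ballToSiegel]
    field_simp

theorem one_sub_ne_zero_of_mem_unitBall {y : Fin (k + 1) → ℂ} (hy : y ∈ unitBall (k + 1)) :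
    1 - y 0 ≠ 0 := by
  intro h
  have h1 : ‖y 0‖ ^ 2 ≤ ∑ i, ‖y i‖ ^ 2 :=
    Finset.single_le_sum (f := fun i => ‖y i‖ ^ 2) (fun i _ => by positivity) (Finset.mem_univ 0)
  rw [← sub_eq_zero.mp h] at h1
  have h2 : ∑ i, ‖y i‖ ^ 2 < 1 := hy
  simp at h1
  linarith

theorem contDiffAt_siegelToBall {x : ℂ × (Fin k → ℂ)} (hx : x.1 + 1 ≠ 0) :
    ContDiffAt ℂ ∞ (siegelToBall (k := k)) x := by
  refine contDiffAt_pi.mpr fun i => ?_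
  refine Fin.cases ?_ (fun i => ?_) i
  · exact (contDiffAt_fst.sub contDiffAt_const).div (contDiffAt_fst.add contDiffAt_const) hx
  · exact (contDiffAt_const.mul ((contDiff_apply ℂ ℂ i).contDiffAt.comp x contDiffAt_snd)).div
      (contDiffAt_fst.add contDiffAt_const) hx

theorem contDiffAt_ballToSiegel {y : Fin (k + 1) → ℂ} (hy : 1 - y 0 ≠ 0) :
    ContDiffAt ℂ ∞ (ballToSiegel (k := k)) y := by
  have h : ∀ i, ContDiffAt ℂ ∞ (fun y : Fin (k + 1) → ℂ => y i) y := fun i =>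
    (contDiff_apply ℂ ℂ i).contDiffAt
  exact ((contDiffAt_const.add (h 0)).div (contDiffAt_const.sub (h 0)) hy).prodMk
    (contDiffAt_pi.mpr fun i => (h i.succ).div (contDiffAt_const.sub (h 0)) hy)

end Cayley

/-! ### The fibres as a ball times a line. -/

namespace SpecialKahlerDomain

variable {m : ℕ} (P : SpecialKahlerDomain m)

/-- The Hermitian form `∑ N_AB Xᴬ conj(Xᴮ)` is constant on `MskHat`. -/
theorem herm_eq_of_sum_eq {Z Z' : Fin (m + 1) → ℂ} (hZ : Z ∈ P.Mask) (hZ' : Z' ∈ P.Mask)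
    {D : Fin (m + 1) → ℂ} (h : ∀ B, ∑ A, D A * F2 P.F Z A B = ∑ A, D A * F2 P.F Z' A B) :
    herm P.F Z D D = herm P.F Z' D D := by
  -- By symmetry of $F_{AB}$ the form at $D$ is $\operatorname{Im}(D^AF_{AB}\bar D^B)$, which
  -- depends on $Z$ only through $D^AF_{AB}$.
  have key : ∀ Z ∈ P.Mask, herm P.F Z D D =
      ((∑ B, (∑ A, D A * F2 P.F Z A B) * conj (D B)).im : ℂ) := by
    intro Z hZ
    have h1 : herm P.F Z D D = (1 / (2 * I)) * (∑ B, (∑ A, D A * F2 P.F Z A B) * conj (D B) -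
        conj (∑ B, (∑ A, D A * F2 P.F Z A B) * conj (D B))) := by
      have h2 : conj (∑ B, (∑ A, D A * F2 P.F Z A B) * conj (D B)) =
          ∑ B, ∑ A, D A * conj (F2 P.F Z A B) * conj (D B) := by
        simp only [map_sum, map_mul, Complex.conj_conj, Finset.sum_mul]
        rw [Finset.sum_comm]
        refine Finset.sum_congr rfl fun A _ => Finset.sum_congr rfl fun B _ => ?_
        rw [F2_comm (P.holomorphic Z hZ)]
        ring
      rw [h2]
      simp only [Finset.sum_mul, ← Finset.sum_sub_distrib, Finset.mul_sum, herm]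
      rw [Finset.sum_comm]
      refine Finset.sum_congr rfl fun B _ => Finset.sum_congr rfl fun A _ => ?_
      have h3 : (NMat P.F Z A B : ℂ) = (1 / (2 * I)) * (F2 P.F Z A B - conj (F2 P.F Z A B)) := by
        rw [Complex.sub_conj]
        simp only [NMat, Matrix.of_apply]
        field_simp
        push_cast
        ring
      rw [h3]
      ring
    rw [h1, Complex.sub_conj]
    field_simp
    push_cast
    ring
  rw [key Z hZ, key Z' hZ']
  simp only [h]

theorem herm_self_re (F : (Fin (m + 1) → ℂ) → ℂ) (Z X : Fin (m + 1) → ℂ) :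
    (herm F Z X X).re = ∑ A, (X A).re * (NMat F Z).mulVec (fun B => (X B).re) A +
      ∑ A, (X A).im * (NMat F Z).mulVec (fun B => (X B).im) A := by
  rw [← Finset.sum_add_distrib, herm, Complex.re_sum]
  refine Finset.sum_congr rfl fun A _ => ?_
  simp only [Complex.re_sum, Matrix.mulVec, dotProduct, Finset.mul_sum]
  rw [← Finset.sum_add_distrib]
  refine Finset.sum_congr rfl fun B _ => ?_
  simp
  ring

/-- Holomorphic coordinates `(s, c, σ, v)` on the fibres of `M`, in which `S` is given by
`s = 0` and `∑ |vᵢ|² < Re σ`. -/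
theorem exists_fibre_coordinates {p : Fin m → ℂ} (hp : p ∈ P.Msk) {D : Fin (m + 1) → ℂ}
    (hD : D ≠ 0) (hnull : herm P.F (hom p) D D = 0) (Ct : ℂ) :
    ∃ (k : ℕ) (_ : m = k + 1) (α : (Fin (m + 1) → ℂ) × ℂ → ℂ × ℂ × ℂ × (Fin k → ℂ))
      (β : ℂ × ℂ × ℂ × (Fin k → ℂ) → (Fin (m + 1) → ℂ) × ℂ),
      ContDiff ℂ ∞ α ∧ ContDiff ℂ ∞ β ∧ (∀ t, β (α t) = t) ∧ (∀ y, α (β y) = y) ∧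
      (∀ t, (α t).1 = linForm D t.1 - Ct) ∧
      ∀ t, linForm D t.1 = Ct → 2 * P.holHeight (p, t) =
        (α t).2.2.1.re - ∑ i, ‖(α t).2.2.2 i‖ ^ 2 := by
  obtain ⟨k, hk, T₀, hT1, hT2⟩ := P.exists_null_coordinates hp hD hnull
  obtain ⟨w₀, hw₀⟩ := linForm_surjective hD Ct
  have hN : IsUnit (P.NAB p).det := isUnit_iff_ne_zero.mpr (P.det_NAB_ne_zero hp)
  have hsym : ∀ A B, P.NAB p A B = P.NAB p B A := fun A B =>
    congrArg Complex.im (P.FAB_comm hp A B)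
  have hdet : ((P.NAB p).map Complex.ofReal).det ≠ 0 := by
    have : ((P.NAB p).map Complex.ofReal).det = ((P.NAB p).det : ℂ) :=
      (RingHom.map_det Complex.ofRealHom (P.NAB p)).symm
    rw [this]
    exact ofReal_ne_zero.mpr (P.det_NAB_ne_zero hp)
  -- Multiplication by $N_{AB}(p)$; the substitution $w=w_0+N\xi$ turns $N^{-1}$ in the height
  -- function into $N$.
  let M₀ : (Fin (m + 1) → ℂ) ≃ₗ[ℂ] (Fin (m + 1) → ℂ) :=
    LinearEquiv.ofInjectiveEndo ((P.NAB p).map Complex.ofReal).mulVecLin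
      (Matrix.mulVec_injective_iff_isUnit.mpr
        ((Matrix.isUnit_iff_isUnit_det _).mpr (isUnit_iff_ne_zero.mpr hdet)))
  let M := M₀.toContinuousLinearEquiv
  let T := T₀.toContinuousLinearEquiv
  have hM : ∀ X A, M X A = ∑ B, (P.NAB p A B : ℂ) * X B := fun X A => rfl
  have hT : ∀ X, T X = T₀ X := fun X => rfl
  have hMlin : ∀ X, linForm D (M X) = (T X).1 := by
    intro X
    rw [hT, hT1, linForm_apply, herm]
    simp only [hM, Finset.mul_sum, Complex.conj_conj]
    rw [Finset.sum_comm]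
    refine Finset.sum_congr rfl fun A _ => Finset.sum_congr rfl fun B _ => ?_
    rw [hsym B A]
    change D B * ((P.NAB p A B : ℂ) * X A) = (P.NAB p A B : ℂ) * X A * D B
    ring
  let y₀ : Fin (m + 1) → ℝ := fun A => (w₀ A).im
  let a₀ : Fin (m + 1) → ℝ := (P.NAB p)⁻¹.mulVec y₀
  -- With $x=\operatorname{Im}\xi$ the height is $\operatorname{Re}\tau+a_0y_0+2y_0x+xNx$, and
  -- $2xNx=N(\xi,\bar\xi)-\operatorname{Re}(\xi N\xi)$. `Q` collects the terms that are real parts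
  -- of holomorphic functions, leaving twice the height equal to
  -- $2\operatorname{Re}(\tau-Q)+N(\xi,\bar\xi)$.
  let Q : (Fin (m + 1) → ℂ) → ℂ := fun X => -((∑ A, a₀ A * y₀ A : ℝ) : ℂ) +
    2 * I * ∑ A, (y₀ A : ℂ) * X A + (1 / 2) * ∑ A, X A * M X A
  have hQ : ContDiff ℂ ∞ Q := by
    refine (contDiff_const.add (contDiff_const.mul (ContDiff.sum fun A _ =>
      contDiff_const.mul (contDiff_apply ℂ ℂ A)))).add (contDiff_const.mul (ContDiff.sum
      fun A _ => (contDiff_apply ℂ ℂ A).mul ((contDiff_apply ℂ ℂ A).comp M.contDiff)))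
  have hξ : ContDiff ℂ ∞ (fun t : (Fin (m + 1) → ℂ) × ℂ => M.symm (t.1 - w₀)) :=
    M.symm.contDiff.comp (contDiff_fst.sub contDiff_const)
  have hη : ContDiff ℂ ∞ (fun y : ℂ × ℂ × ℂ × (Fin k → ℂ) => T.symm (y.1, y.2.1, y.2.2.2)) :=
    T.symm.contDiff.comp (by fun_prop)
  refine ⟨k, hk, fun t => ((T (M.symm (t.1 - w₀))).1, (T (M.symm (t.1 - w₀))).2.1,
      2 * (t.2 - Q (M.symm (t.1 - w₀))), (T (M.symm (t.1 - w₀))).2.2),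
    fun y => (M (T.symm (y.1, y.2.1, y.2.2.2)) + w₀,
      y.2.2.1 / 2 + Q (T.symm (y.1, y.2.1, y.2.2.2))), ?_, ?_, ?_, ?_, ?_, ?_⟩
  · have h1 := T.contDiff.comp hξ
    exact (contDiff_fst.comp h1).prodMk ((contDiff_fst.comp (contDiff_snd.comp h1)).prodMk
      ((contDiff_const.mul (contDiff_snd.sub (hQ.comp hξ))).prodMk
        (contDiff_snd.comp (contDiff_snd.comp h1))))
  · exact ((M.contDiff.comp hη).add contDiff_const).prodMk
      (ContDiff.add (by fun_prop) (hQ.comp hη))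
  · intro t
    set ξ := M.symm (t.1 - w₀) with hξd
    change (M (T.symm (T ξ)) + w₀, 2 * (t.2 - Q ξ) / 2 + Q (T.symm (T ξ))) = t
    rw [T.symm_apply_apply, hξd, M.apply_symm_apply, sub_add_cancel]
    exact Prod.ext rfl (by ring)
  · intro y
    simp only [add_sub_cancel_right, ContinuousLinearEquiv.symm_apply_apply,
      ContinuousLinearEquiv.apply_symm_apply]
    exact Prod.ext rfl (Prod.ext rfl (Prod.ext (by ring) rfl))
  · intro t
    change (T (M.symm (t.1 - w₀))).1 = _
    rw [← hMlin, ContinuousLinearEquiv.apply_symm_apply, map_sub, hw₀]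
  · intro t ht
    set ξ := M.symm (t.1 - w₀) with hξd
    have hw : t.1 = w₀ + M ξ := by
      rw [hξd, ContinuousLinearEquiv.apply_symm_apply]
      abel
    have h0 : herm P.F (hom p) ξ (fun A => conj (D A)) = 0 := by
      rw [← hT1, ← hT, ← hMlin, hξd, ContinuousLinearEquiv.apply_symm_apply, map_sub, ht, hw₀,
        sub_self]
    change _ = (2 * (t.2 - Q ξ)).re - ∑ i, ‖(T ξ).2.2 i‖ ^ 2
    rw [hT, sub_eq_add_neg, ← hT2 ξ h0, herm_self_re]
    let x : Fin (m + 1) → ℝ := fun A => (ξ A).im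
    let x' : Fin (m + 1) → ℝ := fun A => (ξ A).re
    have him : (fun A => (t.1 A).im) = y₀ + (P.NAB p).mulVec x := by
      funext A
      rw [hw]
      simp [hM, y₀, x, Matrix.mulVec, dotProduct]
    have hre : ∀ A, (M ξ A).re = (P.NAB p).mulVec x' A := fun A => by
      simp [hM, x', Matrix.mulVec, dotProduct]
    have him' : ∀ A, (M ξ A).im = (P.NAB p).mulVec x A := fun A => by
      simp [hM, x, Matrix.mulVec, dotProduct]
    have hsol : P.solA p t.1 = -(a₀ + x) := by
      rw [solA, him, Matrix.mulVec_add, Matrix.mulVec_mulVec, Matrix.nonsing_inv_mul _ hN,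
        Matrix.one_mulVec]
    have hNa : (P.NAB p).mulVec a₀ = y₀ := by
      rw [Matrix.mulVec_mulVec, Matrix.mul_nonsing_inv _ hN, Matrix.one_mulVec]
    have hcross : ∑ A, a₀ A * (P.NAB p).mulVec x A = ∑ A, y₀ A * x A := by
      rw [← hNa]
      simp only [Matrix.mulVec, dotProduct, Finset.mul_sum, Finset.sum_mul]
      rw [Finset.sum_comm]
      refine Finset.sum_congr rfl fun A _ => Finset.sum_congr rfl fun B _ => ?_
      rw [hsym A B]
      ring
    have hheight : P.holHeight (p, t) = t.2.re + ∑ A, a₀ A * y₀ A + 2 * ∑ A, y₀ A * x A +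
        ∑ A, x A * (P.NAB p).mulVec x A := by
      have hs : ∀ A, P.solA p t.1 A * (t.1 A).im = -(a₀ A * y₀ A +
          a₀ A * (P.NAB p).mulVec x A + y₀ A * x A + x A * (P.NAB p).mulVec x A) := by
        intro A
        rw [congrFun hsol A, congrFun him A]
        simp only [Pi.neg_apply, Pi.add_apply]
        ring
      simp only [holHeight, hs, Finset.sum_neg_distrib, Finset.sum_add_distrib, hcross]
      ring
    have hQre : (Q ξ).re = -∑ A, a₀ A * y₀ A - 2 * ∑ A, y₀ A * x A +
        (1 / 2) * (∑ A, x' A * (P.NAB p).mulVec x' A - ∑ A, x A * (P.NAB p).mulVec x A) := by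
      have e1 : (2 * I * ∑ A, (y₀ A : ℂ) * ξ A).re = -(2 * ∑ A, y₀ A * x A) := by
        simp [Complex.im_sum, x]
      have e2 : ((1 / 2 : ℂ) * ∑ A, ξ A * M ξ A).re =
          (1 / 2) * (∑ A, x' A * (P.NAB p).mulVec x' A - ∑ A, x A * (P.NAB p).mulVec x A) := by
        rw [show (1 / 2 : ℂ) = ((1 / 2 : ℝ) : ℂ) by simp, Complex.re_ofReal_mul, Complex.re_sum,
          ← Finset.sum_sub_distrib]
        congr 1
        refine Finset.sum_congr rfl fun A _ => ?_
        rw [Complex.mul_re, hre, him']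
      simp only [Q, Complex.add_re, Complex.neg_re, Complex.ofReal_re, e1, e2]
      ring
    have h2 : (2 * (t.2 - Q ξ)).re = 2 * (t.2.re - (Q ξ).re) := by simp
    rw [hheight, h2, hQre]
    change _ = _ + (∑ A, x' A * (P.NAB p).mulVec x' A + ∑ A, x A * (P.NAB p).mulVec x A)
    ring

/-- In the coordinates $(s,c,\sigma,v)$ the fibre is $s=0$ with $(\sigma,v)$ in a Siegel domain. The
coordinate $c$ along the radical is unrestricted and provides the factor $\mathbb C$. -/
theorem areBiholomorphic_fibre {e : (Fin m → ℂ) → Fin m → Fin m → ℂ} (he : P.IsVielbein e)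
    {D C : Fin (m + 1) → ℂ} (hD : D ≠ 0) {p : Fin m → ℂ} (hp : p ∈ P.MskHat D C)
    (hnull : herm P.F (hom p) D D = 0) (Ct : ℂ) :
    AreBiholomorphic (P.JG e p) (affineSet D C Ct) (stdJ ((Fin m → ℂ) × ℂ))
      (unitBall m ×ˢ univ) := by
  obtain ⟨k, rfl, α, β, hα, hβ, hβα, hαβ, h1, h2⟩ := P.exists_fibre_coordinates hp.1 hD hnull Ct
  have hψ := P.isHolChart_fibreChart he hp.1
  set ψ := P.fibreChart hp.1 with hψd
  have hlin : ∀ g, linForm D (ψ g).1 = groupForm D C g := fun g => P.linForm_eta hp g g p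
  have htar : ∀ t, t ∈ ψ.target ↔ 0 < P.holHeight (p, t) := fun t =>
    ⟨fun h => h.2, fun h => ⟨hp.1, h⟩⟩
  have hsie : ∀ g ∈ affineSet D C Ct,
      (α (ψ g)).1 = 0 ∧ ∑ i, ‖(α (ψ g)).2.2.2 i‖ ^ 2 < (α (ψ g)).2.2.1.re := by
    intro g hg
    have h3 : linForm D (ψ g).1 = Ct := by rw [hlin]; exact hg
    refine ⟨by rw [h1, h3, sub_self], ?_⟩
    have h4 := h2 _ h3
    have h5 := (htar _).mp (ψ.map_source (mem_univ g))
    linarith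
  -- Here $\operatorname{Re}\sigma>0$, so the pole $\sigma=-1$ of the Cayley transform is avoided.
  have hne : ∀ g ∈ affineSet D C Ct, (α (ψ g)).2.2.1 + 1 ≠ 0 := by
    intro g hg h
    have h3 := (hsie g hg).2
    have h4 : 0 ≤ ∑ i, ‖(α (ψ g)).2.2.2 i‖ ^ 2 := Finset.sum_nonneg fun i _ => by positivity
    rw [eq_neg_of_add_eq_zero_left h] at h3
    simp at h3
    linarith
  let K : (Fin (k + 1 + 1) → ℂ) × ℂ → (Fin (k + 1) → ℂ) × ℂ := fun t =>
    (siegelToBall (α t).2.2, (α t).2.1)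
  let H : (Fin (k + 1) → ℂ) × ℂ → (Fin (k + 1 + 1) → ℂ) × ℂ := fun y =>
    β (0, y.2, ballToSiegel y.1)
  have hball : ∀ y ∈ unitBall (k + 1) ×ˢ (univ : Set ℂ),
      H y ∈ ψ.target ∧ linForm D (H y).1 = Ct := by
    intro y hy
    have hy0 := one_sub_ne_zero_of_mem_unitBall hy.1
    have h3 : linForm D (H y).1 = Ct := by
      have := h1 (H y)
      rw [hαβ] at this
      exact (sub_eq_zero.mp this.symm)
    refine ⟨(htar _).mpr ?_, h3⟩
    have h4 := h2 _ h3
    rw [hαβ] at h4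
    have h5 : (ballToSiegel y.1).1 + 1 ≠ 0 := by
      rw [ballToSiegel_add_one hy0]
      exact div_ne_zero two_ne_zero hy0
    have h6 := (siegelToBall_mem_iff h5).mp (by rw [siegelToBall_ballToSiegel hy0]; exact hy.1)
    simp only at h4
    linarith
  have hmem : ∀ y ∈ unitBall (k + 1) ×ˢ (univ : Set ℂ), ψ.symm (H y) ∈ affineSet D C Ct := by
    intro y hy
    obtain ⟨h3, h4⟩ := hball y hy
    rw [mem_affineSet, ← hlin, ψ.right_inv h3, h4]
  refine ⟨fun g => K (ψ g), ?_, fun y => ψ.symm (H y), ?_, ?_, ?_⟩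
  · refine isHolomorphicMap_comp_chart hψ (subset_univ _) (fun g hg => ?_) fun g hg => ?_
    · refine ContDiffAt.prodMk ?_ (contDiff_fst.comp (contDiff_snd.comp hα)).contDiffAt
      exact (contDiffAt_siegelToBall (hne g hg)).comp (ψ g)
        (contDiff_snd.comp (contDiff_snd.comp hα)).contDiffAt
    · exact ⟨(siegelToBall_mem_iff (hne g hg)).mpr (hsie g hg).2, mem_univ _⟩
  · refine isHolomorphicMap_symm_comp hψ (fun y hy => ?_) (fun y hy => (hball y hy).1) hmem
    refine hβ.contDiffAt.comp y (contDiffAt_const.prodMk (contDiffAt_snd.prodMk ?_))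
    exact (contDiffAt_ballToSiegel (one_sub_ne_zero_of_mem_unitBall hy.1)).comp y contDiffAt_fst
  · intro g hg
    have h3 : H (K (ψ g)) = ψ g := by
      change β (0, (α (ψ g)).2.1, ballToSiegel (siegelToBall (α (ψ g)).2.2)) = ψ g
      rw [ballToSiegel_siegelToBall (hne g hg)]
      conv_rhs => rw [← hβα (ψ g)]
      congr 1
      exact Prod.ext (hsie g hg).1.symm rfl
    change ψ.symm (H (K (ψ g))) = g
    rw [h3, ψ.left_inv (mem_univ g)]
  · intro y hy
    have hy0 := one_sub_ne_zero_of_mem_unitBall hy.1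
    change K (ψ (ψ.symm (H y))) = y
    rw [ψ.right_inv (hball y hy).1]
    change (siegelToBall (α (β _)).2.2, (α (β _)).2.1) = y
    rw [hαβ]
    exact Prod.ext (siegelToBall_ballToSiegel hy0) rfl

end SpecialKahlerDomain

/-! ### The embedding into $M_{\rm sk}^\wedge\times\mathbb C^n$. -/

theorem linForm_update {n : ℕ} (D y : Fin n → ℂ) (A : Fin n) (c : ℂ) :
    linForm D (Function.update y A c) = linForm D y + D A * (c - y A) := by
  have h : Function.update y A c = y + Pi.single A (c - y A) := by
    funext B
    by_cases hB : B = A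
    · subst hB
      simp
    · simp [hB]
  rw [h, map_add]
  congr 1
  simp [linForm_apply, Pi.single_apply]

theorem contDiff_update {n : ℕ} {E : Type*} [NormedAddCommGroup E] [NormedSpace ℂ E] (A : Fin n)
    {y : E → Fin n → ℂ} {c : E → ℂ} (hy : ContDiff ℂ ∞ y) (hc : ContDiff ℂ ∞ c) :
    ContDiff ℂ ∞ (fun x => Function.update (y x) A (c x)) := by
  refine contDiff_pi.mpr fun B => ?_
  by_cases hB : B = A
  · subst hB
    simpa using hc
  · simpa [hB] using contDiff_pi.mp hy B

namespace SpecialKahlerDomain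

variable {m : ℕ} (P : SpecialKahlerDomain m)

theorem exists_embedding {e : (Fin m → ℂ) → Fin m → Fin m → ℂ} (he : P.IsVielbein e)
    {D : Fin (m + 1) → ℂ} (hD : D ≠ 0) (C : Fin (m + 1) → ℂ) (Ct : ℂ) :
    ∃ Ψ : Ambient m → (Fin m → ℂ) × (Fin (m + 1) → ℂ),
      (∀ q ∈ P.N D C Ct, (Ψ q).1 = q.1) ∧
      (∃ U : Set ((Fin m → ℂ) × (Fin (m + 1) → ℂ)), IsOpen U ∧
        Ψ '' P.N D C Ct = U ∩ (P.MskHat D C ×ˢ Set.univ)) ∧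
      IsBiholomorphicMap (P.J3 e) (P.N D C Ct)
        (stdJ ((Fin m → ℂ) × (Fin (m + 1) → ℂ))) (Ψ '' P.N D C Ct) Ψ := by
  obtain ⟨A, hA⟩ : ∃ A, D A ≠ 0 := by
    by_contra! h
    exact hD (funext h)
  have hψ := P.isHolChart_holChart he
  set ψ := P.holChart with hψd
  -- Since $D^A\ne0$ for this index, $w_A$ is redundant on `N`, and `K` stores $\tau$ in its slot.
  -- The map `H` reads $\tau$ off and restores $w_A$ from the linear equation.
  let K : (Fin m → ℂ) × (Fin (m + 1) → ℂ) × ℂ → (Fin m → ℂ) × (Fin (m + 1) → ℂ) := fun t =>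
    (t.1, Function.update t.2.1 A t.2.2)
  let w : (Fin (m + 1) → ℂ) → Fin (m + 1) → ℂ := fun y =>
    Function.update y A ((Ct - linForm D y) / D A + y A)
  let H : (Fin m → ℂ) × (Fin (m + 1) → ℂ) → (Fin m → ℂ) × (Fin (m + 1) → ℂ) × ℂ := fun y =>
    (y.1, w y.2, y.2 A)
  have hw : ∀ y, linForm D (w y) = Ct := fun y => by
    rw [linForm_update]
    field_simp
    ring
  have hKs : ContDiff ℂ ∞ K := contDiff_fst.prodMk
    (contDiff_update A (contDiff_fst.comp contDiff_snd) (contDiff_snd.comp contDiff_snd))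
  have happ : ContDiff ℂ ∞ (fun y : Fin (m + 1) → ℂ => y A) := contDiff_apply ℂ ℂ A
  have hws : ContDiff ℂ ∞ w := contDiff_update A contDiff_id
    (((contDiff_const.sub (LinearMap.toContinuousLinearMap (linForm D)).contDiff).div_const _).add
      happ)
  have hHs : ContDiff ℂ ∞ H := contDiff_fst.prodMk
    ((hws.comp contDiff_snd).prodMk (happ.comp contDiff_snd))
  have hKH : ∀ y, K (H y) = y := fun y => by
    simp [K, H, w]
  have hHK : ∀ t, linForm D t.2.1 = Ct → H (K t) = t := by
    intro t ht
    have h1 : linForm D (Function.update t.2.1 A t.2.2) = Ct + D A * (t.2.2 - t.2.1 A) := by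
      rw [linForm_update, ht]
    have h2 : w (Function.update t.2.1 A t.2.2) = t.2.1 := by
      simp only [w, h1, Function.update_self, Function.update_idem]
      have : (Ct - (Ct + D A * (t.2.2 - t.2.1 A))) / D A + t.2.2 = t.2.1 A := by
        field_simp
        ring
      rw [this, Function.update_eq_self]
    simp [H, K, h2]
  have hNs : P.N D C Ct ⊆ ψ.source := fun q hq => hq.1
  have hlin : ∀ q ∈ P.N D C Ct, H (K (ψ q)) = ψ q := by
    intro q hq
    rw [P.N_eq] at hq
    exact hHK _ ((P.linForm_eta hq.1 q.2 q.2 q.1).trans hq.2)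
  have hback : ∀ y : (Fin m → ℂ) × (Fin (m + 1) → ℂ), H y ∈ ψ.target → y.1 ∈ P.MskHat D C →
      ψ.symm (H y) ∈ P.N D C Ct := by
    intro y hy hy1
    rw [P.N_eq]
    refine ⟨hy1, ?_⟩
    have h1 : (ψ (ψ.symm (H y))).2.1 = w y.2 := by rw [ψ.right_inv hy]
    have h2 := P.linForm_eta hy1 (ψ.symm (H y)).2 (ψ.symm (H y)).2 (ψ.symm (H y)).1
    rw [mem_affineSet, ← h2, ← hw y.2, ← h1]
    rfl
  -- `H` always lands in $D^Aw_A=\tilde C$, so membership of the image needs only the open condition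
  -- of the chart's target and $z\in M_{\rm sk}^\wedge$.
  have himg : (fun q => K (ψ q)) '' P.N D C Ct = (H ⁻¹' ψ.target) ∩ (P.MskHat D C ×ˢ univ) := by
    ext y
    constructor
    · rintro ⟨q, hq, rfl⟩
      refine ⟨?_, ?_, mem_univ _⟩
      · change H (K (ψ q)) ∈ ψ.target
        rw [hlin q hq]
        exact ψ.map_source (hNs hq)
      · rw [P.N_eq] at hq
        exact hq.1
    · rintro ⟨h1, h2, -⟩
      refine ⟨ψ.symm (H y), hback y h1 h2, ?_⟩
      change K (ψ (ψ.symm (H y))) = y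
      rw [ψ.right_inv h1, hKH]
  refine ⟨fun q => K (ψ q), fun q _ => rfl, ⟨H ⁻¹' ψ.target,
    ψ.open_target.preimage hHs.continuous, himg⟩, ?_, fun y => ψ.symm (H y), ?_, ?_, ?_⟩
  · exact isHolomorphicMap_comp_chart hψ hNs (fun q _ => hKs.contDiffAt) (mapsTo_image _ _)
  · rw [himg]
    exact isHolomorphicMap_symm_comp hψ (fun y _ => hHs.contDiffAt) (fun y hy => hy.1)
      fun y hy => hback y hy.1 hy.2.1
  · intro q hq
    change ψ.symm (H (K (ψ q))) = q
    rw [hlin q hq, ψ.left_inv (hNs hq)]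
  · intro y hy
    rw [himg] at hy
    change K (ψ (ψ.symm (H y))) = y
    rw [ψ.right_inv hy.1, hKH]

end SpecialKahlerDomain

end CMap

/-! ### The proposition. -/

theorem mainTheorem5 (m : ℕ) (P : SpecialKahlerDomain m)
    (e : (Fin m → ℂ) → Fin m → Fin m → ℂ) (he : P.IsVielbein e)
    (Z₀ : Fin (m + 1) → ℂ) (hZ₀ : Z₀ ∈ P.Mask)
    (D : Fin (m + 1) → ℂ) (hD : D ≠ 0) (hnull : herm P.F Z₀ D D = 0)
    (r : ℕ) (hr : ∀ Z ∈ P.Mask, (GMat P.F D Z).rank = r)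
    (C : Fin (m + 1) → ℂ) (hC : ∀ B, C B = ∑ A, D A * F2 P.F Z₀ A B) (Ct : ℂ) :
    (P.MskHat D C).Nonempty ∧
    IsComplexSubmanifold (stdJ (Fin m → ℂ)) P.Msk (P.MskHat D C) r ∧
    IsComplexSubmanifold (P.J3 e) P.M (P.N D C Ct) (r + 1) ∧
    (∃ x : IwasawaGroup (m + 1), x ∈ affineSet D C Ct) ∧
    ∃ Ghat : Subgroup (IwasawaGroup (m + 1)),
      (Ghat : Set (IwasawaGroup (m + 1))) = affineSet D C 0 ∧
      IsSmoothSubmanifold (Ghat : Set (IwasawaGroup (m + 1))) 2 ∧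
      ∀ x ∈ affineSet D C Ct, ∀ S : Set (IwasawaGroup (m + 1)),
        S = (fun h => x * h) '' (Ghat : Set (IwasawaGroup (m + 1))) →
        IsSmoothSubmanifold S 2 ∧
        P.N D C Ct = P.MskHat D C ×ˢ S ∧
        (∀ p ∈ P.MskHat D C, IsComplexSubmanifold (P.JG e p) Set.univ S 1) ∧
        (∀ p ∈ P.MskHat D C, ∀ s ∈ S,
          ∀ v ∈ TSpace (P.MskHat D C) p, ∀ w ∈ TSpace S s,
            P.J3 e (p, s) (v, w) = (Complex.I • v, P.JG e p s w) ∧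
            Complex.I • v ∈ TSpace (P.MskHat D C) p ∧
            P.JG e p s w ∈ TSpace S s ∧ P.JG e p s (P.JG e p s w) = -w) ∧
        ContDiffOn ℝ ∞ (fun q : Ambient m => P.JG e q.1 q.2) (P.MskHat D C ×ˢ S) ∧
        (∀ p ∈ P.MskHat D C, IwasawaGroup.IsLeftInvariantOn Ghat
          (IwasawaGroup.pullLeft x (P.JG e p))) ∧
        IsHolomorphicSubmersion (P.J3 e) (P.N D C Ct) (stdJ (Fin m → ℂ)) (P.MskHat D C)
          Prod.fst ∧
        (∀ p ∈ P.MskHat D C, AreBiholomorphic (P.JG e p) S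
          (stdJ ((Fin m → ℂ) × ℂ)) (unitBall m ×ˢ Set.univ)) ∧
        ∃ Ψ : Ambient m → (Fin m → ℂ) × (Fin (m + 1) → ℂ),
          (∀ q ∈ P.N D C Ct, (Ψ q).1 = q.1) ∧
          (∃ U : Set ((Fin m → ℂ) × (Fin (m + 1) → ℂ)), IsOpen U ∧
            Ψ '' P.N D C Ct = U ∩ (P.MskHat D C ×ˢ Set.univ)) ∧
          IsBiholomorphicMap (P.J3 e) (P.N D C Ct)
            (stdJ ((Fin m → ℂ) × (Fin (m + 1) → ℂ))) (Ψ '' P.N D C Ct) Ψ := by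
  have hne := P.mskHat_nonempty hZ₀ hC
  have hsub := P.isComplexSubmanifold_mskHat D C hr
  obtain ⟨p₀, hp₀⟩ := hne
  have hsurj := P.groupForm_surjective hD hp₀
  refine ⟨⟨p₀, hp₀⟩, hsub, P.isComplexSubmanifold_N he hD Ct hr, hsurj Ct,
    affineSubgroup D C, rfl, isSmoothSubmanifold_affineSet D C hsurj 0, fun x hx S hS => ?_⟩
  -- The coset is the whole solution set and does not depend on the chosen solution `x`.
  rw [image_mul_affineSubgroup D C hx] at hS
  subst hS
  -- Nullity of $D$ is assumed at $Z_0$ only; it spreads to all of $M_{\rm sk}^\wedge$ because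
  -- $D^AF_{AB}=C_B$ there.
  have hnull' : ∀ p ∈ P.MskHat D C, herm P.F (hom p) D D = 0 := fun p hp =>
    (P.herm_eq_of_sum_eq hp.1 hZ₀ fun B => (hp.2 B).trans (hC B)).trans hnull
  refine ⟨isSmoothSubmanifold_affineSet D C hsurj Ct, P.N_eq D C Ct,
    fun p hp => P.isComplexSubmanifold_affineSet he hD hp Ct, fun p hp s hs v hv w hw =>
      ⟨P.J3_apply he hp.1 v w, hsub.map_mem_tspace hp hv,
        (P.isComplexSubmanifold_affineSet he hD hp Ct).map_mem_tspace hs hw,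
        P.JG_JG he hp.1 s w⟩,
    (P.contDiffOn_JG he).mono fun q hq => ⟨hq.1.1, mem_univ _⟩, fun p hp => ?_,
    P.isHolomorphicSubmersion_fst he D C Ct,
    fun p hp => P.areBiholomorphic_fibre he hD hp (hnull' p hp) Ct, P.exists_embedding he hD C Ct⟩
  -- Pulling back to $G^\wedge$ returns $J_G(p)$ itself, and $G^\wedge$ is a complex hypersurface by
  -- the case $\tilde C=0$.
  rw [P.pullLeft_JG he hp.1]
  exact ⟨fun h hh w hw => (P.isComplexSubmanifold_affineSet he hD hp 0).map_mem_tspace hh hw,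
    fun k _ h _ w _ => P.JG_mul he hp.1 k h w⟩
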